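/- Let $k$ be an algebraically closed field. Let $\mathcal C$ be a $k$-linear semisimple abelian monoidal category (with $k$-bilinear tensor product) with finite dimensional Hom-spaces and finitely many isomorphism classes of simple objects. Let $R$ be a finite dimensional semisimple $k$-algebra, let $\mathrm{Rep}(R)$ be the category of finitely generated left $R$-modules, and let $\mathrm{Rep}(R)$ be endowed with a structure of module category over $\mathcal C$, that is, a $k$-bilinear (hence exact) bifunctor $\otimes:\mathcal C\times \mathrm{Rep}(R)\to\mathrm{Rep}(R)$ with coherent associativity and unit isomorphisms. Put $F(X)=X\otimes R$ for $X\in\mathcal C$; this is an $R$-bimodule, $F(X)\otimes_R M\cong X\otimes M$ for $M\in\mathrm{Rep}(R)$, and $F$ is a monoidal functor from $\mathcal C$ to $R$-bimodules. A separability idempotent of $R$ is an element $e=\sum_i e_i\otimes f_i\in R\otimes R$ with $\sum_i e_if_i=1$ and $\sum_i re_i\otimes f_i=\sum_i e_i\otimes f_ir$ for $r\in R$; it is nondegenerate if there is a linear form $\varphi:R\to k$ with $\sum_i\varphi(e_i)f_i=1=\sum_i e_i\varphi(f_i)$. Then $R$ has a nondegenerate separability idempotent, and for every such $e$ (with its form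 $\varphi$) the following holds. (1) Let $H$ be the algebra of natural endomorphisms of the functor $X\mapsto F(X)$ from $\mathcal C$ to vector spaces. Then $H$ is a (finite dimensional) weak bialgebra with the following comultiplication and counit: $\Delta(h)$ acts on $F(X)\otimes F(Y)$ as the composition of the projection $F(X)\otimes F(Y)\to F(X)\otimes_RF(Y)\cong F(X\otimes Y)$, of $h_{X\otimes Y}$, and of the embedding $F(X\otimes Y)\cong F(X)\otimes_RF(Y)\to F(X)\otimes F(Y)$, $x\otimes y\mapsto\sum_i xe_i\otimes f_iy$; and $\varepsilon(h)=\varphi(h_{\mathbf 1}(1))$, where $F(\mathbf 1)\cong R$. (2) Let $\mathcal C^*$ be the monoidal category of $k$-linear module functors $T:\mathrm{Rep}(R)\to\mathrm{Rep}(R)$, i.e. functors with natural morphisms $c_{X,M}:T(X\otimes M)\to X\otimes T(M)$ (not assumed to be invertible) compatible with the associativity and unit isomorphisms, with composition $T\otimes T'=T\circ T'$ as tensor product. Let $\mathrm{Rep}(H^*)$ be the monoidal category of finite dimensional left $H$-comodules (equivalently, right modules over the dual weak bialgebra $H^*$), in which the tensor product of $V$ and $W$ is the image of the idempotent $v\otimes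 w\mapsto\varepsilon(v_{(-1)}w_{(-1)})\,v_{(0)}\otimes w_{(0)}$ of $V\otimes W$ with the diagonal coaction, and the unit object is $H_t=\{\varepsilon(1_{(1)}h)1_{(2)}: h\in H\}$ with coaction $\Delta$. Then there is a monoidal equivalence of categories $\mathcal C^*\simeq\mathrm{Rep}(H^*)$. It is natural: it sends $T$ to a comodule naturally identified as a vector space with $T(R)$, whose coaction $v\mapsto v_{(-1)}\otimes v_{(0)}$ satisfies $c_{X,R}(v\otimes x)=v_{(-1)}x\otimes v_{(0)}$ for $X\in\mathcal C$, $x\in F(X)$, where $v\otimes x\in T(R)\otimes_RF(X)\cong T(F(X))$ and $v_{(-1)}x\otimes v_{(0)}\in F(X)\otimes_RT(R)\cong X\otimes T(R)$. -/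

import Mathlib

open CategoryTheory MonoidalCategory
open scoped TensorProduct

universe u v w u₁ v₁ u₂ v₂

set_option linter.unusedSectionVars false
set_option linter.unusedSimpArgs false

/-- A weak bialgebra over `k`: a finite dimensional `k`-vector space `H` which is an associative
unital algebra and a coassociative counital coalgebra, such that `Δ` is multiplicative,
`(Δ ⊗ id)Δ(1) = (Δ(1) ⊗ 1)(1 ⊗ Δ(1)) = (1 ⊗ Δ(1))(Δ(1) ⊗ 1)` and
`ε(fgh) = ε(f g₍₁₎) ε(g₍₂₎ h) = ε(f g₍₂₎) ε(g₍₁₎ h)`.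
It is not required that `Δ(1) = 1 ⊗ 1` or that `ε` is multiplicative. -/
class WeakBialgebra (k : Type u) (H : Type w) [Field k] [Ring H] [Algebra k H] extends
    Coalgebra k H where
  finiteDimensional : FiniteDimensional k H
  comul_mul : ∀ g h : H, Coalgebra.comul (R := k) (g * h) =
    Coalgebra.comul (R := k) g * Coalgebra.comul (R := k) h
  comul_one_left :
    (Coalgebra.comul (R := k) (A := H)).rTensor H (Coalgebra.comul (R := k) (1 : H)) =
      (Coalgebra.comul (R := k) (1 : H) ⊗ₜ[k] (1 : H)) *
        (TensorProduct.assoc k H H H).symm ((1 : H) ⊗ₜ[k] Coalgebra.comul (R := k) (1 : H))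
  comul_one_right :
    (Coalgebra.comul (R := k) (A := H)).rTensor H (Coalgebra.comul (R := k) (1 : H)) =
      (TensorProduct.assoc k H H H).symm ((1 : H) ⊗ₜ[k] Coalgebra.comul (R := k) (1 : H)) *
        (Coalgebra.comul (R := k) (1 : H) ⊗ₜ[k] (1 : H))
  counit_mul_left : ∀ f g h : H, Coalgebra.counit (R := k) (f * g * h) =
    LinearMap.mul' k k (TensorProduct.map
      ((Coalgebra.counit (R := k) (A := H)) ∘ₗ LinearMap.mulLeft k f)
      ((Coalgebra.counit (R := k) (A := H)) ∘ₗ LinearMap.mulRight k h)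
      (Coalgebra.comul (R := k) g))
  counit_mul_right : ∀ f g h : H, Coalgebra.counit (R := k) (f * g * h) =
    LinearMap.mul' k k (TensorProduct.map
      ((Coalgebra.counit (R := k) (A := H)) ∘ₗ LinearMap.mulRight k h)
      ((Coalgebra.counit (R := k) (A := H)) ∘ₗ LinearMap.mulLeft k f)
      (Coalgebra.comul (R := k) g))

namespace WeakBialgebra

noncomputable section

open Coalgebra TensorProduct


lemma subtype_comp_rangeRestrict {k M N : Type*} [Field k] [AddCommGroup M] [Module k M]
    [AddCommGroup N] [Module k N] (f : M →ₗ[k] N) :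
    (LinearMap.range f).subtype ∘ₗ f.rangeRestrict = f := rfl

section Semi

variable {k : Type u} {H : Type w} [Field k] [Ring H] [Algebra k H] [WeakBialgebra k H]
variable {P P' Q Q' S : Type*} [AddCommGroup P] [Module k P] [AddCommGroup P'] [Module k P']
  [AddCommGroup Q] [Module k Q] [AddCommGroup Q'] [Module k Q'] [AddCommGroup S] [Module k S]

/-- Coassociativity of a map `δ : P → H ⊗ P`. -/
def IsCoassoc (δ : P →ₗ[k] H ⊗[k] P) : Prop :=
  δ.lTensor H ∘ₗ δ = (TensorProduct.assoc k H H P).toLinearMap ∘ₗ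
    (comul (R := k) (A := H)).rTensor P ∘ₗ δ

/-- `f` commutes with the coactions. -/
def IsColinear (δP : P →ₗ[k] H ⊗[k] P) (δQ : Q →ₗ[k] H ⊗[k] Q) (f : P →ₗ[k] Q) : Prop :=
  δQ ∘ₗ f = f.lTensor H ∘ₗ δP

/-- The idempotent `p ↦ ε(p₋₁) p₀`. -/
def counitPart (δ : P →ₗ[k] H ⊗[k] P) : P →ₗ[k] P :=
  (TensorProduct.lid k P).toLinearMap ∘ₗ (counit (R := k) (A := H)).rTensor P ∘ₗ δ

/-- `(h ⊗ p) ⊗ (g ⊗ q) ↦ h g ⊗ (p ⊗ q)`. -/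
def mulMap (k : Type u) (H : Type w) [Field k] [Ring H] [Algebra k H]
    (P Q : Type*) [AddCommGroup P] [Module k P] [AddCommGroup Q] [Module k Q] :
    (H ⊗[k] P) ⊗[k] (H ⊗[k] Q) →ₗ[k] H ⊗[k] (P ⊗[k] Q) :=
  (LinearMap.mul' k H).rTensor (P ⊗[k] Q) ∘ₗ
    (TensorProduct.tensorTensorTensorComm k H P H Q).toLinearMap

@[simp] lemma mulMap_tmul (h g : H) (p : P) (q : Q) :
    mulMap k H P Q ((h ⊗ₜ p) ⊗ₜ (g ⊗ₜ q)) = (h * g) ⊗ₜ (p ⊗ₜ q) := by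
  simp [mulMap]

/-- The diagonal coaction `p ⊗ q ↦ p₋₁ q₋₁ ⊗ (p₀ ⊗ q₀)`. -/
def tensorCoaction (δP : P →ₗ[k] H ⊗[k] P) (δQ : Q →ₗ[k] H ⊗[k] Q) :
    P ⊗[k] Q →ₗ[k] H ⊗[k] (P ⊗[k] Q) :=
  mulMap k H P Q ∘ₗ TensorProduct.map δP δQ

variable {δP : P →ₗ[k] H ⊗[k] P} {δQ : Q →ₗ[k] H ⊗[k] Q} {δS : S →ₗ[k] H ⊗[k] S}
  {δP' : P' →ₗ[k] H ⊗[k] P'} {δQ' : Q' →ₗ[k] H ⊗[k] Q'}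

lemma lTensor_counitPart (h : IsCoassoc δP) : (counitPart δP).lTensor H ∘ₗ δP = δP := by
  have h2 := congrArg (fun f => ((TensorProduct.lid k P).toLinearMap ∘ₗ
    (counit (R := k) (A := H)).rTensor P).lTensor H ∘ₗ f) h
  have e1 : (counitPart δP).lTensor H ∘ₗ δP = ((TensorProduct.lid k P).toLinearMap ∘ₗ
    (counit (R := k) (A := H)).rTensor P).lTensor H ∘ₗ (δP.lTensor H ∘ₗ δP) := by
    ext x; simp [counitPart, LinearMap.lTensor_comp]
  rw [e1, h]
  have key : ((TensorProduct.lid k P).toLinearMap ∘ₗ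
    (counit (R := k) (A := H)).rTensor P).lTensor H ∘ₗ ((TensorProduct.assoc k H H P).toLinearMap ∘ₗ
    (comul (R := k) (A := H)).rTensor P) = LinearMap.id := by
    apply TensorProduct.ext'
    intro g p
    have : ∀ t : H ⊗[k] H, (((TensorProduct.lid k P).toLinearMap ∘ₗ
        (counit (R := k) (A := H)).rTensor P).lTensor H) (TensorProduct.assoc k H H P (t ⊗ₜ p)) =
        (TensorProduct.rid k H ((counit (R := k) (A := H)).lTensor H t)) ⊗ₜ p := by
      intro t
      induction t with
      | zero => simp only [LinearMap.map_zero, LinearEquiv.map_zero, TensorProduct.zero_tmul,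
      TensorProduct.tmul_zero, mul_zero, zero_mul]
      | add a b ha hb => simp only [TensorProduct.add_tmul, map_add, ha, hb]
      | tmul a b => simp [TensorProduct.smul_tmul]
    have h3 := this (comul g)
    simp only [Coalgebra.lTensor_counit_comul] at h3
    simpa using h3
  rw [← LinearMap.comp_assoc (δP), ← LinearMap.comp_assoc (δP), key, LinearMap.id_comp]

lemma comp_counitPart (h : IsCoassoc δP) : δP ∘ₗ counitPart δP = δP := by
  have e1 : δP ∘ₗ counitPart δP = ((TensorProduct.lid k (H ⊗[k] P)).toLinearMap ∘ₗ
    (counit (R := k) (A := H)).rTensor (H ⊗[k] P)) ∘ₗ (δP.lTensor H ∘ₗ δP) := by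
    ext x
    simp only [counitPart, LinearMap.comp_apply, LinearEquiv.coe_coe]
    generalize δP x = t
    induction t with
    | zero => simp only [LinearMap.map_zero, LinearEquiv.map_zero, TensorProduct.zero_tmul,
      TensorProduct.tmul_zero, mul_zero, zero_mul]
    | add a b ha hb => simp only [LinearMap.map_add, LinearEquiv.map_add, ha, hb]
    | tmul a b => simp
  rw [e1, h]
  have key : ((TensorProduct.lid k (H ⊗[k] P)).toLinearMap ∘ₗ
    (counit (R := k) (A := H)).rTensor (H ⊗[k] P)) ∘ₗ ((TensorProduct.assoc k H H P).toLinearMap ∘ₗ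
    (comul (R := k) (A := H)).rTensor P) = LinearMap.id := by
    apply TensorProduct.ext'
    intro g p
    have : ∀ t : H ⊗[k] H, (((TensorProduct.lid k (H ⊗[k] P)).toLinearMap ∘ₗ
        (counit (R := k) (A := H)).rTensor (H ⊗[k] P))) (TensorProduct.assoc k H H P (t ⊗ₜ p)) =
        (TensorProduct.lid k H ((counit (R := k) (A := H)).rTensor H t)) ⊗ₜ p := by
      intro t
      induction t with
      | zero => simp only [LinearMap.map_zero, LinearEquiv.map_zero, TensorProduct.zero_tmul,
      TensorProduct.tmul_zero, mul_zero, zero_mul]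
      | add a b ha hb => simp only [TensorProduct.add_tmul, map_add, ha, hb]
      | tmul a b => simp [TensorProduct.smul_tmul']
    have h3 := this (comul g)
    simp only [Coalgebra.rTensor_counit_comul] at h3
    simpa using h3
  rw [← LinearMap.comp_assoc (δP), ← LinearMap.comp_assoc (δP), key, LinearMap.id_comp]

lemma IsColinear.counitPart_comp {f : P →ₗ[k] Q} (hf : IsColinear δP δQ f) :
    counitPart δQ ∘ₗ f = f ∘ₗ counitPart δP := by
  have : counitPart δQ ∘ₗ f = (TensorProduct.lid k Q).toLinearMap ∘ₗ
      (counit (R := k) (A := H)).rTensor Q ∘ₗ (δQ ∘ₗ f) := rfl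
  rw [this, hf]
  ext x
  simp only [counitPart, LinearMap.comp_apply, LinearEquiv.coe_coe]
  generalize δP x = t
  induction t with
  | zero => simp only [LinearMap.map_zero, LinearEquiv.map_zero, TensorProduct.zero_tmul,
      TensorProduct.tmul_zero, mul_zero, zero_mul]
  | add a b ha hb => simp only [LinearMap.map_add, LinearEquiv.map_add, ha, hb]
  | tmul a b => simp

lemma IsColinear.comp {f : P →ₗ[k] Q} {g : Q →ₗ[k] S} (hg : IsColinear δQ δS g)
    (hf : IsColinear δP δQ f) : IsColinear δP δS (g ∘ₗ f) := by
  unfold IsColinear at *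
  rw [← LinearMap.comp_assoc, hg, LinearMap.comp_assoc, hf, LinearMap.lTensor_comp,
    LinearMap.comp_assoc]

lemma isColinear_id : IsColinear δP δP LinearMap.id := by
  simp [IsColinear]

lemma isColinear_counitPart (h : IsCoassoc δP) : IsColinear δP δP (counitPart δP) := by
  rw [IsColinear, comp_counitPart h, lTensor_counitPart h]

lemma IsColinear.symm {f : P ≃ₗ[k] Q} (hf : IsColinear δP δQ f.toLinearMap) :
    IsColinear δQ δP f.symm.toLinearMap := by
  unfold IsColinear at *
  have h2 : ∀ x, δP x = f.symm.toLinearMap.lTensor H (f.toLinearMap.lTensor H (δP x)) := by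
    intro x
    rw [← LinearMap.comp_apply, ← LinearMap.lTensor_comp]
    simp
  ext x
  have h3 := LinearMap.congr_fun hf (f.symm x)
  simp only [LinearMap.comp_apply, LinearEquiv.coe_coe, LinearEquiv.apply_symm_apply] at h3 ⊢
  rw [h2, h3]

lemma IsColinear.map {f : P →ₗ[k] P'} {g : Q →ₗ[k] Q'} (hf : IsColinear δP δP' f)
    (hg : IsColinear δQ δQ' g) :
    IsColinear (tensorCoaction δP δQ) (tensorCoaction δP' δQ') (TensorProduct.map f g) := by
  have e : ∀ s t, mulMap k H P' Q' ((f.lTensor H s) ⊗ₜ (g.lTensor H t)) =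
      (TensorProduct.map f g).lTensor H (mulMap k H P Q (s ⊗ₜ t)) := by
    intro s t
    induction s with
    | zero => simp only [LinearMap.map_zero, LinearEquiv.map_zero, TensorProduct.zero_tmul,
      TensorProduct.tmul_zero, mul_zero, zero_mul]
    | add a b ha hb => simp only [LinearMap.map_add, LinearEquiv.map_add, TensorProduct.add_tmul, ha, hb]
    | tmul a p =>
      induction t with
      | zero => simp only [LinearMap.map_zero, LinearEquiv.map_zero, TensorProduct.zero_tmul,
      TensorProduct.tmul_zero, mul_zero, zero_mul]
      | add a b ha hb => simp only [LinearMap.map_add, LinearEquiv.map_add, TensorProduct.tmul_add, ha, hb]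
      | tmul b q => simp
  apply TensorProduct.ext'
  intro p q
  have h1 := LinearMap.congr_fun hf p
  have h2 := LinearMap.congr_fun hg q
  simp only [LinearMap.comp_apply] at h1 h2
  simp [tensorCoaction, h1, h2, e]

lemma isColinear_assoc :
    IsColinear (tensorCoaction (tensorCoaction δP δQ) δS)
      (tensorCoaction δP (tensorCoaction δQ δS)) (TensorProduct.assoc k P Q S).toLinearMap := by
  have e : ∀ r s t, mulMap k H P (Q ⊗[k] S) (r ⊗ₜ (mulMap k H Q S (s ⊗ₜ t))) =
      (TensorProduct.assoc k P Q S).toLinearMap.lTensor H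
        (mulMap k H (P ⊗[k] Q) S (mulMap k H P Q (r ⊗ₜ s) ⊗ₜ t)) := by
    intro r s t
    induction r with
    | zero => simp only [LinearMap.map_zero, LinearEquiv.map_zero, TensorProduct.zero_tmul,
      TensorProduct.tmul_zero, mul_zero, zero_mul]
    | add a b ha hb => simp only [LinearMap.map_add, LinearEquiv.map_add, TensorProduct.add_tmul, ha, hb]
    | tmul a p =>
      induction s with
      | zero => simp only [LinearMap.map_zero, LinearEquiv.map_zero, TensorProduct.zero_tmul,
      TensorProduct.tmul_zero, mul_zero, zero_mul]
      | add a b ha hb => simp only [LinearMap.map_add, LinearEquiv.map_add, TensorProduct.tmul_add, TensorProduct.add_tmul, ha, hb]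
      | tmul b q =>
        induction t with
        | zero => simp only [LinearMap.map_zero, LinearEquiv.map_zero, TensorProduct.zero_tmul,
      TensorProduct.tmul_zero, mul_zero, zero_mul]
        | add a b ha hb => simp only [LinearMap.map_add, LinearEquiv.map_add, TensorProduct.tmul_add, ha, hb]
        | tmul b q => simp [mul_assoc]
  apply TensorProduct.ext_threefold
  intro p q s
  simp [tensorCoaction, e]

lemma isCoassoc_tensor (hP : IsCoassoc δP) (hQ : IsCoassoc δQ) :
    IsCoassoc (tensorCoaction δP δQ) := by
  have e1 : ∀ s t, (tensorCoaction δP δQ).lTensor H (mulMap k H P Q (s ⊗ₜ t)) =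
      (mulMap k H P Q).lTensor H (mulMap k H (H ⊗[k] P) (H ⊗[k] Q)
        (δP.lTensor H s ⊗ₜ δQ.lTensor H t)) := by
    intro s t
    induction s with
    | zero => simp only [LinearMap.map_zero, LinearEquiv.map_zero, TensorProduct.zero_tmul,
      TensorProduct.tmul_zero, mul_zero, zero_mul]
    | add a b ha hb => simp only [LinearMap.map_add, LinearEquiv.map_add, TensorProduct.add_tmul, ha, hb]
    | tmul a p =>
      induction t with
      | zero => simp only [LinearMap.map_zero, LinearEquiv.map_zero, TensorProduct.zero_tmul,
      TensorProduct.tmul_zero, mul_zero, zero_mul]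
      | add a b ha hb => simp only [LinearMap.map_add, LinearEquiv.map_add, TensorProduct.tmul_add, ha, hb]
      | tmul b q => simp [tensorCoaction]
  have e3 : ∀ (a b : H ⊗[k] H) (p : P) (q : Q), (mulMap k H P Q).lTensor H
      (mulMap k H (H ⊗[k] P) (H ⊗[k] Q)
      (TensorProduct.assoc k H H P (a ⊗ₜ p) ⊗ₜ TensorProduct.assoc k H H Q (b ⊗ₜ q))) =
      TensorProduct.assoc k H H (P ⊗[k] Q) ((a * b) ⊗ₜ (p ⊗ₜ q)) := by
    intro a b p q
    induction a with
    | zero => simp only [LinearMap.map_zero, LinearEquiv.map_zero, TensorProduct.zero_tmul,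
      TensorProduct.tmul_zero, mul_zero, zero_mul]
    | add a b ha hb => simp only [LinearMap.map_add, LinearEquiv.map_add, TensorProduct.add_tmul, add_mul, ha, hb]
    | tmul a a' =>
      induction b with
      | zero => simp only [LinearMap.map_zero, LinearEquiv.map_zero, TensorProduct.zero_tmul,
      TensorProduct.tmul_zero, mul_zero, zero_mul]
      | add a b ha hb => simp only [LinearMap.map_add, LinearEquiv.map_add, TensorProduct.tmul_add, TensorProduct.add_tmul,
          mul_add, ha, hb]
      | tmul b b' => simp
  have e2 : ∀ s t, (mulMap k H P Q).lTensor H (mulMap k H (H ⊗[k] P) (H ⊗[k] Q)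
      (TensorProduct.assoc k H H P ((comul (R := k) (A := H)).rTensor P s) ⊗ₜ
        TensorProduct.assoc k H H Q ((comul (R := k) (A := H)).rTensor Q t))) =
      TensorProduct.assoc k H H (P ⊗[k] Q) ((comul (R := k) (A := H)).rTensor (P ⊗[k] Q)
        (mulMap k H P Q (s ⊗ₜ t))) := by
    intro s t
    induction s with
    | zero => simp only [LinearMap.map_zero, LinearEquiv.map_zero, TensorProduct.zero_tmul,
      TensorProduct.tmul_zero, mul_zero, zero_mul]
    | add a b ha hb => simp only [LinearMap.map_add, LinearEquiv.map_add, TensorProduct.add_tmul, ha, hb]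
    | tmul a p =>
      induction t with
      | zero => simp only [LinearMap.map_zero, LinearEquiv.map_zero, TensorProduct.zero_tmul,
      TensorProduct.tmul_zero, mul_zero, zero_mul]
      | add a b ha hb => simp only [LinearMap.map_add, LinearEquiv.map_add, TensorProduct.tmul_add, ha, hb]
      | tmul b q => simp [e3, comul_mul]
  apply TensorProduct.ext'
  intro p q
  have h1 := LinearMap.congr_fun hP p
  have h2 := LinearMap.congr_fun hQ q
  simp only [LinearMap.comp_apply, LinearEquiv.coe_coe] at h1 h2
  have : tensorCoaction δP δQ (p ⊗ₜ q) = mulMap k H P Q (δP p ⊗ₜ δQ q) := rfl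
  simp only [LinearMap.comp_apply, this, e1, h1, h2, e2, LinearEquiv.coe_coe]

lemma counitPart_tensor_left (hP : IsCoassoc δP) :
    counitPart (tensorCoaction δP δQ) ∘ₗ (counitPart δP).rTensor Q =
      counitPart (tensorCoaction δP δQ) := by
  apply TensorProduct.ext'
  intro p q
  have := LinearMap.congr_fun (comp_counitPart hP) p
  simp only [LinearMap.comp_apply] at this
  simp [counitPart, tensorCoaction] at this ⊢
  rw [this]

lemma counitPart_tensor_right (hQ : IsCoassoc δQ) :
    counitPart (tensorCoaction δP δQ) ∘ₗ (counitPart δQ).lTensor P =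
      counitPart (tensorCoaction δP δQ) := by
  apply TensorProduct.ext'
  intro p q
  have := LinearMap.congr_fun (comp_counitPart hQ) q
  simp only [LinearMap.comp_apply] at this
  simp [counitPart, tensorCoaction] at this ⊢
  rw [this]

/-- The coaction induced on the image of the idempotent `p ↦ ε(p₋₁) p₀`. -/
def coreCoaction (δ : P →ₗ[k] H ⊗[k] P) :
    LinearMap.range (counitPart δ) →ₗ[k] H ⊗[k] LinearMap.range (counitPart δ) :=
  (counitPart δ).rangeRestrict.lTensor H ∘ₗ δ ∘ₗ (LinearMap.range (counitPart δ)).subtype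

lemma isColinear_core_subtype (h : IsCoassoc δP) :
    IsColinear (coreCoaction δP) δP (LinearMap.range (counitPart δP)).subtype := by
  unfold IsColinear coreCoaction
  rw [← LinearMap.comp_assoc, ← LinearMap.lTensor_comp, subtype_comp_rangeRestrict,
    ← LinearMap.comp_assoc, lTensor_counitPart h]

lemma isColinear_core_rangeRestrict (h : IsCoassoc δP) :
    IsColinear δP (coreCoaction δP) (counitPart δP).rangeRestrict := by
  unfold IsColinear coreCoaction
  rw [LinearMap.comp_assoc, LinearMap.comp_assoc, subtype_comp_rangeRestrict,
    comp_counitPart h]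

lemma isCoassoc_of_injective {f : P →ₗ[k] Q} (hf : Function.Injective f)
    (hc : IsColinear δP δQ f) (hQ : IsCoassoc δQ) : IsCoassoc δP := by
  have hinj : Function.Injective ((f.lTensor H).lTensor H) :=
    Module.Flat.lTensor_preserves_injective_linearMap _
      (Module.Flat.lTensor_preserves_injective_linearMap _ hf)
  ext x
  apply hinj
  have h1 := LinearMap.congr_fun hc x
  simp only [LinearMap.comp_apply] at h1
  have h2 : ∀ t, (f.lTensor H).lTensor H (δP.lTensor H t) = δQ.lTensor H (f.lTensor H t) := by
    intro t
    rw [← LinearMap.comp_apply, ← LinearMap.lTensor_comp, ← hc, LinearMap.lTensor_comp,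
      LinearMap.comp_apply]
  have h4 : ∀ (s : H ⊗[k] H) (p : P), (f.lTensor H).lTensor H
      (TensorProduct.assoc k H H P (s ⊗ₜ p)) = TensorProduct.assoc k H H Q (s ⊗ₜ f p) := by
    intro s p
    induction s with
    | zero => simp only [LinearMap.map_zero, LinearEquiv.map_zero, TensorProduct.zero_tmul,
      TensorProduct.tmul_zero, mul_zero, zero_mul]
    | add a b ha hb => simp only [LinearMap.map_add, LinearEquiv.map_add, TensorProduct.add_tmul, ha, hb]
    | tmul a p => simp
  have h3 : ∀ t, (f.lTensor H).lTensor H (TensorProduct.assoc k H H P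
      ((comul (R := k) (A := H)).rTensor P t)) =
      TensorProduct.assoc k H H Q ((comul (R := k) (A := H)).rTensor Q (f.lTensor H t)) := by
    intro t
    induction t with
    | zero => simp only [LinearMap.map_zero, LinearEquiv.map_zero, TensorProduct.zero_tmul,
      TensorProduct.tmul_zero, mul_zero, zero_mul]
    | add a b ha hb => simp only [LinearMap.map_add, LinearEquiv.map_add, ha, hb]
    | tmul a p => simp [h4]
  have h5 := LinearMap.congr_fun hQ (f x)
  simp only [LinearMap.comp_apply, LinearEquiv.coe_coe] at h5 ⊢
  rw [h2, h3, ← h1, h5]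

lemma isCoassoc_core (h : IsCoassoc δP) : IsCoassoc (coreCoaction δP) :=
  isCoassoc_of_injective Subtype.val_injective (isColinear_core_subtype h) h

lemma counitPart_idem (h : IsCoassoc δP) : counitPart δP ∘ₗ counitPart δP = counitPart δP := by
  conv_lhs => lhs; unfold counitPart
  rw [LinearMap.comp_assoc, LinearMap.comp_assoc, comp_counitPart h]
  rfl

lemma counitPart_core (h : IsCoassoc δP) : counitPart (coreCoaction δP) = LinearMap.id := by
  have h1 := (isColinear_core_subtype h).counitPart_comp
  ext ⟨x, y, rfl⟩
  have h2 := LinearMap.congr_fun h1 ⟨_, y, rfl⟩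
  have h3 := LinearMap.congr_fun (counitPart_idem h) y
  simp only [LinearMap.comp_apply, Submodule.subtype_apply, LinearMap.id_apply] at h2 h3 ⊢
  rw [← h2, h3]

end Semi

section Unit

variable (k : Type u) (H : Type w) [Field k] [Ring H] [Algebra k H] [WeakBialgebra k H]

/-- The target counital map `ε_t(h) = ε(1₍₁₎ h) 1₍₂₎`. -/
def targetCounit : H →ₗ[k] H :=
  (TensorProduct.lid k H).toLinearMap ∘ₗ (counit (R := k) (A := H)).rTensor H ∘ₗ
    LinearMap.mulLeft k (comul (R := k) (1 : H)) ∘ₗ (TensorProduct.mk k H H).flip 1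

/-- The base `H_t = ε_t(H)`. -/
def targetBase : Submodule k H := LinearMap.range (targetCounit k H)

/-- `ε_t` as a map onto `H_t`. -/
def targetProj : H →ₗ[k] targetBase k H := (targetCounit k H).rangeRestrict

variable {H}

lemma comul_one_mul (h : H) : comul (R := k) (1 : H) * comul (R := k) h = comul (R := k) h := by
  rw [← comul_mul, one_mul]

lemma comul_mul_one (h : H) : comul (R := k) h * comul (R := k) (1 : H) = comul (R := k) h := by
  rw [← comul_mul, mul_one]

lemma targetCounit_apply (h : H) : targetCounit k H h = TensorProduct.lid k H
    ((counit (R := k) (A := H)).rTensor H (comul (R := k) (1 : H) * (h ⊗ₜ 1))) := rfl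

lemma targetCounit_one : targetCounit k H 1 = 1 := by
  have := Coalgebra.rTensor_counit_comul (R := k) (1 : H)
  rw [targetCounit_apply, ← Algebra.TensorProduct.one_def, mul_one, this]
  simp

/-- Auxiliary map `t ↦ (ε ⊗ id ⊗ id)(t (h ⊗ 1 ⊗ 1))`. -/
def auxMap (h : H) : (H ⊗[k] H) ⊗[k] H →ₗ[k] H ⊗[k] H :=
  TensorProduct.lift
    ((TensorProduct.mk k H H) ∘ₗ (TensorProduct.lid k H).toLinearMap ∘ₗ
      (counit (R := k) (A := H) ∘ₗ LinearMap.mulRight k h).rTensor H)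

lemma auxMap_tmul (h a b c : H) : auxMap k h ((a ⊗ₜ b) ⊗ₜ c) = counit (R := k) (a * h) • (b ⊗ₜ c) := by
  simp [auxMap, TensorProduct.smul_tmul']

lemma auxMap_eq (h : H) (t : H ⊗[k] H) :
    auxMap k h ((TensorProduct.assoc k H H H).symm ((comul (R := k) (A := H)).lTensor H t)) =
      comul (R := k) (TensorProduct.lid k H
        ((counit (R := k) (A := H)).rTensor H (t * (h ⊗ₜ 1)))) := by
  induction t with
  | zero => simp only [LinearMap.map_zero, LinearEquiv.map_zero, TensorProduct.zero_tmul,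
      TensorProduct.tmul_zero, mul_zero, zero_mul]
  | add a b ha hb => simp only [LinearMap.map_add, LinearEquiv.map_add, add_mul, ha, hb]
  | tmul a b =>
    simp only [LinearMap.lTensor_tmul, Algebra.TensorProduct.tmul_mul_tmul, mul_one,
      LinearMap.rTensor_tmul, TensorProduct.lid_tmul, map_smul]
    generalize (comul (R := k) b) = s
    induction s with
    | zero => simp only [LinearMap.map_zero, LinearEquiv.map_zero, TensorProduct.zero_tmul,
      TensorProduct.tmul_zero, mul_zero, zero_mul, smul_zero]
    | add a b ha hb => simp only [LinearMap.map_add, LinearEquiv.map_add, TensorProduct.tmul_add, smul_add, ha, hb]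
    | tmul b c => simp [auxMap_tmul]

lemma coassoc_symm (h : H) : (TensorProduct.assoc k H H H).symm
    ((comul (R := k) (A := H)).lTensor H (comul h)) = (comul (R := k) (A := H)).rTensor H (comul h) := by
  rw [LinearEquiv.symm_apply_eq, Coalgebra.coassoc_apply]

lemma comul_targetCounit (h : H) : comul (R := k) (targetCounit k H h) =
    auxMap k h ((comul (R := k) (A := H)).rTensor H (comul 1)) := by
  rw [targetCounit_apply, ← auxMap_eq, coassoc_symm]

lemma comul_targetCounit_right (h : H) : comul (R := k) (targetCounit k H h) =
    (targetCounit k H h ⊗ₜ 1) * comul (R := k) (1 : H) := by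
  rw [comul_targetCounit, comul_one_left, targetCounit_apply]
  generalize comul (R := k) (1 : H) = s
  have : ∀ t : H ⊗[k] H, auxMap k h (s ⊗ₜ[k] 1 * (TensorProduct.assoc k H H H).symm (1 ⊗ₜ[k] t)) =
      ((TensorProduct.lid k H) ((counit (R := k) (A := H)).rTensor H (s * h ⊗ₜ[k] 1))) ⊗ₜ[k] 1 * t := by
    intro t
    induction t with
    | zero => simp only [LinearMap.map_zero, LinearEquiv.map_zero, TensorProduct.zero_tmul,
      TensorProduct.tmul_zero, mul_zero, zero_mul]
    | add a b ha hb => simp only [LinearMap.map_add, LinearEquiv.map_add, TensorProduct.tmul_add, mul_add, ha, hb]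
    | tmul b c =>
      induction s with
      | zero => simp only [LinearMap.map_zero, LinearEquiv.map_zero, TensorProduct.zero_tmul,
      TensorProduct.tmul_zero, mul_zero, zero_mul]
      | add a b ha hb => simp only [LinearMap.map_add, LinearEquiv.map_add, TensorProduct.add_tmul, add_mul, ha, hb]
      | tmul d e => simp [auxMap_tmul, TensorProduct.smul_tmul']
  exact this s

lemma comul_targetCounit_left (h : H) : comul (R := k) (targetCounit k H h) =
    comul (R := k) (1 : H) * (targetCounit k H h ⊗ₜ 1) := by
  rw [comul_targetCounit, comul_one_right, targetCounit_apply]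
  generalize comul (R := k) (1 : H) = s
  have : ∀ t : H ⊗[k] H, auxMap k h ((TensorProduct.assoc k H H H).symm (1 ⊗ₜ[k] t) * s ⊗ₜ[k] 1) =
      t * ((TensorProduct.lid k H) ((counit (R := k) (A := H)).rTensor H (s * h ⊗ₜ[k] 1))) ⊗ₜ[k] 1 := by
    intro t
    induction t with
    | zero => simp only [LinearMap.map_zero, LinearEquiv.map_zero, TensorProduct.zero_tmul,
      TensorProduct.tmul_zero, mul_zero, zero_mul]
    | add a b ha hb => simp only [LinearMap.map_add, LinearEquiv.map_add, TensorProduct.tmul_add, add_mul, ha, hb]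
    | tmul b c =>
      induction s with
      | zero => simp only [LinearMap.map_zero, LinearEquiv.map_zero, TensorProduct.zero_tmul,
      TensorProduct.tmul_zero, mul_zero, zero_mul]
      | add a b ha hb => simp only [LinearMap.map_add, LinearEquiv.map_add, TensorProduct.add_tmul, mul_add, add_mul, ha, hb]
      | tmul d e => simp [auxMap_tmul, TensorProduct.smul_tmul']
  exact this s

lemma lTensor_targetCounit_comul_one : (targetCounit k H).lTensor H (comul (R := k) (1 : H)) =
    comul (R := k) (1 : H) := by
  have h1 : ∀ s t : H ⊗[k] H, (TensorProduct.lid k H).toLinearMap.lTensor H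
      (((counit (R := k) (A := H)).rTensor H).lTensor H (TensorProduct.assoc k H H H
      ((TensorProduct.assoc k H H H).symm (1 ⊗ₜ[k] s) * t ⊗ₜ[k] 1))) =
      ((TensorProduct.lid k H).toLinearMap ∘ₗ (counit (R := k) (A := H)).rTensor H ∘ₗ
        LinearMap.mulLeft k s ∘ₗ (TensorProduct.mk k H H).flip 1).lTensor H t := by
    intro s t
    induction t with
    | zero => simp only [LinearMap.map_zero, LinearEquiv.map_zero, TensorProduct.zero_tmul,
      TensorProduct.tmul_zero, mul_zero, zero_mul]
    | add a b ha hb => simp only [LinearMap.map_add, LinearEquiv.map_add, TensorProduct.add_tmul, mul_add, ha, hb]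
    | tmul d e =>
      induction s with
      | zero => simp
      | add a b ha hb =>
        simp only [LinearMap.map_add, LinearEquiv.map_add, TensorProduct.tmul_add, add_mul, ha, hb]
        simp [add_mul, TensorProduct.tmul_add]
      | tmul d e => simp
  have h2 := h1 (comul 1) (comul 1)
  have h3 : (targetCounit k H).lTensor H (comul (R := k) (1 : H)) = _ := h2.symm
  rw [h3, ← comul_one_right, Coalgebra.coassoc_apply, ← LinearMap.comp_apply (LinearMap.lTensor H _),
    ← LinearMap.lTensor_comp]
  rw [← LinearMap.comp_apply, ← LinearMap.lTensor_comp, LinearMap.comp_assoc,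
    Coalgebra.rTensor_counit_comp_comul]
  have : (TensorProduct.lid k H).toLinearMap ∘ₗ TensorProduct.mk k k H 1 = LinearMap.id := by
    ext; simp
  rw [this]; simp

variable {k}

lemma comul_base_left (z : targetBase k H) : comul (R := k) (z : H) =
    comul (R := k) (1 : H) * ((z : H) ⊗ₜ 1) := by
  obtain ⟨_, h, rfl⟩ := z
  exact comul_targetCounit_left k h

lemma comul_base_right (z : targetBase k H) : comul (R := k) (z : H) =
    ((z : H) ⊗ₜ 1) * comul (R := k) (1 : H) := by
  obtain ⟨_, h, rfl⟩ := z
  exact comul_targetCounit_right k h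

variable (k H) in
/-- The coaction of `H` on `H_t`, the restriction of the comultiplication. -/
def baseCoaction : targetBase k H →ₗ[k] H ⊗[k] targetBase k H :=
  (targetProj k H).lTensor H ∘ₗ comul (R := k) (A := H) ∘ₗ (targetBase k H).subtype

lemma isColinear_base : IsColinear (baseCoaction k H) (comul (R := k) (A := H))
    (targetBase k H).subtype := by
  unfold IsColinear baseCoaction
  rw [← LinearMap.comp_assoc, ← LinearMap.lTensor_comp]
  have : (targetBase k H).subtype ∘ₗ targetProj k H = targetCounit k H := rfl
  rw [this]
  ext z
  simp only [LinearMap.comp_apply, Submodule.subtype_apply]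
  rw [comul_base_right]
  have h1 : ∀ t : H ⊗[k] H, (targetCounit k H).lTensor H (((z : H) ⊗ₜ[k] 1) * t) =
      ((z : H) ⊗ₜ[k] 1) * (targetCounit k H).lTensor H t := by
    intro t
    induction t with
    | zero => simp only [LinearMap.map_zero, LinearEquiv.map_zero, TensorProduct.zero_tmul,
      TensorProduct.tmul_zero, mul_zero, zero_mul]
    | add a b ha hb => simp only [LinearMap.map_add, LinearEquiv.map_add, mul_add, ha, hb]
    | tmul a b => simp
  rw [h1, lTensor_targetCounit_comul_one]

lemma isCoassoc_comul : IsCoassoc (comul (R := k) (A := H)) := by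
  unfold IsCoassoc
  exact Coalgebra.coassoc.symm

lemma isCoassoc_base : IsCoassoc (baseCoaction k H) :=
  isCoassoc_of_injective Subtype.val_injective isColinear_base isCoassoc_comul

lemma counitPart_base : counitPart (baseCoaction k H) = LinearMap.id := by
  ext z
  have h1 := LinearMap.congr_fun (isColinear_base (k := k) (H := H)).counitPart_comp z
  simp only [LinearMap.comp_apply, Submodule.subtype_apply, LinearMap.id_apply] at h1 ⊢
  rw [← h1]
  simp [counitPart]

variable (k H) in
/-- The unit of `H` as an element of `H_t`. -/
def baseOne : targetBase k H := ⟨1, 1, targetCounit_one k⟩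

lemma baseCoaction_left (z : targetBase k H) : baseCoaction k H z =
    (LinearMap.mulRight k (z : H)).rTensor (targetBase k H) (baseCoaction k H (baseOne k H)) := by
  have hinj : Function.Injective ((targetBase k H).subtype.lTensor H) :=
    Module.Flat.lTensor_preserves_injective_linearMap _ Subtype.val_injective
  apply hinj
  have h1 := fun z => LinearMap.congr_fun (isColinear_base (k := k) (H := H)) z
  simp only [LinearMap.comp_apply, Submodule.subtype_apply] at h1
  have h2 : ∀ t, (targetBase k H).subtype.lTensor H
      ((LinearMap.mulRight k (z : H)).rTensor (targetBase k H) t) =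
      (targetBase k H).subtype.lTensor H t * ((z : H) ⊗ₜ 1) := by
    intro t
    induction t with
    | zero => simp only [LinearMap.map_zero, LinearEquiv.map_zero, TensorProduct.zero_tmul,
      TensorProduct.tmul_zero, mul_zero, zero_mul]
    | add a b ha hb => simp only [LinearMap.map_add, LinearEquiv.map_add, add_mul, ha, hb]
    | tmul a b => simp
  rw [h2, ← h1, ← h1, comul_base_left]; rfl

lemma baseCoaction_right (z : targetBase k H) : baseCoaction k H z =
    (LinearMap.mulLeft k (z : H)).rTensor (targetBase k H) (baseCoaction k H (baseOne k H)) := by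
  have hinj : Function.Injective ((targetBase k H).subtype.lTensor H) :=
    Module.Flat.lTensor_preserves_injective_linearMap _ Subtype.val_injective
  apply hinj
  have h1 := fun z => LinearMap.congr_fun (isColinear_base (k := k) (H := H)) z
  simp only [LinearMap.comp_apply, Submodule.subtype_apply] at h1
  have h2 : ∀ t, (targetBase k H).subtype.lTensor H
      ((LinearMap.mulLeft k (z : H)).rTensor (targetBase k H) t) =
      ((z : H) ⊗ₜ 1) * (targetBase k H).subtype.lTensor H t := by
    intro t
    induction t with
    | zero => simp only [LinearMap.map_zero, LinearEquiv.map_zero, TensorProduct.zero_tmul,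
      TensorProduct.tmul_zero, mul_zero, zero_mul]
    | add a b ha hb => simp only [LinearMap.map_add, LinearEquiv.map_add, mul_add, ha, hb]
    | tmul a b => simp
  rw [h2, ← h1, ← h1, comul_base_right]; rfl

/-- `ε(z g₁) g₂ = z g` -/
lemma counit_base_mul (z : targetBase k H) (g : H) :
    TensorProduct.lid k H ((counit (R := k) (A := H) ∘ₗ LinearMap.mulLeft k (z : H)).rTensor H
      (comul g)) = z * g := by
  have h1 := Coalgebra.rTensor_counit_comul (R := k) ((z : H) * g)
  rw [comul_mul, comul_base_right, mul_assoc, comul_one_mul] at h1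
  have h2 : ∀ t : H ⊗[k] H, (counit (R := k) (A := H)).rTensor H (((z : H) ⊗ₜ[k] 1) * t) =
      (counit (R := k) (A := H) ∘ₗ LinearMap.mulLeft k (z : H)).rTensor H t := by
    intro t
    induction t with
    | zero => simp only [LinearMap.map_zero, LinearEquiv.map_zero, TensorProduct.zero_tmul,
      TensorProduct.tmul_zero, mul_zero, zero_mul]
    | add a b ha hb => simp only [LinearMap.map_add, LinearEquiv.map_add, mul_add, ha, hb]
    | tmul a b => simp
  rw [← h2, h1]; simp

/-- `ε(g₁ z) g₂ = g z` -/
lemma counit_mul_base (z : targetBase k H) (g : H) :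
    TensorProduct.lid k H ((counit (R := k) (A := H) ∘ₗ LinearMap.mulRight k (z : H)).rTensor H
      (comul g)) = g * z := by
  have h1 := Coalgebra.rTensor_counit_comul (R := k) (g * (z : H))
  rw [comul_mul, comul_base_left, ← mul_assoc, comul_mul_one] at h1
  have h2 : ∀ t : H ⊗[k] H, (counit (R := k) (A := H)).rTensor H (t * ((z : H) ⊗ₜ[k] 1)) =
      (counit (R := k) (A := H) ∘ₗ LinearMap.mulRight k (z : H)).rTensor H t := by
    intro t
    induction t with
    | zero => simp only [LinearMap.map_zero, LinearEquiv.map_zero, TensorProduct.zero_tmul,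
      TensorProduct.tmul_zero, mul_zero, zero_mul]
    | add a b ha hb => simp only [LinearMap.map_add, LinearEquiv.map_add, add_mul, ha, hb]
    | tmul a b => simp
  rw [← h2, h1]; simp

variable {P Q : Type*} [AddCommGroup P] [Module k P] [AddCommGroup Q] [Module k Q]

/-- `z ⊗ v ↦ ε(z v₋₁) v₀` -/
def leftUnit (δ : P →ₗ[k] H ⊗[k] P) : targetBase k H ⊗[k] P →ₗ[k] P :=
  TensorProduct.lift <| LinearMap.mk₂ k
    (fun z p => TensorProduct.lid k P
      ((counit (R := k) (A := H) ∘ₗ LinearMap.mulLeft k (z : H)).rTensor P (δ p)))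
    (fun z z' p => by
      rw [← map_add, ← LinearMap.add_apply, ← LinearMap.rTensor_add, ← LinearMap.comp_add]
      congr; ext; simp [add_mul])
    (fun c z p => by
      rw [← map_smul, ← LinearMap.smul_apply, ← LinearMap.rTensor_smul, ← LinearMap.comp_smul]
      congr; ext; simp)
    (fun z p p' => by simp only [LinearMap.map_add, LinearEquiv.map_add])
    (fun c z p => by simp only [map_smul])

/-- `v ⊗ z ↦ ε(v₋₁ z) v₀` -/
def rightUnit (δ : P →ₗ[k] H ⊗[k] P) : P ⊗[k] targetBase k H →ₗ[k] P :=
  TensorProduct.lift <| LinearMap.mk₂ k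
    (fun p z => TensorProduct.lid k P
      ((counit (R := k) (A := H) ∘ₗ LinearMap.mulRight k (z : H)).rTensor P (δ p)))
    (fun p p' z => by simp only [LinearMap.map_add, LinearEquiv.map_add])
    (fun c p z => by simp only [map_smul])
    (fun p z z' => by
      rw [← map_add, ← LinearMap.add_apply, ← LinearMap.rTensor_add, ← LinearMap.comp_add]
      congr; ext; simp [mul_add])
    (fun c p z => by
      rw [← map_smul, ← LinearMap.smul_apply, ← LinearMap.rTensor_smul, ← LinearMap.comp_smul]
      congr; ext; simp)

lemma leftUnit_tmul (δ : P →ₗ[k] H ⊗[k] P) (z : targetBase k H) (p : P) :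
    leftUnit δ (z ⊗ₜ p) = TensorProduct.lid k P
      ((counit (R := k) (A := H) ∘ₗ LinearMap.mulLeft k (z : H)).rTensor P (δ p)) := rfl

lemma rightUnit_tmul (δ : P →ₗ[k] H ⊗[k] P) (p : P) (z : targetBase k H) :
    rightUnit δ (p ⊗ₜ z) = TensorProduct.lid k P
      ((counit (R := k) (A := H) ∘ₗ LinearMap.mulRight k (z : H)).rTensor P (δ p)) := rfl

variable {δP : P →ₗ[k] H ⊗[k] P} {δQ : Q →ₗ[k] H ⊗[k] Q}

lemma lid_rTensor_coassoc (h : IsCoassoc δP) (f : H →ₗ[k] k) (g : H → H)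
    (hg : ∀ a, TensorProduct.lid k H (f.rTensor H (comul a)) = g a) (gl : H →ₗ[k] H)
    (hgl : ∀ a, gl a = g a) (p : P) :
    δP (TensorProduct.lid k P (f.rTensor P (δP p))) = gl.rTensor P (δP p) := by
  have e1 : ∀ t, δP (TensorProduct.lid k P (f.rTensor P t)) =
      TensorProduct.lid k (H ⊗[k] P) (f.rTensor (H ⊗[k] P) (δP.lTensor H t)) := by
    intro t
    induction t with
    | zero => simp only [LinearMap.map_zero, LinearEquiv.map_zero, TensorProduct.zero_tmul,
      TensorProduct.tmul_zero, mul_zero, zero_mul]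
    | add a b ha hb => simp only [LinearMap.map_add, LinearEquiv.map_add, ha, hb]
    | tmul a b => simp
  have h1 := LinearMap.congr_fun h p
  simp only [LinearMap.comp_apply, LinearEquiv.coe_coe] at h1
  rw [e1, h1]
  have e2 : ∀ (s : H ⊗[k] H) (p : P), TensorProduct.lid k (H ⊗[k] P) (f.rTensor (H ⊗[k] P)
      (TensorProduct.assoc k H H P (s ⊗ₜ p))) =
      (TensorProduct.lid k H (f.rTensor H s)) ⊗ₜ p := by
    intro s p
    induction s with
    | zero => simp only [LinearMap.map_zero, LinearEquiv.map_zero, TensorProduct.zero_tmul,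
      TensorProduct.tmul_zero, mul_zero, zero_mul]
    | add a b ha hb => simp only [LinearMap.map_add, LinearEquiv.map_add, TensorProduct.add_tmul, ha, hb]
    | tmul a b => simp [TensorProduct.smul_tmul']
  generalize δP p = t
  induction t with
  | zero => simp only [LinearMap.map_zero, LinearEquiv.map_zero, TensorProduct.zero_tmul,
      TensorProduct.tmul_zero, mul_zero, zero_mul]
  | add a b ha hb => simp only [LinearMap.map_add, LinearEquiv.map_add, ha, hb]
  | tmul a b => simp [e2, hg, hgl]

lemma coaction_leftUnit (h : IsCoassoc δP) (z : targetBase k H) (p : P) :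
    δP (leftUnit δP (z ⊗ₜ p)) = (LinearMap.mulLeft k (z : H)).rTensor P (δP p) :=
  lid_rTensor_coassoc h _ _ (counit_base_mul z) _ (fun _ => rfl) p

lemma coaction_rightUnit (h : IsCoassoc δP) (z : targetBase k H) (p : P) :
    δP (rightUnit δP (p ⊗ₜ z)) = (LinearMap.mulRight k (z : H)).rTensor P (δP p) :=
  lid_rTensor_coassoc h _ _ (counit_mul_base z) _ (fun _ => rfl) p

lemma tensorCoaction_tmul (p : P) (q : Q) :
    tensorCoaction δP δQ (p ⊗ₜ q) = mulMap k H P Q (δP p ⊗ₜ δQ q) := rfl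

lemma assoc_symm_coassoc (h : IsCoassoc δP) (p : P) :
    (TensorProduct.assoc k H H P).symm (δP.lTensor H (δP p)) =
      (comul (R := k) (A := H)).rTensor P (δP p) := by
  rw [LinearEquiv.symm_apply_eq]
  exact LinearMap.congr_fun h p

lemma comul_subtype_base (z : targetBase k H) :
    (targetBase k H).subtype.lTensor H (baseCoaction k H z) = comul (R := k) (z : H) :=
  (LinearMap.congr_fun (isColinear_base (k := k) (H := H)) z).symm

lemma isColinear_leftUnit (h : IsCoassoc δP) :
    IsColinear (tensorCoaction (baseCoaction k H) δP) δP (leftUnit δP) := by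
  have e : ∀ (t : H ⊗[k] targetBase k H) (x : H ⊗[k] P),
      (leftUnit δP).lTensor H (mulMap k H _ _ (t ⊗ₜ x)) =
      ((TensorProduct.rid k H).toLinearMap ∘ₗ (counit (R := k) (A := H)).lTensor H ∘ₗ
        LinearMap.mulLeft k ((targetBase k H).subtype.lTensor H t)).rTensor P
        ((TensorProduct.assoc k H H P).symm (δP.lTensor H x)) := by
    intro t x
    induction x with
    | zero => simp only [LinearMap.map_zero, LinearEquiv.map_zero, TensorProduct.zero_tmul,
      TensorProduct.tmul_zero, mul_zero, zero_mul]
    | add a b ha hb => simp only [LinearMap.map_add, LinearEquiv.map_add, TensorProduct.tmul_add, ha, hb]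
    | tmul b q =>
      induction t with
      | zero =>
        simp only [TensorProduct.zero_tmul, map_zero, LinearMap.mulLeft_zero_eq_zero,
          LinearMap.comp_zero, LinearMap.rTensor_zero, LinearMap.zero_apply]
      | add a a' ha hb =>
        simp only [LinearMap.map_add, LinearEquiv.map_add, TensorProduct.add_tmul, ha, hb]
        rw [← LinearMap.add_apply, ← LinearMap.rTensor_add]
        congr 2
        ext; simp [add_mul]
      | tmul a u =>
        simp only [mulMap_tmul, LinearMap.lTensor_tmul, leftUnit_tmul]
        generalize δP q = y
        induction y with
        | zero => simp only [LinearMap.map_zero, LinearEquiv.map_zero, TensorProduct.zero_tmul,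
      TensorProduct.tmul_zero, mul_zero, zero_mul]
        | add a b ha hb => simp only [LinearMap.map_add, LinearEquiv.map_add, TensorProduct.tmul_add, ha, hb]
        | tmul c p => simp [TensorProduct.smul_tmul']
  apply TensorProduct.ext'
  intro z p
  simp only [LinearMap.comp_apply, tensorCoaction_tmul, e, coaction_leftUnit h,
    assoc_symm_coassoc h, comul_subtype_base]
  rw [← LinearMap.rTensor_comp_apply]
  congr 2
  ext g
  simp [← comul_mul]

lemma isColinear_rightUnit (h : IsCoassoc δP) :
    IsColinear (tensorCoaction δP (baseCoaction k H)) δP (rightUnit δP) := by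
  have e : ∀ (t : H ⊗[k] targetBase k H) (x : H ⊗[k] P),
      (rightUnit δP).lTensor H (mulMap k H _ _ (x ⊗ₜ t)) =
      ((TensorProduct.rid k H).toLinearMap ∘ₗ (counit (R := k) (A := H)).lTensor H ∘ₗ
        LinearMap.mulRight k ((targetBase k H).subtype.lTensor H t)).rTensor P
        ((TensorProduct.assoc k H H P).symm (δP.lTensor H x)) := by
    intro t x
    induction x with
    | zero => simp only [LinearMap.map_zero, LinearEquiv.map_zero, TensorProduct.zero_tmul,
      TensorProduct.tmul_zero, mul_zero, zero_mul]
    | add a b ha hb => simp only [LinearMap.map_add, LinearEquiv.map_add, TensorProduct.add_tmul, ha, hb]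
    | tmul b q =>
      induction t with
      | zero =>
        simp only [TensorProduct.tmul_zero, map_zero, LinearMap.mulRight_zero_eq_zero,
          LinearMap.comp_zero, LinearMap.rTensor_zero, LinearMap.zero_apply]
      | add a a' ha hb =>
        simp only [LinearMap.map_add, LinearEquiv.map_add, TensorProduct.tmul_add, ha, hb]
        rw [← LinearMap.add_apply, ← LinearMap.rTensor_add]
        congr 2
        ext; simp [mul_add]
      | tmul a u =>
        simp only [mulMap_tmul, LinearMap.lTensor_tmul, rightUnit_tmul]
        generalize δP q = y
        induction y with
        | zero => simp only [LinearMap.map_zero, LinearEquiv.map_zero, TensorProduct.zero_tmul,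
      TensorProduct.tmul_zero, mul_zero, zero_mul]
        | add a b ha hb => simp only [LinearMap.map_add, LinearEquiv.map_add, TensorProduct.tmul_add, ha, hb]
        | tmul c p => simp [TensorProduct.smul_tmul']
  apply TensorProduct.ext'
  intro p z
  simp only [LinearMap.comp_apply, tensorCoaction_tmul, e, coaction_rightUnit h,
    assoc_symm_coassoc h, comul_subtype_base]
  rw [← LinearMap.rTensor_comp_apply]
  congr 2
  ext g
  simp [← comul_mul]

lemma counitPart_tensor_apply (p : P) (q : Q) : counitPart (tensorCoaction δP δQ) (p ⊗ₜ q) =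
    TensorProduct.lid k _ ((counit (R := k) (A := H)).rTensor _
      (mulMap k H P Q (δP p ⊗ₜ δQ q))) := rfl

lemma counitPart_one_leftUnit (h : IsCoassoc δP) (z : targetBase k H) (p : P) :
    counitPart (tensorCoaction (baseCoaction k H) δP) (baseOne k H ⊗ₜ leftUnit δP (z ⊗ₜ p)) =
      counitPart (tensorCoaction (baseCoaction k H) δP) (z ⊗ₜ p) := by
  rw [counitPart_tensor_apply, counitPart_tensor_apply, coaction_leftUnit h, baseCoaction_left z]
  congr 2
  generalize baseCoaction k H (baseOne k H) = t
  generalize δP p = x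
  induction x with
  | zero => simp only [LinearMap.map_zero, LinearEquiv.map_zero, TensorProduct.zero_tmul,
      TensorProduct.tmul_zero, mul_zero, zero_mul]
  | add a b ha hb => simp only [LinearMap.map_add, LinearEquiv.map_add, TensorProduct.tmul_add, ha, hb]
  | tmul b q =>
    induction t with
    | zero => simp only [LinearMap.map_zero, LinearEquiv.map_zero, TensorProduct.zero_tmul,
      TensorProduct.tmul_zero, mul_zero, zero_mul]
    | add a a' ha hb => simp only [LinearMap.map_add, LinearEquiv.map_add, TensorProduct.add_tmul, ha, hb]
    | tmul a u => simp [mul_assoc]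

lemma counitPart_rightUnit_one (h : IsCoassoc δP) (z : targetBase k H) (p : P) :
    counitPart (tensorCoaction δP (baseCoaction k H)) (rightUnit δP (p ⊗ₜ z) ⊗ₜ baseOne k H) =
      counitPart (tensorCoaction δP (baseCoaction k H)) (p ⊗ₜ z) := by
  rw [counitPart_tensor_apply, counitPart_tensor_apply, coaction_rightUnit h, baseCoaction_right z]
  congr 2
  generalize baseCoaction k H (baseOne k H) = t
  generalize δP p = x
  induction x with
  | zero => simp only [LinearMap.map_zero, LinearEquiv.map_zero, TensorProduct.zero_tmul,
      TensorProduct.tmul_zero, mul_zero, zero_mul]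
  | add a b ha hb => simp only [LinearMap.map_add, LinearEquiv.map_add, TensorProduct.add_tmul, ha, hb]
  | tmul b q =>
    induction t with
    | zero => simp only [LinearMap.map_zero, LinearEquiv.map_zero, TensorProduct.zero_tmul,
      TensorProduct.tmul_zero, mul_zero, zero_mul]
    | add a a' ha hb => simp only [LinearMap.map_add, LinearEquiv.map_add, TensorProduct.tmul_add, ha, hb]
    | tmul a u => simp [mul_assoc]

lemma counitPart_triangle (hP : IsCoassoc δP) (hQ : IsCoassoc δQ) (z : targetBase k H)
    (p : P) (q : Q) :
    counitPart (tensorCoaction δP δQ) (p ⊗ₜ leftUnit δQ (z ⊗ₜ q)) =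
      counitPart (tensorCoaction δP δQ) (rightUnit δP (p ⊗ₜ z) ⊗ₜ q) := by
  rw [counitPart_tensor_apply, counitPart_tensor_apply, coaction_leftUnit hQ, coaction_rightUnit hP]
  congr 2
  generalize δP p = x
  generalize δQ q = y
  induction x with
  | zero => simp only [LinearMap.map_zero, LinearEquiv.map_zero, TensorProduct.zero_tmul,
      TensorProduct.tmul_zero, mul_zero, zero_mul]
  | add a b ha hb => simp only [LinearMap.map_add, LinearEquiv.map_add, TensorProduct.add_tmul, ha, hb]
  | tmul b q =>
    induction y with
    | zero => simp only [LinearMap.map_zero, LinearEquiv.map_zero, TensorProduct.zero_tmul,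
      TensorProduct.tmul_zero, mul_zero, zero_mul]
    | add a a' ha hb => simp only [LinearMap.map_add, LinearEquiv.map_add, TensorProduct.tmul_add, ha, hb]
    | tmul a u => simp [mul_assoc]

lemma leftUnit_one (hc : counitPart δP = LinearMap.id) (p : P) :
    leftUnit δP (baseOne k H ⊗ₜ p) = p := by
  rw [leftUnit_tmul]
  have : (LinearMap.mulLeft k ((baseOne k H : targetBase k H) : H)) = LinearMap.id := by
    ext; simp [baseOne]
  rw [this]
  exact LinearMap.congr_fun hc p

lemma rightUnit_one (hc : counitPart δP = LinearMap.id) (p : P) :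
    rightUnit δP (p ⊗ₜ baseOne k H) = p := by
  rw [rightUnit_tmul]
  have : (LinearMap.mulRight k ((baseOne k H : targetBase k H) : H)) = LinearMap.id := by
    ext; simp [baseOne]
  rw [this]
  exact LinearMap.congr_fun hc p

lemma leftUnit_natural {f : P →ₗ[k] Q} (hf : IsColinear δP δQ f) (z : targetBase k H) (p : P) :
    leftUnit δQ (z ⊗ₜ f p) = f (leftUnit δP (z ⊗ₜ p)) := by
  have h1 := LinearMap.congr_fun hf p
  simp only [LinearMap.comp_apply] at h1
  rw [leftUnit_tmul, leftUnit_tmul, h1]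
  generalize δP p = t
  induction t with
  | zero => simp only [LinearMap.map_zero, LinearEquiv.map_zero, TensorProduct.zero_tmul,
      TensorProduct.tmul_zero, mul_zero, zero_mul]
  | add a b ha hb => simp only [LinearMap.map_add, LinearEquiv.map_add, ha, hb]
  | tmul a u => simp

lemma rightUnit_natural {f : P →ₗ[k] Q} (hf : IsColinear δP δQ f) (z : targetBase k H) (p : P) :
    rightUnit δQ (f p ⊗ₜ z) = f (rightUnit δP (p ⊗ₜ z)) := by
  have h1 := LinearMap.congr_fun hf p
  simp only [LinearMap.comp_apply] at h1
  rw [rightUnit_tmul, rightUnit_tmul, h1]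
  generalize δP p = t
  induction t with
  | zero => simp only [LinearMap.map_zero, LinearEquiv.map_zero, TensorProduct.zero_tmul,
      TensorProduct.tmul_zero, mul_zero, zero_mul]
  | add a b ha hb => simp only [LinearMap.map_add, LinearEquiv.map_add, ha, hb]
  | tmul a u => simp

end Unit

/-- A finite dimensional left `H`-comodule `v ↦ v₋₁ ⊗ v₀`. This is the same as a finite
dimensional (right) module over the dual weak bialgebra `H*`, the element `f ∈ H*` acting by
`v ↦ f(v₋₁) v₀`; thus `LeftComodule k H` is the category `Rep(H*)`. -/
structure LeftComodule (k : Type u) (H : Type w) [Field k] [Ring H] [Algebra k H]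
    [WeakBialgebra k H] where
  /-- The underlying vector space. -/
  carrier : Type w
  [addCommGroup : AddCommGroup carrier]
  [module : Module k carrier]
  [finiteDimensional : FiniteDimensional k carrier]
  /-- The coaction. -/
  coaction : carrier →ₗ[k] H ⊗[k] carrier
  coassoc : coaction.lTensor H ∘ₗ coaction = (TensorProduct.assoc k H H carrier).toLinearMap ∘ₗ
    (comul (R := k) (A := H)).rTensor carrier ∘ₗ coaction
  counital : (TensorProduct.lid k carrier).toLinearMap ∘ₗ
    (counit (R := k) (A := H)).rTensor carrier ∘ₗ coaction = LinearMap.id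

attribute [instance] LeftComodule.addCommGroup LeftComodule.module
  LeftComodule.finiteDimensional

namespace LeftComodule

variable {k : Type u} {H : Type w} [Field k] [Ring H] [Algebra k H] [WeakBialgebra k H]

lemma isCoassoc (V : LeftComodule k H) : IsCoassoc V.coaction := V.coassoc

lemma counitPart_eq (V : LeftComodule k H) : counitPart V.coaction = LinearMap.id := V.counital

/-- Morphisms of comodules. -/
@[ext] structure Hom (V W : LeftComodule k H) where
  /-- The underlying linear map. -/
  toLinearMap : V.carrier →ₗ[k] W.carrier
  colinear : W.coaction ∘ₗ toLinearMap = toLinearMap.lTensor H ∘ₗ V.coaction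

instance : Category (LeftComodule k H) where
  Hom V W := Hom V W
  id V := ⟨LinearMap.id, by simp⟩
  comp f g := ⟨g.toLinearMap ∘ₗ f.toLinearMap, IsColinear.comp g.colinear f.colinear⟩

variable {V V' W W' U X : LeftComodule k H}

@[ext] lemma hom_ext {f g : V ⟶ W} (h : f.toLinearMap = g.toLinearMap) : f = g := Hom.ext h

@[simp] lemma id_toLinearMap (V : LeftComodule k H) : Hom.toLinearMap (𝟙 V) = LinearMap.id := rfl

@[simp] lemma comp_toLinearMap (f : V ⟶ W) (g : W ⟶ U) :
    (f ≫ g).toLinearMap = g.toLinearMap ∘ₗ f.toLinearMap := rfl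

/-- The tensor product `V ⊠ W` of comodules: the image of the idempotent
`v ⊗ w ↦ ε(v₋₁ w₋₁) v₀ ⊗ w₀` of `V ⊗ W`, with the coaction `v ⊗ w ↦ v₋₁ w₋₁ ⊗ (v₀ ⊗ w₀)`.
In terms of `H*`-modules it is the image of `V ⊗ W` under the action of the coproduct of the unit
of `H*`. -/
def tensor (V W : LeftComodule k H) : LeftComodule k H where
  carrier := LinearMap.range (counitPart (tensorCoaction V.coaction W.coaction))
  coaction := coreCoaction (tensorCoaction V.coaction W.coaction)
  coassoc := isCoassoc_core (isCoassoc_tensor V.isCoassoc W.isCoassoc)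
  counital := counitPart_core (isCoassoc_tensor V.isCoassoc W.isCoassoc)

/-- The unit comodule: `H_t = ε_t(H)` with the restriction of the comultiplication of `H`. -/
def unit (k : Type u) (H : Type w) [Field k] [Ring H] [Algebra k H] [WeakBialgebra k H] :
    LeftComodule k H where
  carrier := targetBase k H
  finiteDimensional :=
    haveI : FiniteDimensional k H := WeakBialgebra.finiteDimensional
    inferInstance
  coaction := baseCoaction k H
  coassoc := isCoassoc_base
  counital := counitPart_base

/-- The inclusion `V ⊠ W → V ⊗ W`. -/
def incl (V W : LeftComodule k H) : (tensor V W).carrier →ₗ[k] V.carrier ⊗[k] W.carrier :=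
  (LinearMap.range (counitPart (tensorCoaction V.coaction W.coaction))).subtype

/-- The projection `V ⊗ W → V ⊠ W`. -/
def proj (V W : LeftComodule k H) : V.carrier ⊗[k] W.carrier →ₗ[k] (tensor V W).carrier :=
  (counitPart (tensorCoaction V.coaction W.coaction)).rangeRestrict

/-- `v ⊠ w`, the image of `v ⊗ w`. -/
def tm (v : V.carrier) (w : W.carrier) : (tensor V W).carrier := proj V W (v ⊗ₜ w)

lemma incl_injective (V W : LeftComodule k H) : Function.Injective (incl V W) :=
  Subtype.val_injective

lemma incl_proj (V W : LeftComodule k H) :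
    incl V W ∘ₗ proj V W = counitPart (tensorCoaction V.coaction W.coaction) := rfl

lemma incl_tm (v : V.carrier) (w : W.carrier) :
    incl V W (tm v w) = counitPart (tensorCoaction V.coaction W.coaction) (v ⊗ₜ w) := rfl

lemma colinear_incl (V W : LeftComodule k H) : IsColinear (tensor V W).coaction
    (tensorCoaction V.coaction W.coaction) (incl V W) :=
  isColinear_core_subtype (isCoassoc_tensor V.isCoassoc W.isCoassoc)

lemma colinear_proj (V W : LeftComodule k H) : IsColinear
    (tensorCoaction V.coaction W.coaction) (tensor V W).coaction (proj V W) :=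
  isColinear_core_rangeRestrict (isCoassoc_tensor V.isCoassoc W.isCoassoc)

lemma tensor_ext {Y : Type*} [AddCommGroup Y] [Module k Y]
    {f g : (tensor V W).carrier →ₗ[k] Y} (h : ∀ v w, f (tm v w) = g (tm v w)) : f = g := by
  have h1 : f ∘ₗ proj V W = g ∘ₗ proj V W := TensorProduct.ext' h
  ext x
  obtain ⟨y, rfl⟩ : ∃ y, proj V W y = x := LinearMap.surjective_rangeRestrict _ x
  exact LinearMap.congr_fun h1 y

lemma tm_add_left (v v' : V.carrier) (w : W.carrier) : tm (v + v') w = tm v w + tm v' w := by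
  simp [tm, TensorProduct.add_tmul]

lemma tm_add_right (v : V.carrier) (w w' : W.carrier) : tm v (w + w') = tm v w + tm v w' := by
  simp [tm, TensorProduct.tmul_add]

/-- The map out of `V ⊠ W` induced by a colinear map out of `V ⊗ W`. -/
def desc (f : V.carrier ⊗[k] W.carrier →ₗ[k] U.carrier) : (tensor V W).carrier →ₗ[k] U.carrier :=
  f ∘ₗ incl V W

lemma colinear_desc {f : V.carrier ⊗[k] W.carrier →ₗ[k] U.carrier}
    (hf : IsColinear (tensorCoaction V.coaction W.coaction) U.coaction f) :
    IsColinear (tensor V W).coaction U.coaction (desc f) :=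
  hf.comp (colinear_incl V W)

lemma desc_tm {f : V.carrier ⊗[k] W.carrier →ₗ[k] U.carrier}
    (hf : IsColinear (tensorCoaction V.coaction W.coaction) U.coaction f)
    (v : V.carrier) (w : W.carrier) : desc f (tm v w) = f (v ⊗ₜ w) := by
  have h1 := LinearMap.congr_fun hf.counitPart_comp (v ⊗ₜ w)
  rw [counitPart_eq] at h1
  exact h1.symm

/-- `f ⊠ g`. -/
def map (f : V ⟶ V') (g : W ⟶ W') : tensor V W ⟶ tensor V' W' where
  toLinearMap := desc (proj V' W' ∘ₗ TensorProduct.map f.toLinearMap g.toLinearMap)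
  colinear := colinear_desc ((colinear_proj V' W').comp (IsColinear.map f.colinear g.colinear))

@[simp] lemma map_tm (f : V ⟶ V') (g : W ⟶ W') (v : V.carrier) (w : W.carrier) :
    (map f g).toLinearMap (tm v w) = tm (f.toLinearMap v) (g.toLinearMap w) :=
  desc_tm ((colinear_proj V' W').comp (IsColinear.map f.colinear g.colinear)) v w

/-- `(V ⊗ W) ⊗ U → V ⊠ (W ⊠ U)` -/
def assocAux (V W U : LeftComodule k H) :
    (V.carrier ⊗[k] W.carrier) ⊗[k] U.carrier →ₗ[k] (tensor V (tensor W U)).carrier :=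
  proj V (tensor W U) ∘ₗ TensorProduct.map LinearMap.id (proj W U) ∘ₗ
    (TensorProduct.assoc k V.carrier W.carrier U.carrier).toLinearMap

lemma colinear_assocAux (V W U : LeftComodule k H) :
    IsColinear (tensorCoaction (tensorCoaction V.coaction W.coaction) U.coaction)
      (tensor V (tensor W U)).coaction (assocAux V W U) :=
  (colinear_proj V (tensor W U)).comp
    ((IsColinear.map isColinear_id (colinear_proj W U)).comp isColinear_assoc)

lemma colinear_assocHom (V W U : LeftComodule k H) :
    IsColinear (tensorCoaction (tensor V W).coaction U.coaction)
      (tensor V (tensor W U)).coaction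
      (assocAux V W U ∘ₗ TensorProduct.map (incl V W) LinearMap.id) :=
  (colinear_assocAux V W U).comp (IsColinear.map (colinear_incl V W) isColinear_id)

/-- `V ⊗ (W ⊗ U) → (V ⊠ W) ⊠ U` -/
def assocInvAux (V W U : LeftComodule k H) :
    V.carrier ⊗[k] (W.carrier ⊗[k] U.carrier) →ₗ[k] (tensor (tensor V W) U).carrier :=
  proj (tensor V W) U ∘ₗ TensorProduct.map (proj V W) LinearMap.id ∘ₗ
    (TensorProduct.assoc k V.carrier W.carrier U.carrier).symm.toLinearMap

lemma colinear_assocInvAux (V W U : LeftComodule k H) :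
    IsColinear (tensorCoaction V.coaction (tensorCoaction W.coaction U.coaction))
      (tensor (tensor V W) U).coaction (assocInvAux V W U) :=
  (colinear_proj (tensor V W) U).comp
    ((IsColinear.map (colinear_proj V W) isColinear_id).comp isColinear_assoc.symm)

lemma colinear_assocInv (V W U : LeftComodule k H) :
    IsColinear (tensorCoaction V.coaction (tensor W U).coaction)
      (tensor (tensor V W) U).coaction
      (assocInvAux V W U ∘ₗ TensorProduct.map LinearMap.id (incl W U)) :=
  (colinear_assocInvAux V W U).comp (IsColinear.map isColinear_id (colinear_incl W U))

lemma desc_assocHom_tm (v : V.carrier) (w : W.carrier) (u : U.carrier) :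
    desc (assocAux V W U ∘ₗ TensorProduct.map (incl V W) LinearMap.id) (tm (tm v w) u) =
      tm v (tm w u) := by
  rw [desc_tm (colinear_assocHom V W U)]
  have h1 := (colinear_assocAux V W U).counitPart_comp
  rw [counitPart_eq, LinearMap.id_comp] at h1
  have h2 := counitPart_tensor_left (δP := tensorCoaction V.coaction W.coaction)
    (δQ := U.coaction) (isCoassoc_tensor V.isCoassoc W.isCoassoc)
  have h3 : assocAux V W U ∘ₗ (counitPart (tensorCoaction V.coaction W.coaction)).rTensor _ =
      assocAux V W U := by
    rw [h1, LinearMap.comp_assoc, h2]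
  exact LinearMap.congr_fun h3 ((v ⊗ₜ w) ⊗ₜ u)

lemma desc_assocInv_tm (v : V.carrier) (w : W.carrier) (u : U.carrier) :
    desc (assocInvAux V W U ∘ₗ TensorProduct.map LinearMap.id (incl W U)) (tm v (tm w u)) =
      tm (tm v w) u := by
  rw [desc_tm (colinear_assocInv V W U)]
  have h1 := (colinear_assocInvAux V W U).counitPart_comp
  rw [counitPart_eq, LinearMap.id_comp] at h1
  have h2 := counitPart_tensor_right (δP := V.coaction)
    (δQ := tensorCoaction W.coaction U.coaction) (isCoassoc_tensor W.isCoassoc U.isCoassoc)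
  have h3 : assocInvAux V W U ∘ₗ (counitPart (tensorCoaction W.coaction U.coaction)).lTensor _ =
      assocInvAux V W U := by
    rw [h1, LinearMap.comp_assoc, h2]
  exact LinearMap.congr_fun h3 (v ⊗ₜ (w ⊗ₜ u))

lemma tensor_ext_left {Y : Type*} [AddCommGroup Y] [Module k Y]
    {f g : (tensor (tensor V W) U).carrier →ₗ[k] Y}
    (h : ∀ v w u, f (tm (tm v w) u) = g (tm (tm v w) u)) : f = g := by
  apply tensor_ext
  intro x u
  have : (f ∘ₗ proj _ _) ∘ₗ (TensorProduct.mk k _ _).flip u =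
      (g ∘ₗ proj _ _) ∘ₗ (TensorProduct.mk k _ _).flip u := tensor_ext (fun v w => h v w u)
  exact LinearMap.congr_fun this x

lemma tensor_ext_right {Y : Type*} [AddCommGroup Y] [Module k Y]
    {f g : (tensor V (tensor W U)).carrier →ₗ[k] Y}
    (h : ∀ v w u, f (tm v (tm w u)) = g (tm v (tm w u))) : f = g := by
  apply tensor_ext
  intro v x
  have : (f ∘ₗ proj _ _) ∘ₗ TensorProduct.mk k _ _ v =
      (g ∘ₗ proj _ _) ∘ₗ TensorProduct.mk k _ _ v := tensor_ext (fun w u => h v w u)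
  exact LinearMap.congr_fun this x

lemma tensor_ext_four {Y : Type*} [AddCommGroup Y] [Module k Y]
    {f g : (tensor (tensor (tensor V W) U) X).carrier →ₗ[k] Y}
    (h : ∀ v w u x, f (tm (tm (tm v w) u) x) = g (tm (tm (tm v w) u) x)) : f = g := by
  apply tensor_ext
  intro y x
  have : (f ∘ₗ proj _ _) ∘ₗ (TensorProduct.mk k _ _).flip x =
      (g ∘ₗ proj _ _) ∘ₗ (TensorProduct.mk k _ _).flip x :=
    tensor_ext_left (fun v w u => h v w u x)
  exact LinearMap.congr_fun this y

/-- The associator, `(v ⊠ w) ⊠ u ↦ v ⊠ (w ⊠ u)`. -/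
def assocIso (V W U : LeftComodule k H) : tensor (tensor V W) U ≅ tensor V (tensor W U) where
  hom := ⟨_, colinear_desc (colinear_assocHom V W U)⟩
  inv := ⟨_, colinear_desc (colinear_assocInv V W U)⟩
  hom_inv_id := by
    apply hom_ext
    apply tensor_ext_left
    intro v w u
    simp only [comp_toLinearMap, LinearMap.comp_apply, desc_assocHom_tm, desc_assocInv_tm,
      id_toLinearMap, LinearMap.id_apply]
  inv_hom_id := by
    apply hom_ext
    apply tensor_ext_right
    intro v w u
    simp only [comp_toLinearMap, LinearMap.comp_apply, desc_assocHom_tm, desc_assocInv_tm,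
      id_toLinearMap, LinearMap.id_apply]

@[simp] lemma assocIso_hom_tm (v : V.carrier) (w : W.carrier) (u : U.carrier) :
    (assocIso V W U).hom.toLinearMap (tm (tm v w) u) = tm v (tm w u) :=
  desc_assocHom_tm v w u

/-- A bijective comodule morphism with a linear inverse is an isomorphism. -/
def isoOfInverse (f : V ⟶ W) (g : W.carrier →ₗ[k] V.carrier)
    (h₁ : g ∘ₗ f.toLinearMap = LinearMap.id) (h₂ : f.toLinearMap ∘ₗ g = LinearMap.id) : V ≅ W where
  hom := f
  inv := ⟨g, IsColinear.symm (f := LinearEquiv.ofLinearMap f.toLinearMap g h₂ h₁) f.colinear⟩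
  hom_inv_id := hom_ext h₁
  inv_hom_id := hom_ext h₂

/-- The left unitor `z ⊠ v ↦ ε(z v₋₁) v₀`. -/
def leftUnitHom (V : LeftComodule k H) : tensor (unit k H) V ⟶ V where
  toLinearMap := desc (V := unit k H) (leftUnit V.coaction)
  colinear := colinear_desc (V := unit k H) (isColinear_leftUnit V.isCoassoc)

/-- The right unitor `v ⊠ z ↦ ε(v₋₁ z) v₀`. -/
def rightUnitHom (V : LeftComodule k H) : tensor V (unit k H) ⟶ V where
  toLinearMap := desc (W := unit k H) (rightUnit V.coaction)
  colinear := colinear_desc (W := unit k H) (isColinear_rightUnit V.isCoassoc)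

/-- The unit of `H`, as an element of the unit comodule. -/
def unitOne (k : Type u) (H : Type w) [Field k] [Ring H] [Algebra k H] [WeakBialgebra k H] :
    (unit k H).carrier := baseOne k H

lemma leftUnitHom_tm (z : (unit k H).carrier) (v : V.carrier) :
    (leftUnitHom V).toLinearMap (tm z v) = leftUnit V.coaction (z ⊗ₜ v) :=
  desc_tm (V := unit k H) (isColinear_leftUnit V.isCoassoc) z v

lemma rightUnitHom_tm (v : V.carrier) (z : (unit k H).carrier) :
    (rightUnitHom V).toLinearMap (tm v z) = rightUnit V.coaction (v ⊗ₜ z) :=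
  desc_tm (W := unit k H) (isColinear_rightUnit V.isCoassoc) v z

lemma tm_one_leftUnit (z : (unit k H).carrier) (v : V.carrier) :
    tm (unitOne k H) (leftUnit V.coaction (z ⊗ₜ v)) = tm z v :=
  incl_injective _ _ (counitPart_one_leftUnit V.isCoassoc z v)

lemma tm_rightUnit_one (z : (unit k H).carrier) (v : V.carrier) :
    tm (rightUnit V.coaction (v ⊗ₜ z)) (unitOne k H) = tm v z :=
  incl_injective _ _ (counitPart_rightUnit_one V.isCoassoc z v)

lemma tm_triangle (z : (unit k H).carrier) (v : V.carrier) (w : W.carrier) :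
    tm v (leftUnit W.coaction (z ⊗ₜ w)) = tm (rightUnit V.coaction (v ⊗ₜ z)) w :=
  incl_injective _ _ (counitPart_triangle V.isCoassoc W.isCoassoc z v w)

/-- The left unitor. -/
def leftUnitIso (V : LeftComodule k H) : tensor (unit k H) V ≅ V :=
  isoOfInverse (leftUnitHom V)
    (proj (unit k H) V ∘ₗ TensorProduct.mk k _ _ (unitOne k H))
    (tensor_ext fun z v => by
      rw [LinearMap.comp_apply, leftUnitHom_tm]
      exact tm_one_leftUnit z v)
    (LinearMap.ext fun v => (leftUnitHom_tm _ _).trans (leftUnit_one V.counitPart_eq v))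

/-- The right unitor. -/
def rightUnitIso (V : LeftComodule k H) : tensor V (unit k H) ≅ V :=
  isoOfInverse (rightUnitHom V)
    (proj V (unit k H) ∘ₗ (TensorProduct.mk k _ _).flip (unitOne k H))
    (tensor_ext fun v z => by
      rw [LinearMap.comp_apply, rightUnitHom_tm]
      exact tm_rightUnit_one z v)
    (LinearMap.ext fun v => (rightUnitHom_tm _ _).trans (rightUnit_one V.counitPart_eq v))

@[simp] lemma leftUnitIso_hom_tm (z : (unit k H).carrier) (v : V.carrier) :
    (leftUnitIso V).hom.toLinearMap (tm z v) = leftUnit V.coaction (z ⊗ₜ v) :=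
  leftUnitHom_tm z v

@[simp] lemma rightUnitIso_hom_tm (v : V.carrier) (z : (unit k H).carrier) :
    (rightUnitIso V).hom.toLinearMap (tm v z) = rightUnit V.coaction (v ⊗ₜ z) :=
  rightUnitHom_tm v z

lemma map_id : map (𝟙 V) (𝟙 W) = 𝟙 (tensor V W) := by
  apply hom_ext
  apply tensor_ext
  intro v w
  simp only [map_tm, id_toLinearMap, LinearMap.id_apply]

lemma map_comp {V'' W'' : LeftComodule k H} (f : V ⟶ V') (f' : V' ⟶ V'') (g : W ⟶ W')
    (g' : W' ⟶ W'') : map (f ≫ f') (g ≫ g') = map f g ≫ map f' g' := by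
  apply hom_ext
  apply tensor_ext
  intro v w
  simp only [map_tm, comp_toLinearMap, LinearMap.comp_apply]

instance : MonoidalCategoryStruct (LeftComodule k H) where
  tensorObj V W := tensor V W
  whiskerLeft V _ _ g := map (𝟙 V) g
  whiskerRight f W := map f (𝟙 W)
  tensorHom f g := map f g
  tensorUnit := unit k H
  associator V W U := assocIso V W U
  leftUnitor V := leftUnitIso V
  rightUnitor V := rightUnitIso V

lemma pentagon_aux (V W U X : LeftComodule k H) :
    map (assocIso V W U).hom (𝟙 X) ≫ (assocIso V (tensor W U) X).hom ≫
      map (𝟙 V) (assocIso W U X).hom =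
    (assocIso (tensor V W) U X).hom ≫ (assocIso V W (tensor U X)).hom := by
  apply hom_ext
  apply tensor_ext_four
  intro v w u x
  simp only [map_tm, comp_toLinearMap, LinearMap.comp_apply, assocIso_hom_tm, id_toLinearMap,
    LinearMap.id_apply]

lemma triangle_aux (V W : LeftComodule k H) :
    (assocIso V (unit k H) W).hom ≫ map (𝟙 V) (leftUnitIso W).hom =
      map (rightUnitIso V).hom (𝟙 W) := by
  apply hom_ext
  apply tensor_ext_left
  intro v z w
  simp only [map_tm, comp_toLinearMap, LinearMap.comp_apply, assocIso_hom_tm, id_toLinearMap,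
    LinearMap.id_apply, leftUnitIso_hom_tm, rightUnitIso_hom_tm]
  exact tm_triangle z v w

lemma assoc_natural {U' : LeftComodule k H} (f : V ⟶ V') (g : W ⟶ W') (h : U ⟶ U') :
    map (map f g) h ≫ (assocIso V' W' U').hom = (assocIso V W U).hom ≫ map f (map g h) := by
  apply hom_ext
  apply tensor_ext_left
  intro v w u
  simp only [map_tm, comp_toLinearMap, LinearMap.comp_apply, assocIso_hom_tm]

lemma leftUnit_nat (f : V ⟶ W) :
    map (𝟙 (unit k H)) f ≫ (leftUnitIso W).hom = (leftUnitIso V).hom ≫ f := by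
  apply hom_ext
  apply tensor_ext
  intro z v
  simp only [map_tm, comp_toLinearMap, LinearMap.comp_apply, leftUnitIso_hom_tm, id_toLinearMap,
    LinearMap.id_apply]
  exact leftUnit_natural f.colinear z v

lemma rightUnit_nat (f : V ⟶ W) :
    map f (𝟙 (unit k H)) ≫ (rightUnitIso W).hom = (rightUnitIso V).hom ≫ f := by
  apply hom_ext
  apply tensor_ext
  intro v z
  simp only [map_tm, comp_toLinearMap, LinearMap.comp_apply, rightUnitIso_hom_tm, id_toLinearMap,
    LinearMap.id_apply]
  exact rightUnit_natural f.colinear z v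

/-- The monoidal category of finite dimensional left comodules of a weak bialgebra. -/
instance : MonoidalCategory (LeftComodule k H) where
  tensorHom_def f g := by
    change map f g = map f (𝟙 _) ≫ map (𝟙 _) g
    rw [← map_comp, Category.id_comp, Category.comp_id]
  id_tensorHom_id _ _ := map_id
  tensorHom_comp_tensorHom _ _ _ _ := (map_comp _ _ _ _).symm
  whiskerLeft_id _ _ := map_id
  id_whiskerRight _ _ := map_id
  associator_naturality f g h := assoc_natural f g h
  leftUnitor_naturality f := leftUnit_nat f
  rightUnitor_naturality f := rightUnit_nat f
  pentagon V W U X := pentagon_aux V W U X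
  triangle V W := triangle_aux V W

end LeftComodule
end

end WeakBialgebra

noncomputable section

open MonoidalLeftAction Functor ModuleCat

/-- The action `C × D → D` of a module category is a `k`-bilinear bifunctor. (When `C` and `D` are
semisimple abelian categories it is then automatically exact in each variable.) -/
class BilinearAction (k : Type u) [Field k] (C : Type u₁) [Category.{v₁} C] [Preadditive C]
    [Linear k C] [MonoidalCategory C] (D : Type u₂) [Category.{v₂} D] [Preadditive D] [Linear k D]
    [MonoidalLeftAction C D] : Prop where
  add_actionHomLeft : ∀ {X Y : C} (f g : X ⟶ Y) (M : D), (f + g) ⊵ₗ M = f ⊵ₗ M + g ⊵ₗ M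
  smul_actionHomLeft : ∀ {X Y : C} (c : k) (f : X ⟶ Y) (M : D), (c • f) ⊵ₗ M = c • (f ⊵ₗ M)
  actionHomRight_add : ∀ (X : C) {M N : D} (f g : M ⟶ N), X ⊴ₗ (f + g) = X ⊴ₗ f + X ⊴ₗ g
  actionHomRight_smul : ∀ (X : C) {M N : D} (c : k) (f : M ⟶ N), X ⊴ₗ (c • f) = c • (X ⊴ₗ f)

/-- A module functor from the module category `D` over `C` to itself: a `k`-linear functor
`F : D ⥤ D` with morphisms `c_{X,M} : F (X ⊙ M) ⟶ X ⊙ F M`, natural in `X` and `M` and compatible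
with the associativity and unit isomorphisms. The `c_{X,M}` are not required to be invertible. -/
structure ModuleEndofunctor (k : Type u) [Field k] (C : Type u₁) [Category.{v₁} C]
    [MonoidalCategory C] (D : Type u₂) [Category.{v₂} D] [Preadditive D] [Linear k D]
    [MonoidalLeftAction C D] where
  /-- The underlying functor. -/
  functor : D ⥤ D
  [additive : functor.Additive]
  [linear : functor.Linear k]
  /-- The natural morphisms `c_{X,M} : F (X ⊙ M) ⟶ X ⊙ F M`. -/
  [oplax : functor.OplaxLeftLinear C]

namespace ModuleEndofunctor

attribute [instance] additive linear oplax

variable {k : Type u} [Field k] {C : Type u₁} [Category.{v₁} C]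
    [MonoidalCategory C] {D : Type u₂} [Category.{v₂} D] [Preadditive D] [Linear k D]
    [MonoidalLeftAction C D]

/-- The structure morphism `c_{X,M} : F (X ⊙ M) ⟶ X ⊙ F M`. -/
abbrev lineator (F : ModuleEndofunctor k C D) (X : C) (M : D) :
    F.functor.obj (X ⊙ₗ M) ⟶ X ⊙ₗ F.functor.obj M :=
  OplaxLeftLinear.δₗ F.functor X M

/-- A morphism of module functors: a natural transformation commuting with the `c_{X,M}`. -/
@[ext] structure Hom (F G : ModuleEndofunctor k C D) where
  /-- The underlying natural transformation. -/
  natTrans : F.functor ⟶ G.functor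
  comm : ∀ (X : C) (M : D), natTrans.app (X ⊙ₗ M) ≫ G.lineator X M =
    F.lineator X M ≫ X ⊴ₗ natTrans.app M

instance : Category (ModuleEndofunctor k C D) where
  Hom F G := Hom F G
  id F := ⟨𝟙 F.functor, by simp⟩
  comp f g := ⟨f.natTrans ≫ g.natTrans, fun X M => by
    simp [g.comm, reassoc_of% (f.comm X M)]⟩

variable {F F' G G' : ModuleEndofunctor k C D}

@[ext] lemma hom_ext {f g : F ⟶ G} (h : ∀ M, f.natTrans.app M = g.natTrans.app M) : f = g :=
  Hom.ext (NatTrans.ext (funext h))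

@[simp] lemma id_natTrans (F : ModuleEndofunctor k C D) : Hom.natTrans (𝟙 F) = 𝟙 F.functor := rfl

@[simp] lemma comp_natTrans {K : ModuleEndofunctor k C D} (f : F ⟶ G) (g : G ⟶ K) :
    (f ≫ g).natTrans = f.natTrans ≫ g.natTrans := rfl

variable (k C D) in
/-- The identity module functor. -/
def idFunctor : ModuleEndofunctor k C D where
  functor := 𝟭 D
  oplax := { δₗ X M := 𝟙 _ }

/-- The composition `F ∘ G` of module functors, with
`F (G (X ⊙ M)) ⟶ F (X ⊙ G M) ⟶ X ⊙ F (G M)`. -/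
def composition (F G : ModuleEndofunctor k C D) : ModuleEndofunctor k C D where
  functor := G.functor ⋙ F.functor
  oplax :=
    { δₗ X M := F.functor.map (G.lineator X M) ≫ F.lineator X (G.functor.obj M)
      δₗ_naturality_left f M := by
        rw [Functor.comp_map, ← Functor.map_comp_assoc, OplaxLeftLinear.δₗ_naturality_left,
          Functor.map_comp_assoc, OplaxLeftLinear.δₗ_naturality_left, Category.assoc]
        rfl
      δₗ_naturality_right X _ _ g := by
        rw [Functor.comp_map, ← Functor.map_comp_assoc, OplaxLeftLinear.δₗ_naturality_right,
          Functor.map_comp_assoc, OplaxLeftLinear.δₗ_naturality_right, Category.assoc]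
        rfl
      δₗ_associativity X Y M := by
        simp only [Functor.comp_obj, Functor.comp_map, Category.assoc,
          OplaxLeftLinear.δₗ_associativity, actionHomRight_comp]
        rw [← Functor.map_comp_assoc, OplaxLeftLinear.δₗ_associativity]
        simp only [Functor.map_comp, Category.assoc]
        rw [← OplaxLeftLinear.δₗ_naturality_right_assoc]
      δₗ_unitality_inv M := by
        rw [Functor.comp_map, ← Functor.map_comp_assoc, ← OplaxLeftLinear.δₗ_unitality_inv,
          ← OplaxLeftLinear.δₗ_unitality_inv]
        rfl }

lemma lineator_composition (F G : ModuleEndofunctor k C D) (X : C) (M : D) :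
    (composition F G).lineator X M =
      F.functor.map (G.lineator X M) ≫ F.lineator X (G.functor.obj M) := rfl

lemma lineator_id (X : C) (M : D) : (idFunctor k C D).lineator X M = 𝟙 _ := rfl

/-- Horizontal composition of morphisms of module functors. -/
def homComp (f : F ⟶ F') (g : G ⟶ G') : composition F G ⟶ composition F' G' where
  natTrans := g.natTrans ◫ f.natTrans
  comm X M := by
    change (f.natTrans.app (G.functor.obj (X ⊙ₗ M)) ≫ F'.functor.map (g.natTrans.app (X ⊙ₗ M))) ≫
      (F'.functor.map (G'.lineator X M) ≫ F'.lineator X (G'.functor.obj M)) =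
      (F.functor.map (G.lineator X M) ≫ F.lineator X (G.functor.obj M)) ≫
        X ⊴ₗ (f.natTrans.app (G.functor.obj M) ≫ F'.functor.map (g.natTrans.app M))
    rw [Category.assoc, ← Functor.map_comp_assoc, g.comm, Functor.map_comp_assoc,
      OplaxLeftLinear.δₗ_naturality_right, ← NatTrans.naturality_assoc, actionHomRight_comp,
      Category.assoc, ← reassoc_of% (f.comm X (G.functor.obj M))]

@[simp] lemma homComp_app (f : F ⟶ F') (g : G ⟶ G') (M : D) :
    (homComp f g).natTrans.app M =
      f.natTrans.app (G.functor.obj M) ≫ F'.functor.map (g.natTrans.app M) := rfl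

/-- A natural isomorphism compatible with the lineators is an isomorphism of module functors. -/
def isoMk (e : F.functor ≅ G.functor) (h : ∀ (X : C) (M : D),
    e.hom.app (X ⊙ₗ M) ≫ G.lineator X M = F.lineator X M ≫ X ⊴ₗ e.hom.app M) : F ≅ G where
  hom := ⟨e.hom, h⟩
  inv := ⟨e.inv, fun X M => by
    rw [← cancel_epi (e.hom.app (X ⊙ₗ M)), reassoc_of% (h X M)]
    simp [← actionHomRight_comp]⟩
  hom_inv_id := by ext; simp
  inv_hom_id := by ext; simp

/-- The associativity isomorphism, with identity components. -/
def assocIso (F G K : ModuleEndofunctor k C D) :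
    composition (composition F G) K ≅ composition F (composition G K) :=
  isoMk (Functor.associator K.functor G.functor F.functor).symm (fun X M => by
    change 𝟙 _ ≫ F.functor.map (G.functor.map (K.lineator X M) ≫ G.lineator X (K.functor.obj M)) ≫
        F.lineator X (G.functor.obj (K.functor.obj M)) =
      (F.functor.map (G.functor.map (K.lineator X M)) ≫
        F.functor.map (G.lineator X (K.functor.obj M)) ≫
        F.lineator X (G.functor.obj (K.functor.obj M))) ≫ X ⊴ₗ 𝟙 _
    simp only [Functor.map_comp, Category.id_comp, Category.assoc, actionHomRight_id]
    exact congrArg _ (congrArg _ (Category.comp_id _).symm))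

/-- The left unit isomorphism, with identity components. -/
def leftUnitIso (F : ModuleEndofunctor k C D) : composition (idFunctor k C D) F ≅ F :=
  isoMk (Functor.rightUnitor F.functor) (fun X M => by
    change 𝟙 _ ≫ F.lineator X M = (F.lineator X M ≫ 𝟙 _) ≫ X ⊴ₗ 𝟙 _
    simp)

/-- The right unit isomorphism, with identity components. -/
def rightUnitIso (F : ModuleEndofunctor k C D) : composition F (idFunctor k C D) ≅ F :=
  isoMk (Functor.leftUnitor F.functor) (fun X M => by
    change 𝟙 _ ≫ F.lineator X M = (F.functor.map (𝟙 _) ≫ F.lineator X M) ≫ X ⊴ₗ 𝟙 _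
    simp)

/-- The monoidal category of module endofunctors, with `F ⊗ G = F ∘ G`. -/
instance : MonoidalCategory (ModuleEndofunctor k C D) where
  tensorObj F G := composition F G
  whiskerLeft F _ _ g := homComp (𝟙 F) g
  whiskerRight f G := homComp f (𝟙 G)
  tensorHom f g := homComp f g
  tensorUnit := idFunctor k C D
  associator F G K := assocIso F G K
  leftUnitor F := leftUnitIso F
  rightUnitor F := rightUnitIso F
  tensorHom_def {F F' G G'} f g := by
    refine hom_ext fun M => ?_
    change f.natTrans.app (G.functor.obj M) ≫ F'.functor.map (g.natTrans.app M) =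
      (f.natTrans.app (G.functor.obj M) ≫ F'.functor.map (𝟙 (G.functor.obj M))) ≫
        (𝟙 _ ≫ F'.functor.map (g.natTrans.app M))
    simp
  id_tensorHom_id F G := by
    refine hom_ext fun M => ?_
    change 𝟙 _ ≫ F.functor.map (𝟙 (G.functor.obj M)) = 𝟙 (F.functor.obj (G.functor.obj M))
    simp
  tensorHom_comp_tensorHom {F₁ G₁ K₁ F₂ G₂ K₂} f₁ f₂ g₁ g₂ := by
    refine hom_ext fun M => ?_
    change (f₁.natTrans.app (F₂.functor.obj M) ≫ G₁.functor.map (f₂.natTrans.app M)) ≫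
        (g₁.natTrans.app (G₂.functor.obj M) ≫ K₁.functor.map (g₂.natTrans.app M)) =
      (f₁.natTrans.app (F₂.functor.obj M) ≫ g₁.natTrans.app (F₂.functor.obj M)) ≫
        K₁.functor.map (f₂.natTrans.app M ≫ g₂.natTrans.app M)
    simp
  whiskerLeft_id F G := by
    refine hom_ext fun M => ?_
    change 𝟙 _ ≫ F.functor.map (𝟙 (G.functor.obj M)) = 𝟙 (F.functor.obj (G.functor.obj M))
    simp
  id_whiskerRight F G := by
    refine hom_ext fun M => ?_
    change 𝟙 _ ≫ F.functor.map (𝟙 (G.functor.obj M)) = 𝟙 (F.functor.obj (G.functor.obj M))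
    simp
  associator_naturality {F₁ F₂ F₃ G₁ G₂ G₃} f g h := by
    refine hom_ext fun M => ?_
    change ((f.natTrans.app (F₂.functor.obj (F₃.functor.obj M)) ≫
          G₁.functor.map (g.natTrans.app (F₃.functor.obj M))) ≫
          G₁.functor.map (G₂.functor.map (h.natTrans.app M))) ≫ 𝟙 _ =
      𝟙 _ ≫ (f.natTrans.app (F₂.functor.obj (F₃.functor.obj M)) ≫
        G₁.functor.map (g.natTrans.app (F₃.functor.obj M) ≫ G₂.functor.map (h.natTrans.app M)))
    simp
  leftUnitor_naturality {F G} f := by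
    refine hom_ext fun M => ?_
    change (𝟙 (F.functor.obj M) ≫ f.natTrans.app M) ≫ 𝟙 (G.functor.obj M) =
      𝟙 (F.functor.obj M) ≫ f.natTrans.app M
    simp
  rightUnitor_naturality {F G} f := by
    refine hom_ext fun M => ?_
    change (f.natTrans.app M ≫ G.functor.map (𝟙 M)) ≫ 𝟙 (G.functor.obj M) =
      𝟙 (F.functor.obj M) ≫ f.natTrans.app M
    simp
  pentagon F G K L := by
    refine hom_ext fun M => ?_
    change (𝟙 (F.functor.obj (G.functor.obj (K.functor.obj (L.functor.obj M)))) ≫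
        F.functor.map (G.functor.map (K.functor.map (𝟙 (L.functor.obj M))))) ≫
        𝟙 _ ≫ 𝟙 _ ≫ F.functor.map (𝟙 (G.functor.obj (K.functor.obj (L.functor.obj M)))) =
      𝟙 _ ≫ 𝟙 _
    simp
  triangle F G := by
    refine hom_ext fun M => ?_
    change 𝟙 _ ≫ 𝟙 _ ≫ F.functor.map (𝟙 (G.functor.obj M)) =
      𝟙 (F.functor.obj (G.functor.obj M)) ≫ F.functor.map (𝟙 (G.functor.obj M))
    simp

end ModuleEndofunctor

/-- `C` is semisimple with finitely many isomorphism classes of simple objects. -/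
def IsFinitelySemisimple (C : Type u₁) [Category.{v₁} C] [Abelian C] : Prop :=
  haveI : Limits.HasFiniteBiproducts C := Abelian.hasFiniteBiproducts
  ∃ (n : ℕ) (S : Fin n → C), (∀ i, Simple (S i)) ∧
    ∀ X : C, ∃ (m : ℕ) (f : Fin m → Fin n), Nonempty (X ≅ ⨁ fun j => S (f j))

/-- A (nondegenerate) separability idempotent `e = ∑ eᵢ ⊗ fᵢ` of the algebra `R`: one has
`∑ eᵢ fᵢ = 1` and `∑ r eᵢ ⊗ fᵢ = ∑ eᵢ ⊗ fᵢ r`, and there is a (unique) linear form `φ` with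
`∑ φ(eᵢ) fᵢ = 1 = ∑ eᵢ φ(fᵢ)`. If `R` is commutative and separable there is exactly one. -/
structure SeparabilityIdempotent (k : Type u) [Field k] (R : Type w) [Ring R] [Algebra k R] where
  /-- The separability idempotent `e`. -/
  idem : R ⊗[k] R
  /-- The linear form `φ`. -/
  form : R →ₗ[k] k
  mul_idem : LinearMap.mul' k R idem = 1
  comm : ∀ r : R, (r ⊗ₜ[k] (1 : R)) * idem = idem * ((1 : R) ⊗ₜ[k] r)
  form_left : TensorProduct.lid k R (form.rTensor R idem) = 1
  form_right : TensorProduct.rid k R (form.lTensor R idem) = 1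

namespace Reconstruction

variable (k : Type u) [Field k] {R : Type w} [Ring R] [Algebra k R]

/-- An `R`-module is a `k`-vector space. -/
instance fgModule (M : FGModuleCat.{w} R) : Module k M := moduleOfAlgebraModule M.obj

instance fgTower (M : FGModuleCat.{w} R) : IsScalarTower k R M := isScalarTower_of_algebra_moduleCat M.obj

variable {k}
/-- The underlying `k`-linear map of a morphism of `R`-modules. -/
def linMap {M N : FGModuleCat.{w} R} (f : M ⟶ N) : M →ₗ[k] N := f.hom.hom.restrictScalars k

/-- The regular `R`-module. -/
abbrev regular (R : Type w) [Ring R] : FGModuleCat.{w} R := FGModuleCat.of R R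

variable (R) in
/-- The morphism of left `R`-modules `R ⟶ M`, `r ↦ r • m`. -/
def orbit {M : FGModuleCat.{w} R} (m : M) : regular R ⟶ M :=
  FGModuleCat.ofHom (LinearMap.toSpanSingleton R M m)

lemma orbit_apply {M : FGModuleCat.{w} R} (m : M) (r : R) : (orbit R m).hom.hom r = r • m := rfl

lemma orbit_add {M : FGModuleCat.{w} R} (m m' : M) : orbit R (m + m') = orbit R m + orbit R m' := by
  apply FGModuleCat.hom_ext
  ext
  exact smul_add (1 : R) m m'

lemma orbit_smul {M : FGModuleCat.{w} R} (c : k) (m : M) : orbit R (c • m) = c • orbit R m := by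
  apply FGModuleCat.hom_ext
  ext
  exact smul_comm (1 : R) c m

variable {C : Type u₁} [Category.{v₁} C] [Preadditive C] [Linear k C] [MonoidalCategory C]
  [MonoidalLeftAction C (FGModuleCat.{w} R)]

variable (R) in
/-- The `R`-fiber functor `F(X) = X ⊙ R`, as a left `R`-module; the right `R`-module structure is
induced by the right multiplications `R ⟶ R`. -/
abbrev fiber (X : C) : FGModuleCat.{w} R := X ⊙ₗ regular R

variable (k) in
/-- The linear map `F(f) : F(X) → F(Y)`. -/
def fiberMap {X Y : C} (f : X ⟶ Y) : fiber R X →ₗ[k] fiber R Y := linMap (f ⊵ₗ regular R)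

variable [BilinearAction k C (FGModuleCat.{w} R)]

variable (k) in
/-- The map `F(X) ⊗ M → X ⊙ M`, `x ⊗ m ↦ (X ⊙ (r ↦ r m)) (x)`, which induces the canonical
isomorphism `F(X) ⊗_R M ≅ X ⊙ M`. -/
def pairing (X : C) (M : FGModuleCat.{w} R) :
    fiber R X ⊗[k] M →ₗ[k] (X ⊙ₗ M : FGModuleCat.{w} R) :=
  TensorProduct.lift <| LinearMap.mk₂ k (fun x m => linMap (k := k) (X ⊴ₗ orbit R m) x)
    (fun x x' m => map_add _ x x')
    (fun c x m => map_smul _ c x)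
    (fun x m m' => by
      rw [orbit_add, BilinearAction.actionHomRight_add k]
      rfl)
    (fun c x m => by
      rw [orbit_smul, BilinearAction.actionHomRight_smul]
      rfl)

variable (k) in
/-- The map `r ↦ x r` given by the right `R`-module structure of `F(X)`. -/
def rightMul (X : C) (x : fiber R X) : R →ₗ[k] fiber R X where
  toFun r := linMap (k := k) (X ⊴ₗ orbit R (M := regular R) r) x
  map_add' r r' := by
    rw [orbit_add (M := regular R), BilinearAction.actionHomRight_add k]
    rfl
  map_smul' c r := by
    have h : orbit R (M := regular R) (c • r) = c • orbit R (M := regular R) r := by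
      rw [← orbit_smul]
      exact congrArg (orbit R (M := regular R)) (Algebra.smul_def c r)
    rw [h, BilinearAction.actionHomRight_smul]
    rfl

variable (k) in
/-- The map `r ↦ r x` given by the left `R`-module structure of `F(X)`. -/
def leftMul (X : C) (x : fiber R X) : R →ₗ[k] fiber R X :=
  (LinearMap.toSpanSingleton R (fiber R X) x).restrictScalars k

variable (k) in
/-- The map `F(X) ⊗ F(Y) → F(X) ⊗_R F(Y) ≅ F(X ⊗ Y)` given by the monoidal structure of the
`R`-fiber functor. -/
def fiberMul (X Y : C) : fiber R X ⊗[k] fiber R Y →ₗ[k] fiber R (X ⊗ Y) :=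
  linMap (αₗ X Y (regular R)).inv ∘ₗ pairing k X (fiber R Y)

variable (k C R) in
/-- The algebra `H` of natural endomorphisms of the functor `X ↦ F(X)` to vector spaces. -/
def naturalEnd : Subalgebra k (∀ X : C, Module.End k (fiber R X)) where
  carrier := {h | ∀ (X Y : C) (f : X ⟶ Y), h Y ∘ₗ fiberMap k f = fiberMap k f ∘ₗ h X}
  mul_mem' {g h} hg hh X Y f := by
    change (g Y ∘ₗ h Y) ∘ₗ fiberMap k f = fiberMap k f ∘ₗ (g X ∘ₗ h X)
    rw [LinearMap.comp_assoc, hh X Y f, ← LinearMap.comp_assoc, hg X Y f, LinearMap.comp_assoc]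
  add_mem' {g h} hg hh X Y f := by
    change (g Y + h Y) ∘ₗ fiberMap k f = fiberMap k f ∘ₗ (g X + h X)
    rw [LinearMap.add_comp, LinearMap.comp_add, hh X Y f, hg X Y f]
  algebraMap_mem' c X Y f := by
    ext x
    exact (map_smul (fiberMap k f) c x).symm


variable (k C R) in
/-- The action of `H` on `F(X)`. -/
def evalAt (X : C) : naturalEnd k R C →ₗ[k] Module.End k (fiber R X) where
  toFun h := h.1 X
  map_add' _ _ := rfl
  map_smul' _ _ := rfl

variable (k) in
/-- The action of `H ⊗ H` on `F(X) ⊗ F(Y)`. -/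
def evalTwo (X Y : C) : naturalEnd k R C ⊗[k] naturalEnd k R C →ₗ[k]
    Module.End k (fiber R X ⊗[k] fiber R Y) :=
  TensorProduct.homTensorHomMap (RingHom.id k) (fiber R X) (fiber R Y) (fiber R X) (fiber R Y) ∘ₗ
    TensorProduct.map (evalAt k R C X) (evalAt k R C Y)

/-- The coalgebra structure of `H` is the one reconstructed from the `R`-fiber functor and the
separability idempotent `e`: `Δ(h)` acts on `F(X) ⊗ F(Y)` as the composition
`F(X) ⊗ F(Y) → F(X) ⊗_R F(Y) ≅ F(X ⊗ Y) → F(X ⊗ Y) ≅ F(X) ⊗_R F(Y) → F(X) ⊗ F(Y)`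
of the projection, `h_{X ⊗ Y}` and the embedding `x ⊗ y ↦ ∑ x eᵢ ⊗ fᵢ y`, and
`ε(h) = φ(h_𝟙(1))` where `F(𝟙) ≅ R`. As `Δ` is multiplicative, the action of `Δ(h)` is described by
that of `Δ(1)`, the idempotent `x ⊗ y ↦ ∑ x eᵢ ⊗ fᵢ y`, and by its effect on `F(X ⊗ Y)`; so these
conditions determine `Δ` and `ε`. -/
structure IsAttached (S : SeparabilityIdempotent k R) [WeakBialgebra k (naturalEnd k R C)] : Prop where
  comul_mul : ∀ (h : naturalEnd k R C) (X Y : C),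
    fiberMul k X Y ∘ₗ evalTwo k X Y (Coalgebra.comul (R := k) h) = h.1 (X ⊗ Y) ∘ₗ fiberMul k X Y
  comul_one : ∀ (X Y : C) (x : fiber R X) (y : fiber R Y),
    evalTwo k X Y (Coalgebra.comul (R := k) (1 : naturalEnd k R C)) (x ⊗ₜ[k] y) =
      TensorProduct.map (rightMul k X x) (leftMul k Y y) S.idem
  counit_eq : ∀ h : naturalEnd k R C, Coalgebra.counit (R := k) h =
    S.form ((λₗ[C] (regular R)).hom.hom.hom (h.1 (𝟙_ C) ((λₗ[C] (regular R)).inv.hom.hom (1 : R))))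

/-- The equivalence `E` is the natural one: the comodule `E(F)` is naturally identified with `F(R)`,
in such a way that its coaction `v ↦ v₋₁ ⊗ v₀` is given by the `c_{X,R}` through
`c(v ⊗ x) = v₋₁ x ⊗ v₀` for `v ∈ F(R)`, `x ∈ X ⊙ R`, where `v ⊗ x` is in
`F(R) ⊗_R (X ⊙ R) ≅ F(X ⊙ R)` and `v₋₁ x ⊗ v₀` is in `(X ⊙ R) ⊗_R F(R) ≅ X ⊙ F(R)`. -/
def IsCanonical [WeakBialgebra k (naturalEnd k R C)]
    (E : ModuleEndofunctor k C (FGModuleCat.{w} R) ≌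
      WeakBialgebra.LeftComodule k (naturalEnd k R C)) : Prop :=
  ∃ j : ∀ F : ModuleEndofunctor k C (FGModuleCat.{w} R),
      (E.functor.obj F).carrier ≃ₗ[k] F.functor.obj (regular R),
    (∀ (F G : ModuleEndofunctor k C (FGModuleCat.{w} R)) (f : F ⟶ G)
      (v : (E.functor.obj F).carrier),
      j G ((E.functor.map f).toLinearMap v) = linMap (k := k) (f.natTrans.app (regular R)) (j F v)) ∧
    ∀ (F : ModuleEndofunctor k C (FGModuleCat.{w} R)) (v : (E.functor.obj F).carrier)
      (X : C) (x : fiber R X),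
      linMap (k := k) (F.lineator X (regular R))
          (linMap (k := k) (F.functor.map (orbit R x)) (j F v)) =
        pairing k X (F.functor.obj (regular R))
          (TensorProduct.map ((LinearMap.applyₗ x) ∘ₗ evalAt k R C X) (j F).toLinearMap
            ((E.functor.obj F).coaction v))

end Reconstruction

end

/-! The argument rests on two facts about `R`. Finitely generated modules over a semisimple ring are
projective, so a `k`-linear endofunctor `T` of `Rep(R)` is determined by the bimodule `T(R)`, with
`T(M) ≅ T(R) ⊗_R M` (Eilenberg-Watts: `sum_pair_dualBasis`, `natTrans_ext_regular`,
`exists_natTrans_of_rmul`). A separability idempotent `e = ∑ a ⊗ b` realises the quotient `P ⊗_R Q`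
of `P ⊗ Q` as the image of the idempotent `x ⊗ y ↦ ∑ x a ⊗ b y` (`split_balanced`, `comp_split`).
Together they give the projection `T(R) ⊗ M → T(M)` an explicit natural section (`exists_sec`). For
`T = X ⊙ -` at the module `F(Y)` this section is the embedding of `F(X ⊗ Y)` into `F(X) ⊗ F(Y)`.

Let `H = End(F)`. For finite dimensional `Q`, natural maps `F → F ⊗ Q` are the same as elements of
`H ⊗ Q` (`exists_tensor_of_natural`), and tensors over `H` are detected by evaluating their `H`-legs
at elements of the spaces `F(X)` (`JointlyInjective.map`). Elements of `H ⊗ H` can therefore be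
defined, and identities between them checked, on `F(X) ⊗ F(Y)`. This constructs `Δ` and reduces the
axioms of a weak bialgebra to statements about inserting `e`. Coassociativity and the axioms for
`Δ(1)` say that insertions of `e` on the two sides of a middle factor commute; multiplicativity
holds because projecting after embedding is the identity; the counit axioms come from `∑ φ(r a) b =
r = ∑ φ(b r) a`.

For a module functor `T`, the maps `x ↦ c_{X,R}(v ⊗ x)`, followed by the section, are natural in `X`
and so give an element `δ(v)` of `H ⊗ T(R)`. The associativity and unit axioms of `c` become
coassociativity and counitality of `δ` (`IsCoact.isCoassoc`, `IsCoact.counitPart_eq`).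

Conversely, `R` is identified with `H_t` through left multiplications, and `Δ(1) = ∑ right(a) ⊗
left(b)`. Every comodule thus becomes an `R`-bimodule. The identities `Δ(1)Δ(h) = Δ(h) = Δ(h)Δ(1)`
show that `δ(v)` is fixed by the insertion of `e` and that `v₋₁ right(r) ⊗ v₀ = v₋₁ ⊗ v₀ r`
(`sum_map_lact`, `rTensor_right_coaction`). This is what makes `v ⊗ (x ⊗ m) ↦ v₋₁ x ⊗ (v₀ ⊗ m)` well
defined over `R`, so that `A ⊗_R -` is a module functor whose comodule is `A`: the functor is
essentially surjective. Colinear maps are bimodule maps, which by Eilenberg-Watts gives fullness and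
faithfulness.

The functor is monoidal because the tensor product of comodules is the tensor product over `R` of
the underlying bimodules, while `T(T'(R)) = T(R) ⊗_R T'(R)`, with the diagonal coaction
(`IsCoact.isColinear_pair`).

A nondegenerate separability idempotent exists because `R` is a product of matrix algebras, where `∑
E_{jl} a ⊗ E_{lj}` works for any invertible diagonal `a` of trace `1`. -/

noncomputable section

namespace Reconstruction

/-! ### Tensors detected by contractions and by families of linear maps -/

section LinearAlgebra

variable {k : Type*} [Field k] {A B Q Q' M : Type*} [AddCommGroup A] [Module k A] [AddCommGroup B]
  [Module k B] [AddCommGroup Q] [Module k Q] [AddCommGroup Q'] [Module k Q']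
  [AddCommGroup M] [Module k M]

/-- The contraction `a ⊗ q ↦ β(q) a`. -/
def contract (A : Type*) [AddCommGroup A] [Module k A] (β : Q →ₗ[k] k) : A ⊗[k] Q →ₗ[k] A :=
  (TensorProduct.rid k A).toLinearMap ∘ₗ β.lTensor A

@[simp] lemma contract_tmul (β : Q →ₗ[k] k) (a : A) (q : Q) :
    contract A β (a ⊗ₜ q) = β q • a := by
  simp [contract]

lemma contract_rTensor (β : Q →ₗ[k] k) (f : A →ₗ[k] B) (t : A ⊗[k] Q) :
    contract B β (f.rTensor Q t) = f (contract A β t) := by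
  induction t with
  | zero => simp
  | add a b ha hb => simp [ha, hb]
  | tmul a b => simp

/-- The contractions with the coordinate forms of a basis of `Q` are the coefficients of `t` in that
basis. No finiteness of `Q` is needed. -/
lemma tensor_eq_zero_of_contract {t : A ⊗[k] Q} (h : ∀ β : Q →ₗ[k] k, contract A β t = 0) :
    t = 0 := by
  classical
  let b := Module.Basis.ofVectorSpace k Q
  apply (TensorProduct.equivFinsuppOfBasisRight (M := A) b).injective
  ext i
  rw [map_zero, Finsupp.zero_apply, ← h (b.coord i)]
  clear h
  induction t with
  | zero => simp
  | add a b ha hb => simp [ha, hb]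
  | tmul a b => simp [TensorProduct.equivFinsuppOfBasisRight_apply_tmul_apply]

/-- The reverse direction, for finite bases: a tensor is rebuilt from its contractions. It turns a
natural map `F → F ⊗ Q` into an element of `H ⊗ Q`. -/
lemma sum_contract_basis {ι : Type*} [Fintype ι] (b : Module.Basis ι k Q) (t : A ⊗[k] Q) :
    ∑ i, contract A (b.coord i) t ⊗ₜ[k] b i = t := by
  induction t with
  | zero => simp
  | add a b ha hb =>
    simp only [map_add, TensorProduct.add_tmul, Finset.sum_add_distrib, ha, hb]
  | tmul a q =>
    simp only [contract_tmul, TensorProduct.smul_tmul, ← TensorProduct.tmul_sum]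
    simp [b.sum_repr]

/-- A family of linear maps with trivial common kernel. -/
def JointlyInjective {ι : Type*} {N : ι → Type*} [∀ i, AddCommGroup (N i)] [∀ i, Module k (N i)]
    (f : ∀ i, A →ₗ[k] N i) : Prop :=
  ∀ a, (∀ i, f i a = 0) → a = 0

lemma JointlyInjective.ext {ι : Type*} {N : ι → Type*} [∀ i, AddCommGroup (N i)]
    [∀ i, Module k (N i)] {f : ∀ i, A →ₗ[k] N i} (hf : JointlyInjective f) {a b : A}
    (h : ∀ i, f i a = f i b) : a = b :=
  sub_eq_zero.1 (hf _ fun i => by rw [map_sub, h, sub_self])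

lemma jointlyInjective_id :
    JointlyInjective (fun _ : Unit => (LinearMap.id : A →ₗ[k] A)) :=
  fun _ h => h ()

/-- Contraction of `Q` commutes with each `f i`, so every contraction of `t` lies in the common
kernel of the family. -/
lemma JointlyInjective.rTensor {ι : Type*} {N : ι → Type*} [∀ i, AddCommGroup (N i)]
    [∀ i, Module k (N i)] {f : ∀ i, A →ₗ[k] N i} (hf : JointlyInjective f) {t : A ⊗[k] Q}
    (h : ∀ i, (f i).rTensor Q t = 0) : t = 0 :=
  tensor_eq_zero_of_contract fun β => hf _ fun i => by
    rw [← contract_rTensor, h, map_zero]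

/-- The device by which identities in `H ⊗ H` and `H ⊗ H ⊗ H` are checked on tensor products of
fibers. -/
lemma JointlyInjective.map {ι κ : Type*} {N : ι → Type*} {P : κ → Type*}
    [∀ i, AddCommGroup (N i)] [∀ i, Module k (N i)] [∀ i, AddCommGroup (P i)]
    [∀ i, Module k (P i)] {f : ∀ i, A →ₗ[k] N i} {g : ∀ i, Q →ₗ[k] P i}
    (hf : JointlyInjective f) (hg : JointlyInjective g) :
    JointlyInjective (fun p : ι × κ => TensorProduct.map (f p.1) (g p.2)) := by
  intro t h
  refine hf.rTensor fun i => ?_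
  -- The factors are swapped so that the one-sided statement applies to `Q` as well.
  rw [← (TensorProduct.comm k _ _).map_eq_zero_iff]
  refine hg.rTensor fun j => ?_
  have h1 := congrArg (TensorProduct.comm k _ _) (h (i, j))
  rw [map_zero] at h1
  rw [← h1]
  clear h h1
  induction t with
  | zero => simp
  | add a b ha hb => simp [ha, hb]
  | tmul a q => simp

end LinearAlgebra

variable {k : Type u} [Field k] {R : Type w} [Ring R] [Algebra k R]

/-! ### Morphisms of `R`-modules as `k`-linear maps -/

section Morphisms

variable {M N P : FGModuleCat.{w} R}

lemma linMap_comp (f : M ⟶ N) (g : N ⟶ P) (x : M) :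
    linMap (k := k) (f ≫ g) x = linMap (k := k) g (linMap (k := k) f x) := rfl

@[simp] lemma linMap_id (x : M) : linMap (k := k) (𝟙 M) x = x := rfl

lemma linMap_smul (f : M ⟶ N) (r : R) (x : M) :
    linMap (k := k) f (r • x) = r • linMap (k := k) f x := f.hom.hom.map_smul r x

lemma linMap_add (f g : M ⟶ N) (x : M) :
    linMap (k := k) (f + g) x = linMap (k := k) f x + linMap (k := k) g x := rfl

lemma linMap_sum {ι : Type*} (s : Finset ι) (f : ι → (M ⟶ N)) (x : M) :
    linMap (k := k) (∑ i ∈ s, f i) x = ∑ i ∈ s, linMap (k := k) (f i) x := by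
  classical
  induction s using Finset.induction_on with
  | empty => rfl
  | insert a s ha ih => rw [Finset.sum_insert ha, Finset.sum_insert ha, linMap_add, ih]

lemma linMap_ext {f g : M ⟶ N} (h : ∀ x, linMap (k := k) f x = linMap (k := k) g x) : f = g :=
  FGModuleCat.hom_ext (LinearMap.ext h)

@[simp] lemma linMap_hom_inv (e : M ≅ N) (x : M) :
    linMap (k := k) e.inv (linMap (k := k) e.hom x) = x := by
  rw [← linMap_comp, e.hom_inv_id, linMap_id]

@[simp] lemma linMap_inv_hom (e : M ≅ N) (x : N) :
    linMap (k := k) e.hom (linMap (k := k) e.inv x) = x := by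
  rw [← linMap_comp, e.inv_hom_id, linMap_id]

lemma orbit_comp (m : M) (f : M ⟶ N) : orbit R m ≫ f = orbit R (linMap (k := k) f m) :=
  linMap_ext (k := k) fun x => linMap_smul f x m

lemma orbit_one : orbit R (M := regular R) (1 : R) = 𝟙 _ :=
  FGModuleCat.hom_ext (LinearMap.ext fun r : R => mul_one r)

lemma orbit_mul (r s : R) : orbit R (M := regular R) (r * s) =
    orbit R (M := regular R) r ≫ orbit R (M := regular R) s :=
  FGModuleCat.hom_ext (LinearMap.ext fun t : R => (mul_assoc t r s).symm)

end Morphisms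

/-! ### Linear endofunctors `T` of `Rep(R)` and the bimodule `T(R)` -/

section Pair

/-- A `k`-linear endofunctor of the category of finitely generated `R`-modules. -/
class IsLinearFunctor (k : Type u) [Field k] [Algebra k R]
    (T : FGModuleCat.{w} R ⥤ FGModuleCat.{w} R) : Prop where
  map_add : ∀ {M N : FGModuleCat.{w} R} (f g : M ⟶ N), T.map (f + g) = T.map f + T.map g
  map_smul : ∀ {M N : FGModuleCat.{w} R} (c : k) (f : M ⟶ N), T.map (c • f) = c • T.map f

instance (T : FGModuleCat.{w} R ⥤ FGModuleCat.{w} R) [T.Additive] [T.Linear k] :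
    IsLinearFunctor k T where
  map_add _ _ := T.map_add
  map_smul _ _ := T.map_smul _ _

variable (T T' : FGModuleCat.{w} R ⥤ FGModuleCat.{w} R) [IsLinearFunctor k T]
  [IsLinearFunctor k T']

variable (k) in
/-- The map `r ↦ v r` given by the right `R`-module structure of `T(R)`. -/
def rmul (v : T.obj (regular R)) : R →ₗ[k] T.obj (regular R) where
  toFun r := linMap (k := k) (T.map (orbit R (M := regular R) r)) v
  map_add' r r' := by
    rw [orbit_add (M := regular R), IsLinearFunctor.map_add k]
    rfl
  map_smul' c r := by
    have h : orbit R (M := regular R) (c • r) = c • orbit R (M := regular R) r := by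
      rw [← orbit_smul]
      exact congrArg (orbit R (M := regular R)) (Algebra.smul_def c r)
    rw [h, IsLinearFunctor.map_smul]
    rfl

lemma rmul_apply (v : T.obj (regular R)) (r : R) :
    rmul k T v r = linMap (k := k) (T.map (orbit R (M := regular R) r)) v := rfl

@[simp] lemma rmul_one (v : T.obj (regular R)) : rmul k T v 1 = v := by
  rw [rmul_apply, orbit_one, T.map_id, linMap_id]

lemma rmul_mul (v : T.obj (regular R)) (r s : R) : rmul k T v (r * s) = rmul k T (rmul k T v r) s := by
  rw [rmul_apply, rmul_apply, rmul_apply, ← linMap_comp, ← T.map_comp, orbit_mul]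

lemma rmul_smul (v : T.obj (regular R)) (r s : R) : rmul k T (r • v) s = r • rmul k T v s :=
  linMap_smul (k := k) _ _ _

lemma rmul_add (v v' : T.obj (regular R)) (s : R) : rmul k T (v + v') s = rmul k T v s + rmul k T v' s :=
  map_add (linMap (k := k) _) _ _

variable (k) in
/-- The map `T(R) ⊗ M → T(M)`, `v ⊗ m ↦ T(r ↦ r m)(v)`. -/
def pair (M : FGModuleCat.{w} R) : T.obj (regular R) ⊗[k] M →ₗ[k] T.obj M :=
  TensorProduct.lift <| LinearMap.mk₂ k (fun x m => linMap (k := k) (T.map (orbit R m)) x)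
    (fun x x' m => map_add _ x x')
    (fun c x m => map_smul _ c x)
    (fun x m m' => by
      rw [orbit_add, IsLinearFunctor.map_add k]
      rfl)
    (fun c x m => by
      rw [orbit_smul, IsLinearFunctor.map_smul]
      rfl)

variable {T T'} {M N : FGModuleCat.{w} R}

lemma pair_tmul (v : T.obj (regular R)) (m : M) :
    pair k T M (v ⊗ₜ m) = linMap (k := k) (T.map (orbit R m)) v := rfl

lemma pair_map (f : M ⟶ N) (v : T.obj (regular R)) (m : M) :
    linMap (k := k) (T.map f) (pair k T M (v ⊗ₜ m)) = pair k T N (v ⊗ₜ linMap (k := k) f m) := by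
  rw [pair_tmul, pair_tmul, ← orbit_comp, T.map_comp, linMap_comp]

lemma pair_natTrans (η : T ⟶ T') (v : T.obj (regular R)) (m : M) :
    linMap (k := k) (η.app M) (pair k T M (v ⊗ₜ m)) =
      pair k T' M (linMap (k := k) (η.app _) v ⊗ₜ m) := by
  rw [pair_tmul, pair_tmul, ← linMap_comp, ← linMap_comp, η.naturality]

lemma pair_smul (r : R) (v : T.obj (regular R)) (m : M) :
    pair k T M ((r • v) ⊗ₜ m) = r • pair k T M (v ⊗ₜ m) :=
  linMap_smul (k := k) _ _ _

/-- The morphism `R ⟶ M` attached to `r m` is right multiplication by `r` followed by the one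
attached to `m`. Hence `pair` factors through `T(R) ⊗_R M`. -/
lemma pair_rmul (r : R) (v : T.obj (regular R)) (m : M) :
    pair k T M (rmul k T v r ⊗ₜ m) = pair k T M (v ⊗ₜ (r • m)) := by
  rw [pair_tmul, pair_tmul, rmul_apply, ← linMap_comp, ← T.map_comp, orbit_comp (k := k)]
  rfl

lemma rmul_natTrans (η : T ⟶ T') (v : T.obj (regular R)) (r : R) :
    linMap (k := k) (η.app _) (rmul k T v r) = rmul k T' (linMap (k := k) (η.app _) v) r := by
  rw [rmul_apply, rmul_apply, ← linMap_comp, ← linMap_comp, η.naturality]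

end Pair

end Reconstruction

end

/-! ### Calculus with a separability idempotent -/

noncomputable section

namespace SeparabilityIdempotent

variable {k : Type u} [Field k] {R : Type w} [Ring R] [Algebra k R]

lemma exists_sum_eq_idem (S : SeparabilityIdempotent k R) :
    ∃ s : Finset (R × R), S.idem = ∑ p ∈ s, p.1 ⊗ₜ[k] p.2 :=
  TensorProduct.exists_finset S.idem

/-- A finite set of pairs `(a, b)` with `e = ∑ a ⊗ b`. -/
def support (S : SeparabilityIdempotent k R) : Finset (R × R) := S.exists_sum_eq_idem.choose

lemma idem_eq_sum (S : SeparabilityIdempotent k R) : S.idem = ∑ p ∈ S.support, p.1 ⊗ₜ[k] p.2 :=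
  S.exists_sum_eq_idem.choose_spec

variable (S : SeparabilityIdempotent k R)

lemma sum_mul : ∑ p ∈ S.support, p.1 * p.2 = 1 := by
  have h := S.mul_idem
  rw [idem_eq_sum, map_sum] at h
  exact h

lemma sum_mul_tmul {P Q : Type*} [AddCommGroup P] [Module k P] [AddCommGroup Q] [Module k Q]
    (f : R →ₗ[k] P) (g : R →ₗ[k] Q) (r : R) :
    ∑ p ∈ S.support, f (r * p.1) ⊗ₜ[k] g p.2 = ∑ p ∈ S.support, f p.1 ⊗ₜ[k] g (p.2 * r) := by
  have h := congrArg (TensorProduct.map f g) (S.comm r)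
  rw [idem_eq_sum, Finset.mul_sum, Finset.sum_mul, map_sum, map_sum] at h
  simpa using h

/-- The relation `r e = e r` moves `r` to the second leg, where `∑ φ(a) b = 1` finishes. The two
legs of `e` are thus dual for `(r, s) ↦ φ(r s)`; this and its mirror image are the only uses of
nondegeneracy. -/
lemma sum_form_mul (r : R) : ∑ p ∈ S.support, S.form (r * p.1) • p.2 = r := by
  have h := congrArg (TensorProduct.lid k R) (S.sum_mul_tmul S.form LinearMap.id r)
  have h2 := S.form_left
  rw [idem_eq_sum] at h2
  simp only [map_sum, LinearMap.rTensor_tmul, TensorProduct.lid_tmul, LinearMap.id_apply] at h h2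
  rw [h]
  conv_rhs => rw [← one_mul r, ← h2, Finset.sum_mul]
  simp

lemma sum_form_mul_right (r : R) : ∑ p ∈ S.support, S.form (p.2 * r) • p.1 = r := by
  have h := congrArg (TensorProduct.rid k R) (S.sum_mul_tmul LinearMap.id S.form r)
  have h2 := S.form_right
  rw [idem_eq_sum] at h2
  simp only [map_sum, LinearMap.lTensor_tmul, TensorProduct.rid_tmul, LinearMap.id_apply] at h h2
  rw [← h]
  conv_rhs => rw [← mul_one r, ← h2, Finset.mul_sum]
  simp

variable {P Q N : Type*} [AddCommGroup P] [Module k P] [AddCommGroup Q] [Module k Q]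
  [AddCommGroup N] [Module k N]

/-- The map `x ⊗ y ↦ ∑ x aᵢ ⊗ bᵢ y` on `P ⊗ Q`, for a right action on `P` and a left action
on `Q`. -/
def split (ρ : R →ₗ[k] Module.End k P) (l : R →ₗ[k] Module.End k Q) : P ⊗[k] Q →ₗ[k] P ⊗[k] Q :=
  ∑ p ∈ S.support, TensorProduct.map (ρ p.1) (l p.2)

variable {ρ : R →ₗ[k] Module.End k P} {l : R →ₗ[k] Module.End k Q}

lemma split_tmul (x : P) (y : Q) :
    S.split ρ l (x ⊗ₜ y) = ∑ p ∈ S.support, ρ p.1 x ⊗ₜ l p.2 y := by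
  simp [split]

/-- This is `r e = e r` carried to `P ⊗ Q`. With `comp_split` it shows that `split` is an idempotent
whose image is a copy of `P ⊗_R Q`. -/
lemma split_balanced (hρ : ∀ r s, ρ (r * s) = ρ s ∘ₗ ρ r) (hl : ∀ r s, l (r * s) = l r ∘ₗ l s)
    (r : R) (x : P) (y : Q) : S.split ρ l (ρ r x ⊗ₜ y) = S.split ρ l (x ⊗ₜ l r y) := by
  have h := S.sum_mul_tmul ((LinearMap.applyₗ x) ∘ₗ ρ) ((LinearMap.applyₗ y) ∘ₗ l) r
  simpa [split_tmul, hρ, hl] using h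

/-- A balanced map lets the first leg of `e` pass to the second factor, where `∑ a b = 1`. -/
lemma comp_split (hl1 : l 1 = LinearMap.id) (hl : ∀ r s, l (r * s) = l r ∘ₗ l s)
    {g : P ⊗[k] Q →ₗ[k] N}
    (hg : ∀ r x y, g (ρ r x ⊗ₜ y) = g (x ⊗ₜ l r y)) : g ∘ₗ S.split ρ l = g := by
  apply TensorProduct.ext'
  intro x y
  simp only [LinearMap.comp_apply, split_tmul, map_sum, hg]
  have : ∀ p : R × R, l p.1 (l p.2 y) = l (p.1 * p.2) y := fun p => by rw [hl]; rfl
  simp only [this]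
  rw [← map_sum, ← TensorProduct.tmul_sum, ← LinearMap.sum_apply, ← map_sum, S.sum_mul, hl1]
  rfl

end SeparabilityIdempotent

/-! ### Eilenberg-Watts: `T(M)` as `T(R) ⊗_R M` -/

namespace Reconstruction

variable {k : Type u} [Field k] {R : Type w} [Ring R] [Algebra k R]

/-- Semisimplicity splits a surjection `Rⁿ → M`. The `p j` are the coordinates of the splitting and
the `m j` the images of the basis vectors. -/
lemma exists_dualBasis [IsSemisimpleRing R] (M : FGModuleCat.{w} R) :
    ∃ (n : ℕ) (p : Fin n → (M ⟶ regular R)) (m : Fin n → M),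
      ∑ j, p j ≫ orbit R (m j) = 𝟙 M := by
  obtain ⟨n, f, hf⟩ := Module.Finite.exists_fin' R M
  obtain ⟨s, hs⟩ := IsSemisimpleModule.lifting_property f hf LinearMap.id
  refine ⟨n, fun j => FGModuleCat.ofHom (LinearMap.proj j ∘ₗ s), fun j => f (Pi.single j 1), ?_⟩
  apply FGModuleCat.hom_ext
  ext x
  have h : ∀ (t : Finset (Fin n)) (g : Fin n → (M ⟶ M)), (∑ j ∈ t, g j).hom.hom x =
      ∑ j ∈ t, (g j).hom.hom x := by
    intro t g
    induction t using Finset.induction_on with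
    | empty => rfl
    | insert a t ha ih => rw [Finset.sum_insert ha, Finset.sum_insert ha, ← ih]; rfl
  rw [h]
  have h2 : ∀ j, (FGModuleCat.ofHom (LinearMap.proj j ∘ₗ s) ≫ orbit R (f (Pi.single j 1)) :
      M ⟶ M).hom.hom x = f (Pi.single j (s x j)) := by
    intro j
    rw [← mul_one (s x j), ← smul_eq_mul, Pi.single_smul, map_smul]
    rfl
  rw [Finset.sum_congr rfl fun j _ => h2 j, ← map_sum, Finset.univ_sum_single]
  exact LinearMap.congr_fun hs x

section Functors

variable (T T' : FGModuleCat.{w} R ⥤ FGModuleCat.{w} R) [IsLinearFunctor k T]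
  [IsLinearFunctor k T']

variable (k) in
/-- The right action of `R` on `T(R)`. -/
def rmulHom : R →ₗ[k] Module.End k (T.obj (regular R)) :=
  LinearMap.mk₂ k (fun r v => rmul k T v r) (fun r s _ => map_add _ r s)
    (fun c r _ => map_smul _ c r) (fun _ v v' => rmul_add T v v' _)
    (fun c _ v => map_smul (linMap (k := k) _) c v)

variable (k) in
/-- The left action of `R` on `M`. -/
def lmulHom (M : FGModuleCat.{w} R) : R →ₗ[k] Module.End k M :=
  LinearMap.mk₂ k (fun r m => r • m) (fun r s m => add_smul r s m)
    (fun c r m => smul_assoc c r m) (fun r m m' => smul_add r m m')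
    (fun c r m => smul_comm r c m)

@[simp] lemma lmulHom_apply (M : FGModuleCat.{w} R) (r : R) (m : M) : lmulHom k M r m = r • m := rfl

lemma rmulHom_mul (r s : R) : rmulHom k T (r * s) = rmulHom k T s ∘ₗ rmulHom k T r :=
  LinearMap.ext fun v => rmul_mul T v r s

lemma lmulHom_mul (M : FGModuleCat.{w} R) (r s : R) :
    lmulHom k M (r * s) = lmulHom k M r ∘ₗ lmulHom k M s :=
  LinearMap.ext fun m => mul_smul r s m

lemma lmulHom_one (M : FGModuleCat.{w} R) : lmulHom k M 1 = LinearMap.id :=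
  LinearMap.ext fun m => one_smul R m

variable [IsSemisimpleRing R] {T T'} {M : FGModuleCat.{w} R}

/-- Apply the additive functor `T` to the dual basis identity; by definition of `pair`, each summand
is the pairing of `T(p j) z` with `m j`. -/
lemma sum_pair_dualBasis {n : ℕ} {p : Fin n → (M ⟶ regular R)} {m : Fin n → M}
    (h : ∑ j, p j ≫ orbit R (m j) = 𝟙 M) (z : T.obj M) :
    ∑ j, pair k T M (linMap (k := k) (T.map (p j)) z ⊗ₜ m j) = z := by
  have h1 := congrArg (fun f => linMap (k := k) (T.map f) z) h
  have : T.Additive := ⟨IsLinearFunctor.map_add k _ _⟩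
  simp only [T.map_sum, T.map_comp, T.map_id, linMap_sum, linMap_comp, linMap_id] at h1
  exact h1

variable (k T M) in
lemma pair_surjective : Function.Surjective (pair k T M) := by
  obtain ⟨n, p, m, h⟩ := exists_dualBasis M
  intro z
  exact ⟨_, (map_sum _ _ _).trans (sum_pair_dualBasis h z)⟩

lemma pair_ext {N : Type*} [AddCommGroup N] [Module k N] {f g : T.obj M →ₗ[k] N}
    (h : ∀ v m, f (pair k T M (v ⊗ₜ m)) = g (pair k T M (v ⊗ₜ m))) : f = g := by
  have h1 : f ∘ₗ pair k T M = g ∘ₗ pair k T M := TensorProduct.ext' h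
  exact LinearMap.cancel_right (pair_surjective k T M) |>.1 h1

lemma pair_hom_ext {N : FGModuleCat.{w} R} {f g : T.obj M ⟶ N}
    (h : ∀ v m, linMap (k := k) f (pair k T M (v ⊗ₜ m)) =
      linMap (k := k) g (pair k T M (v ⊗ₜ m))) : f = g :=
  linMap_ext (k := k) (LinearMap.congr_fun (pair_ext (T := T) h))

/-- A natural transformation of `k`-linear functors is determined by its component at `R`. -/
lemma natTrans_ext_regular (k : Type u) [Field k] [Algebra k R]
    {T T' : FGModuleCat.{w} R ⥤ FGModuleCat.{w} R} [IsLinearFunctor k T]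
    [IsLinearFunctor k T'] {η θ : T ⟶ T'} (h : η.app (regular R) = θ.app (regular R)) : η = θ := by
  ext1
  ext1 M
  exact pair_hom_ext (k := k) fun v m => by rw [pair_natTrans, pair_natTrans, h]

/-- A map of `R`-bimodules `T(R) → T'(R)` extends to a natural transformation. -/
lemma exists_natTrans_of_rmul (g : T.obj (regular R) ⟶ T'.obj (regular R))
    (hg : ∀ v r, linMap (k := k) g (rmul k T v r) = rmul k T' (linMap (k := k) g v) r) :
    ∃ η : T ⟶ T', η.app (regular R) = g := by
  choose n p m h using fun M : FGModuleCat.{w} R => exists_dualBasis M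
  -- On `T(R) ⊗_R M` the extension should be `g ⊗ id`. The dual basis gives a formula for it, and
  -- `hη` shows that the choice does not matter, which yields naturality.
  let η (M : FGModuleCat.{w} R) : T.obj M ⟶ T'.obj M :=
    ∑ j, T.map (p M j) ≫ g ≫ T'.map (orbit R (m M j))
  have hη (M : FGModuleCat.{w} R) (v : T.obj (regular R)) (x : M) :
      linMap (k := k) (η M) (pair k T M (v ⊗ₜ x)) = pair k T' M (linMap (k := k) g v ⊗ₜ x) := by
    rw [← sum_pair_dualBasis (k := k) (T := T') (h M) (pair k T' M (linMap (k := k) g v ⊗ₜ x))]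
    simp only [η, linMap_sum, linMap_comp]
    refine Finset.sum_congr rfl fun j _ => ?_
    have h1 : linMap (k := k) (T.map (p M j)) (pair k T M (v ⊗ₜ x)) =
        rmul k T v (linMap (k := k) (p M j) x) := pair_map (p M j) v x
    have h2 : linMap (k := k) (T'.map (p M j)) (pair k T' M (linMap (k := k) g v ⊗ₜ x)) =
        rmul k T' (linMap (k := k) g v) (linMap (k := k) (p M j) x) := pair_map (p M j) _ x
    rw [h1, hg, h2]
    rfl
  refine ⟨{ app := η, naturality := fun M N f => ?_ }, ?_⟩
  · refine pair_hom_ext (k := k) fun v x => ?_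
    rw [linMap_comp, linMap_comp, pair_map, hη, hη, pair_map]
  · refine pair_hom_ext (k := k) fun v x => ?_
    refine (hη _ v x).trans ?_
    exact (hg v x).symm

section Sec

variable (S : SeparabilityIdempotent k R)

/-- The image of `split` is a copy of `T(R) ⊗_R M ≅ T(M)`, so the section is forced: expand in a
dual basis, then insert `e`. -/
lemma exists_sec (T : FGModuleCat.{w} R ⥤ FGModuleCat.{w} R) [IsLinearFunctor k T]
    (M : FGModuleCat.{w} R) : ∃ s : T.obj M →ₗ[k] T.obj (regular R) ⊗[k] M,
      pair k T M ∘ₗ s = LinearMap.id ∧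
        s ∘ₗ pair k T M = S.split (rmulHom k T) (lmulHom k M) := by
  obtain ⟨n, p, m, h⟩ := exists_dualBasis M
  have hb : pair k T M ∘ₗ S.split (rmulHom k T) (lmulHom k M) = pair k T M :=
    S.comp_split (lmulHom_one M) (lmulHom_mul M) fun r x y => pair_rmul r x y
  have hbal := S.split_balanced (rmulHom_mul (k := k) T) (lmulHom_mul (k := k) M)
  -- `s₀` is already a section of `pair`, but depends on the dual basis. After `split`, balancedness
  -- moves the coefficients `p j x` to the second factor, where they recombine to `x`.
  let s₀ : T.obj M →ₗ[k] T.obj (regular R) ⊗[k] M :=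
    ∑ j, (TensorProduct.mk k _ M).flip (m j) ∘ₗ linMap (k := k) (T.map (p j))
  have hs₀ (z) : s₀ z = ∑ j, linMap (k := k) (T.map (p j)) z ⊗ₜ m j := by
    simp [s₀]
  refine ⟨S.split (rmulHom k T) (lmulHom k M) ∘ₗ s₀, ?_, ?_⟩
  · rw [← LinearMap.comp_assoc, hb]
    ext z
    rw [LinearMap.comp_apply, hs₀, map_sum]
    exact sum_pair_dualBasis h z
  · apply TensorProduct.ext'
    intro v x
    rw [LinearMap.comp_apply, LinearMap.comp_apply, hs₀, map_sum]
    have h1 (j) : linMap (k := k) (T.map (p j)) (pair k T M (v ⊗ₜ x)) =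
        rmulHom k T (linMap (k := k) (p j) x) v := pair_map (p j) v x
    simp only [h1, hbal]
    rw [← map_sum, ← TensorProduct.tmul_sum]
    congr 2
    have h2 := congrArg (fun f => linMap (k := k) f x) h
    simp only [linMap_sum, linMap_comp, linMap_id] at h2
    exact h2

/-- The section `T(M) → T(R) ⊗ M` of `pair` given by a separability idempotent. -/
def sec (T : FGModuleCat.{w} R ⥤ FGModuleCat.{w} R) [IsLinearFunctor k T]
    (M : FGModuleCat.{w} R) : T.obj M →ₗ[k] T.obj (regular R) ⊗[k] M :=
  (exists_sec S T M).choose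

@[simp] lemma pair_sec (z : T.obj M) : pair k T M (sec S T M z) = z :=
  LinearMap.congr_fun (exists_sec S T M).choose_spec.1 z

lemma sec_pair (t : T.obj (regular R) ⊗[k] M) :
    sec S T M (pair k T M t) = S.split (rmulHom k T) (lmulHom k M) t :=
  LinearMap.congr_fun (exists_sec S T M).choose_spec.2 t

lemma sec_pair_tmul (v : T.obj (regular R)) (m : M) :
    sec S T M (pair k T M (v ⊗ₜ m)) = ∑ p ∈ S.support, rmul k T v p.1 ⊗ₜ (p.2 • m) := by
  rw [sec_pair, S.split_tmul]
  rfl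

/-- As `pair` is surjective and the section has an explicit formula on its image, this naturality
and the next two can be tested on pure tensors. -/
lemma sec_map {N : FGModuleCat.{w} R} (f : M ⟶ N) (z : T.obj M) :
    sec S T N (linMap (k := k) (T.map f) z) = (linMap (k := k) f).lTensor _ (sec S T M z) := by
  refine LinearMap.congr_fun (f := sec S T N ∘ₗ linMap (k := k) (T.map f))
    (g := (linMap (k := k) f).lTensor _ ∘ₗ sec S T M) (pair_ext fun v m => ?_) z
  simp only [LinearMap.comp_apply, pair_map, sec_pair_tmul, map_sum, LinearMap.lTensor_tmul,
    linMap_smul]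

lemma sec_natTrans (η : T ⟶ T') (z : T.obj M) :
    sec S T' M (linMap (k := k) (η.app M) z) =
      (linMap (k := k) (η.app (regular R))).rTensor _ (sec S T M z) := by
  refine LinearMap.congr_fun (f := sec S T' M ∘ₗ linMap (k := k) (η.app M))
    (g := (linMap (k := k) (η.app (regular R))).rTensor _ ∘ₗ sec S T M)
    (pair_ext fun v m => ?_) z
  simp only [LinearMap.comp_apply, pair_natTrans, sec_pair_tmul, map_sum, LinearMap.rTensor_tmul,
    rmul_natTrans]

lemma sec_smul (r : R) (z : T.obj M) :
    sec S T M (r • z) = (lmulHom k _ r).rTensor _ (sec S T M z) := by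
  refine LinearMap.congr_fun (f := sec S T M ∘ₗ lmulHom k _ r)
    (g := (lmulHom k _ r).rTensor _ ∘ₗ sec S T M) (pair_ext fun v m => ?_) z
  simp only [LinearMap.comp_apply, lmulHom_apply, ← pair_smul, sec_pair_tmul, map_sum,
    LinearMap.rTensor_tmul, rmul_smul]

end Sec

end Functors

end Reconstruction

end

/-! ### The fiber functor and its natural endomorphisms -/

noncomputable section

open MonoidalLeftAction

namespace Reconstruction

variable {k : Type u} [Field k] {R : Type w} [Ring R] [Algebra k R]
variable {C : Type u₁} [Category.{v₁} C] [Preadditive C] [Linear k C] [MonoidalCategory C]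
  [MonoidalLeftAction C (FGModuleCat.{w} R)]

/-- The functor `M ↦ X ⊙ M`. -/
abbrev actionFunctor (X : C) : FGModuleCat.{w} R ⥤ FGModuleCat.{w} R where
  obj M := X ⊙ₗ M
  map f := X ⊴ₗ f

section Natural

variable {X Y : C}

lemma fiberMap_comp_apply {Z : C} (f : X ⟶ Y) (g : Y ⟶ Z) (x : fiber R X) :
    fiberMap k (f ≫ g) x = fiberMap k g (fiberMap k f x) := by
  simp only [fiberMap, comp_actionHomLeft, linMap_comp]

lemma fiberMap_id_apply (x : fiber R X) : fiberMap k (𝟙 X) x = x := by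
  simp only [fiberMap, id_actionHomLeft, linMap_id]

@[simp] lemma fiberMap_hom_inv (e : X ≅ Y) (x : fiber R X) :
    fiberMap k e.inv (fiberMap k e.hom x) = x := by
  rw [← fiberMap_comp_apply, e.hom_inv_id, fiberMap_id_apply]

lemma fiberMap_smul (f : X ⟶ Y) (r : R) (x : fiber R X) :
    fiberMap k f (r • x) = r • fiberMap k f x := linMap_smul (k := k) _ _ _

lemma naturalEnd_fiberMap (h : naturalEnd k R C) (f : X ⟶ Y) (x : fiber R X) :
    h.1 Y (fiberMap k f x) = fiberMap k f (h.1 X x) := LinearMap.congr_fun (h.2 X Y f) x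

end Natural

variable (k) in
/-- Evaluation of natural endomorphisms at an element of `F(X)`. -/
def evalElem (X : C) (x : fiber R X) : naturalEnd k R C →ₗ[k] fiber R X :=
  LinearMap.applyₗ x ∘ₗ evalAt k R C X

lemma jointlyInjective_evalElem : JointlyInjective
    (fun p : Σ X : C, fiber R X => evalElem (C := C) k p.1 p.2) := by
  intro h hh
  apply Subtype.ext
  funext X
  ext x
  exact hh ⟨X, x⟩

variable (k C) in
/-- Left multiplication by `r ∈ R` on the fiber functor. -/
def leftEnd : R →ₗ[k] naturalEnd k R C where
  toFun r := ⟨fun X => lmulHom k (fiber R X) r, fun X Y f => by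
    ext x
    exact (fiberMap_smul f r x).symm⟩
  map_add' r s := Subtype.ext <| funext fun X => map_add (lmulHom k (fiber R X)) r s
  map_smul' c r := Subtype.ext <| funext fun X => map_smul (lmulHom k (fiber R X)) c r

variable [BilinearAction k C (FGModuleCat.{w} R)]

instance (X : C) : IsLinearFunctor k (actionFunctor (R := R) X) where
  map_add f g := BilinearAction.actionHomRight_add k X f g
  map_smul c f := BilinearAction.actionHomRight_smul X c f

/-! ### The isomorphisms `F(X) ⊗_R M ≅ X ⊙ M` and their compatibilities -/

section Pairing

variable {X Y Z : C} {M N : FGModuleCat.{w} R}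

lemma pairing_tmul (x : fiber R X) (m : M) :
    pairing k X M (x ⊗ₜ m) = linMap (k := k) (X ⊴ₗ orbit R m) x := rfl

lemma pairing_map (f : M ⟶ N) (x : fiber R X) (m : M) :
    linMap (k := k) (X ⊴ₗ f) (pairing k X M (x ⊗ₜ m)) = pairing k X N (x ⊗ₜ linMap (k := k) f m) :=
  pair_map (T := actionFunctor X) f x m

/-- The exchange law for the action: a morphism acting on the `C` side commutes with `R ⟶ M` acting
on the module side. -/
lemma pairing_mapLeft (f : X ⟶ Y) (x : fiber R X) (m : M) :
    linMap (k := k) (f ⊵ₗ M) (pairing k X M (x ⊗ₜ m)) = pairing k Y M (fiberMap k f x ⊗ₜ m) := by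
  rw [pairing_tmul, pairing_tmul, fiberMap, ← linMap_comp, ← linMap_comp, action_exchange]

lemma pairing_smul (r : R) (x : fiber R X) (m : M) :
    pairing k X M ((r • x) ⊗ₜ m) = r • pairing k X M (x ⊗ₜ m) :=
  pair_smul (T := actionFunctor X) r x m

lemma rightMul_one (x : fiber R X) : rightMul k X x 1 = x := rmul_one (actionFunctor X) x

lemma rightMul_mul (x : fiber R X) (r s : R) :
    rightMul k X x (r * s) = rightMul k X (rightMul k X x r) s := rmul_mul (actionFunctor X) x r s

lemma rightMul_smul (x : fiber R X) (r s : R) :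
    rightMul k X (r • x) s = r • rightMul k X x s := rmul_smul (actionFunctor X) x r s

lemma fiberMap_rightMul (f : X ⟶ Y) (x : fiber R X) (r : R) :
    fiberMap k f (rightMul k X x r) = rightMul k Y (fiberMap k f x) r :=
  pairing_mapLeft (M := regular R) f x r

lemma fiberMul_tmul (x : fiber R X) (y : fiber R Y) : fiberMul k X Y (x ⊗ₜ y) =
    linMap (k := k) (αₗ X Y (regular R)).inv (pairing k X (fiber R Y) (x ⊗ₜ y)) := rfl

lemma assoc_fiberMul (t : fiber R X ⊗[k] fiber R Y) :
    linMap (k := k) (αₗ X Y (regular R)).hom (fiberMul k X Y t) = pairing k X (fiber R Y) t :=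
  linMap_inv_hom _ _

variable (k) in
lemma orbit_fiberMul (x : fiber R X) (y : fiber R Y) : orbit R (fiberMul k X Y (x ⊗ₜ y)) =
    orbit R x ≫ X ⊴ₗ orbit R y ≫ (αₗ X Y (regular R)).inv := by
  rw [orbit_comp (k := k)]
  rfl

/-- The action of `X ⊗ Y` on `R ⟶ M` is the iterated action conjugated by the associativity
isomorphism. All associativity of tensor products over `R` used below comes from this identity. -/
lemma pairing_assoc (x : fiber R X) (y : fiber R Y) (m : M) :
    linMap (k := k) (αₗ X Y M).hom (pairing k (X ⊗ Y) M (fiberMul k X Y (x ⊗ₜ y) ⊗ₜ m)) =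
      pairing k X (Y ⊙ₗ M) (x ⊗ₜ pairing k Y M (y ⊗ₜ m)) := by
  rw [pairing_tmul, tensor_actionHomRight, linMap_comp, assoc_fiberMul, linMap_comp,
    linMap_inv_hom, pairing_map]
  rfl

/-- The case `M = R` of `pairing_assoc`, with the associativity isomorphism cancelled. -/
lemma rightMul_fiberMul (r : R) (x : fiber R X) (y : fiber R Y) :
    rightMul k (X ⊗ Y) (fiberMul k X Y (x ⊗ₜ y)) r = fiberMul k X Y (x ⊗ₜ rightMul k Y y r) := by
  have h := pairing_assoc (k := k) (M := regular R) x y r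
  have h2 := congrArg (linMap (k := k) (αₗ X Y (regular R)).inv) h
  rw [linMap_hom_inv] at h2
  exact h2

lemma fiberMap_whiskerRight_fiberMul (f : X ⟶ Y) (x : fiber R X) (z : fiber R Z) :
    fiberMap k (f ▷ Z) (fiberMul k X Z (x ⊗ₜ z)) = fiberMul k Y Z (fiberMap k f x ⊗ₜ z) := by
  rw [fiberMap, whiskerRight_actionHomLeft, linMap_comp, assoc_fiberMul, linMap_comp,
    pairing_mapLeft, fiberMul_tmul]

lemma fiberMap_whiskerLeft_fiberMul (f : X ⟶ Y) (z : fiber R Z) (x : fiber R X) :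
    fiberMap k (Z ◁ f) (fiberMul k Z X (z ⊗ₜ x)) = fiberMul k Z Y (z ⊗ₜ fiberMap k f x) := by
  rw [fiberMap, whiskerLeft_actionHomLeft, linMap_comp, assoc_fiberMul, linMap_comp,
    pairing_map, fiberMul_tmul, fiberMap]

/-- The fiber functor respects associators: evaluate the pentagon of the action at `R` and move `x`,
`y`, `z` through it by `pairing_assoc`. -/
lemma fiberMap_associator (x : fiber R X) (y : fiber R Y) (z : fiber R Z) :
    fiberMap k (α_ X Y Z).hom (fiberMul k (X ⊗ Y) Z (fiberMul k X Y (x ⊗ₜ y) ⊗ₜ z)) =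
      fiberMul k X (Y ⊗ Z) (x ⊗ₜ fiberMul k Y Z (y ⊗ₜ z)) := by
  have h := congrArg (fun f => linMap (k := k) f
    (fiberMul k (X ⊗ Y) Z (fiberMul k X Y (x ⊗ₜ y) ⊗ₜ z)))
    (associator_actionHom X Y Z (regular R))
  simp only [linMap_comp, assoc_fiberMul, pairing_assoc] at h
  have h2 := congrArg (linMap (k := k) (X ⊴ₗ (αₗ Y Z (regular R)).inv)) h
  rw [← linMap_comp (X ⊴ₗ (αₗ Y Z (regular R)).hom), actionHomRight_hom_inv, linMap_id,
    pairing_map] at h2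
  exact (linMap_hom_inv (αₗ X (Y ⊗ Z) (regular R)) _).symm.trans
    (congrArg (linMap (k := k) (αₗ X (Y ⊗ Z) (regular R)).inv) h2)

end Pairing

/-! ### The identification of `F(𝟙)` with `R` -/

section Unit

variable (k C) in
/-- The map `F(𝟙) ≅ R`. -/
def unitVal : fiber R (𝟙_ C) →ₗ[k] R where
  toFun x := linMap (k := k) (λₗ[C] (regular R)).hom x
  map_add' x y := map_add (linMap (k := k) (λₗ[C] (regular R)).hom) x y
  map_smul' c x := by
    have h : linMap (k := k) (λₗ[C] (regular R)).hom (c • x) =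
        algebraMap k R c • linMap (k := k) (λₗ[C] (regular R)).hom x :=
      linMap_smul (k := k) _ (algebraMap k R c) x
    exact h.trans (Algebra.smul_def (A := R) c _).symm

variable (R C) in
/-- The element of `F(𝟙)` corresponding to `1 ∈ R`. -/
def unitElem : fiber R (𝟙_ C) := (λₗ[C] (regular R)).inv.hom.hom (1 : R)

variable {X Y : C} {M : FGModuleCat.{w} R}

lemma unitVal_unitElem : unitVal k C (unitElem R C) = 1 :=
  linMap_inv_hom (k := k) (λₗ[C] (regular R)) (1 : R)

lemma unitVal_smul (r : R) (x : fiber R (𝟙_ C)) : unitVal k C (r • x) = r * unitVal k C x :=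
  linMap_smul (k := k) _ _ _

lemma unitVal_injective : Function.Injective (unitVal k C (R := R)) := fun x y h => by
  have h2 := congrArg (fun z : regular R => linMap (k := k) (λₗ[C] (regular R)).inv z) h
  exact ((linMap_hom_inv _ _).symm.trans h2).trans (linMap_hom_inv _ _)

lemma unitVal_smul_unitElem (x : fiber R (𝟙_ C)) : unitVal k C x • unitElem R C = x :=
  unitVal_injective (k := k) (by rw [unitVal_smul, unitVal_unitElem, mul_one])

lemma unit_pairing (x : fiber R (𝟙_ C)) (m : M) :
    linMap (k := k) (λₗ[C] M).hom (pairing k (𝟙_ C) M (x ⊗ₜ m)) = unitVal k C x • m := by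
  rw [pairing_tmul, ← linMap_comp, ← actionUnitIso_hom_naturality, linMap_comp]
  rfl

lemma unitVal_rightMul (x : fiber R (𝟙_ C)) (r : R) :
    unitVal k C (rightMul k _ x r) = unitVal k C x * r :=
  unit_pairing (M := regular R) x r

lemma rightMul_unitElem (r : R) : rightMul k _ (unitElem R C) r = r • unitElem R C :=
  unitVal_injective (k := k) (by
    rw [unitVal_rightMul, unitVal_smul, unitVal_unitElem, one_mul, mul_one])

lemma orbit_unitElem : orbit R (unitElem R C) = (λₗ[C] (regular R)).inv :=
  FGModuleCat.hom_ext <| LinearMap.ext fun r : R =>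
    ((λₗ[C] (regular R)).inv.hom.hom.map_smul r (1 : R)).symm.trans
      (congrArg (λₗ[C] (regular R)).inv.hom.hom (mul_one r))

lemma fiberMap_leftUnitor (x : fiber R (𝟙_ C)) (y : fiber R X) :
    fiberMap k (λ_ X).hom (fiberMul k _ X (x ⊗ₜ y)) = unitVal k C x • y := by
  rw [fiberMap, leftUnitor_actionHom, linMap_comp, assoc_fiberMul, unit_pairing]

lemma fiberMap_rightUnitor (x : fiber R X) (y : fiber R (𝟙_ C)) :
    fiberMap k (ρ_ X).hom (fiberMul k X _ (x ⊗ₜ y)) = rightMul k X x (unitVal k C y) := by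
  rw [fiberMap, rightUnitor_actionHom, linMap_comp, assoc_fiberMul, pairing_map]
  rfl

end Unit

variable (k C) in
/-- Right multiplication by `r ∈ R` on the fiber functor. -/
def rightEnd : R →ₗ[k] naturalEnd k R C where
  toFun r := ⟨fun X => rmulHom k (actionFunctor X) r, fun X Y f => by
    ext x
    exact (fiberMap_rightMul f x r).symm⟩
  map_add' r s := Subtype.ext <| funext fun X => map_add (rmulHom k (actionFunctor X)) r s
  map_smul' c r := Subtype.ext <| funext fun X => map_smul (rmulHom k (actionFunctor X)) c r

/-! ### Sections of the projections onto tensor products over `R` -/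

section Sections

variable [IsSemisimpleRing R] (S : SeparabilityIdempotent k R) {X Y Z : C} {M N : FGModuleCat.{w} R}

variable (k X M) in
lemma pairing_surjective : Function.Surjective (pairing k X M) :=
  pair_surjective k (actionFunctor X) M

variable (X M) in
/-- The section `X ⊙ M → F(X) ⊗ M` of `pairing`. -/
def pairingSec : (X ⊙ₗ M : FGModuleCat.{w} R) →ₗ[k] fiber R X ⊗[k] M := sec S (actionFunctor X) M

/-- The idempotent `x ⊗ m ↦ ∑ x aᵢ ⊗ bᵢ m` of `F(X) ⊗ M`. -/
abbrev pairingSplit (X : C) (M : FGModuleCat.{w} R) : fiber R X ⊗[k] M →ₗ[k] fiber R X ⊗[k] M :=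
  S.split (rmulHom k (actionFunctor X)) (lmulHom k M)

lemma pairingSplit_tmul (x : fiber R X) (m : M) :
    pairingSplit S X M (x ⊗ₜ m) = ∑ p ∈ S.support, rightMul k X x p.1 ⊗ₜ (p.2 • m) :=
  S.split_tmul x m

@[simp] lemma pairing_pairingSec (z : (X ⊙ₗ M : FGModuleCat.{w} R)) :
    pairing k X M (pairingSec S X M z) = z := pair_sec (T := actionFunctor X) S z

lemma pairingSec_pairing (t : fiber R X ⊗[k] M) :
    pairingSec S X M (pairing k X M t) = pairingSplit S X M t :=
  sec_pair S (T := actionFunctor X) t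

lemma pairingSec_map (f : M ⟶ N) (z : (X ⊙ₗ M : FGModuleCat.{w} R)) :
    pairingSec S X N (linMap (k := k) (X ⊴ₗ f) z) =
      (linMap (k := k) f).lTensor _ (pairingSec S X M z) :=
  sec_map S (T := actionFunctor X) f z

lemma pairingSec_smul (r : R) (z : (X ⊙ₗ M : FGModuleCat.{w} R)) :
    pairingSec S X M (r • z) = (lmulHom k _ r).rTensor _ (pairingSec S X M z) :=
  sec_smul S (T := actionFunctor X) r z

lemma pairingSec_mapLeft (f : X ⟶ Y) (z : (X ⊙ₗ M : FGModuleCat.{w} R)) :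
    pairingSec S Y M (linMap (k := k) (f ⊵ₗ M) z) =
      (fiberMap k f).rTensor _ (pairingSec S X M z) :=
  sec_natTrans S (T := actionFunctor X) (T' := actionFunctor Y)
    { app := fun M => f ⊵ₗ M, naturality := fun _ _ g => action_exchange f g } z

variable (X Y) in
/-- The embedding `F(X ⊗ Y) → F(X) ⊗ F(Y)`. -/
def fiberSec : fiber R (X ⊗ Y) →ₗ[k] fiber R X ⊗[k] fiber R Y :=
  pairingSec S X (fiber R Y) ∘ₗ linMap (k := k) (αₗ X Y (regular R)).hom

@[simp] lemma fiberMul_fiberSec (z : fiber R (X ⊗ Y)) :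
    fiberMul k X Y (fiberSec S X Y z) = z := by
  simp [fiberSec, fiberMul]

lemma fiberSec_fiberMul (t : fiber R X ⊗[k] fiber R Y) :
    fiberSec S X Y (fiberMul k X Y t) = pairingSplit S X (fiber R Y) t := by
  rw [← pairingSec_pairing, ← assoc_fiberMul]
  rfl

lemma fiberSec_fiberMul_tmul (x : fiber R X) (y : fiber R Y) :
    fiberSec S X Y (fiberMul k X Y (x ⊗ₜ y)) =
      ∑ p ∈ S.support, rightMul k X x p.1 ⊗ₜ (p.2 • y) := by
  rw [fiberSec_fiberMul, pairingSplit_tmul]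

include S in
variable (X Y) in
lemma fiberMul_surjective : Function.Surjective (fiberMul k (R := R) X Y) :=
  fun z => ⟨fiberSec S X Y z, fiberMul_fiberSec S z⟩

/-- On pure tensors this is right `R`-linearity of `F(f)`, which lets it pass the leg `a` of `e`.
The other whiskering uses left linearity and the leg `b`. -/
lemma fiberSec_whiskerRight (f : X ⟶ Y) (z : fiber R (X ⊗ Z)) :
    fiberSec S Y Z (fiberMap k (f ▷ Z) z) = (fiberMap k f).rTensor _ (fiberSec S X Z z) := by
  obtain ⟨t, rfl⟩ := fiberMul_surjective S X Z z
  induction t with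
  | zero => simp
  | add a b ha hb => simp only [map_add, ha, hb]
  | tmul a b =>
    rw [fiberMap_whiskerRight_fiberMul, fiberSec_fiberMul_tmul, fiberSec_fiberMul_tmul]
    simp [fiberMap_rightMul]

lemma fiberSec_whiskerLeft (f : X ⟶ Y) (z : fiber R (Z ⊗ X)) :
    fiberSec S Z Y (fiberMap k (Z ◁ f) z) = (fiberMap k f).lTensor _ (fiberSec S Z X z) := by
  obtain ⟨t, rfl⟩ := fiberMul_surjective S Z X z
  induction t with
  | zero => simp
  | add a b ha hb => simp only [map_add, ha, hb]
  | tmul a b =>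
    rw [fiberMap_whiskerLeft_fiberMul, fiberSec_fiberMul_tmul, fiberSec_fiberMul_tmul]
    simp [fiberMap_smul]

end Sections

end Reconstruction

end

/-! ### An algebra acting by all natural endomorphisms of `F`, and its comultiplication -/

noncomputable section

open MonoidalLeftAction

namespace Reconstruction

section TensorMaps

variable {k : Type*} [Field k] {A B M N P Q : Type*} [AddCommGroup A] [Module k A]
  [AddCommGroup B] [Module k B] [AddCommGroup M] [Module k M] [AddCommGroup N] [Module k N]
  [AddCommGroup P] [Module k P] [AddCommGroup Q] [Module k Q]

lemma JointlyInjective.rTensor_ext {ι : Type*} {N : ι → Type*} [∀ i, AddCommGroup (N i)]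
    [∀ i, Module k (N i)] {f : ∀ i, A →ₗ[k] N i} (hf : JointlyInjective f) {s t : A ⊗[k] Q}
    (h : ∀ i, (f i).rTensor Q s = (f i).rTensor Q t) : s = t :=
  sub_eq_zero.1 <| hf.rTensor fun i => by rw [map_sub, h, sub_self]

lemma comm_lTensor (f : A →ₗ[k] B) (t : M ⊗[k] A) :
    TensorProduct.comm k M B (f.lTensor M t) = f.rTensor M (TensorProduct.comm k M A t) := by
  induction t with
  | zero => simp
  | add a b ha hb => simp only [map_add, ha, hb]
  | tmul a b => simp

lemma rTensor_comm_rTensor (f : A →ₗ[k] M) (g : B →ₗ[k] N) (t : B ⊗[k] A) :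
    f.rTensor N (TensorProduct.comm k N A (g.rTensor A t)) =
      TensorProduct.map f g (TensorProduct.comm k B A t) := by
  induction t with
  | zero => simp
  | add a b ha hb => simp only [map_add, ha, hb]
  | tmul a b => simp

end TensorMaps

section TensorAct

variable {k : Type*} [Field k] {A B M N : Type*} [Ring A] [Algebra k A] [Ring B] [Algebra k B]
  [AddCommGroup M] [Module k M] [AddCommGroup N] [Module k N]

/-- The action of `A ⊗ B` on `M ⊗ N`. -/
def tensorAct (ρ : A →ₗ[k] Module.End k M) (σ : B →ₗ[k] Module.End k N) :
    A ⊗[k] B →ₗ[k] Module.End k (M ⊗[k] N) :=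
  TensorProduct.homTensorHomMap (RingHom.id k) M N M N ∘ₗ TensorProduct.map ρ σ

lemma tensorAct_tmul (ρ : A →ₗ[k] Module.End k M) (σ : B →ₗ[k] Module.End k N) (a : A) (b : B) :
    tensorAct ρ σ (a ⊗ₜ b) = TensorProduct.map (ρ a) (σ b) := by
  simp [tensorAct]

lemma tensorAct_apply_tmul (ρ : A →ₗ[k] Module.End k M) (σ : B →ₗ[k] Module.End k N) (t : A ⊗[k] B)
    (m : M) (n : N) : tensorAct ρ σ t (m ⊗ₜ n) =
      TensorProduct.map (LinearMap.applyₗ m ∘ₗ ρ) (LinearMap.applyₗ n ∘ₗ σ) t := by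
  induction t with
  | zero => simp
  | add a b ha hb => simp only [map_add, LinearMap.add_apply, ha, hb]
  | tmul a b => simp [tensorAct_tmul]

lemma tensorAct_mul {ρ : A →ₗ[k] Module.End k M} {σ : B →ₗ[k] Module.End k N}
    (hρ : ∀ a b, ρ (a * b) = ρ a ∘ₗ ρ b) (hσ : ∀ a b, σ (a * b) = σ a ∘ₗ σ b)
    (s t : A ⊗[k] B) : tensorAct ρ σ (s * t) = tensorAct ρ σ s ∘ₗ tensorAct ρ σ t := by
  induction s with
  | zero => simp
  | add a b ha hb => simp only [add_mul, map_add, LinearMap.add_comp, ha, hb]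
  | tmul a b =>
    induction t with
    | zero => simp
    | add a b ha hb => simp only [mul_add, map_add, LinearMap.comp_add, ha, hb]
    | tmul c d =>
      rw [Algebra.TensorProduct.tmul_mul_tmul, tensorAct_tmul, tensorAct_tmul, tensorAct_tmul,
        hρ, hσ, TensorProduct.map_comp]

end TensorAct

variable {k : Type u} [Field k] {R : Type w} [Ring R] [Algebra k R]
variable {C : Type u₁} [Category.{v₁} C] [Preadditive C] [Linear k C] [MonoidalCategory C]
  [MonoidalLeftAction C (FGModuleCat.{w} R)]

lemma finiteDimensional_fgModule [FiniteDimensional k R] (M : FGModuleCat.{w} R) :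
    FiniteDimensional k M := Module.Finite.trans R M

variable [BilinearAction k C (FGModuleCat.{w} R)]

section Unit

variable {X : C}

lemma fiberMul_unitElem_left (x : fiber R X) :
    fiberMul k _ X (unitElem R C ⊗ₜ x) = fiberMap k (λ_ X).inv x := by
  have h := fiberMap_leftUnitor (k := k) (unitElem R C) x
  rw [unitVal_unitElem, one_smul] at h
  rw [← fiberMap_hom_inv (k := k) (λ_ X) (fiberMul k _ X _), h]

lemma fiberMul_unitElem_right (x : fiber R X) :
    fiberMul k X _ (x ⊗ₜ unitElem R C) = fiberMap k (ρ_ X).inv x := by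
  have h := fiberMap_rightUnitor (k := k) x (unitElem R C)
  rw [unitVal_unitElem, rightMul_one] at h
  rw [← fiberMap_hom_inv (k := k) (ρ_ X) (fiberMul k X _ _), h]

end Unit

variable (k R C) in
/-- An algebra `H` acting on the fiber functor by all of its natural endomorphisms. -/
structure FiberRep (H : Type v) [Ring H] [Algebra k H] where
  /-- The action on `F(X)`. -/
  act : ∀ X : C, H →ₗ[k] Module.End k (fiber R X)
  act_mul : ∀ X g h x, act X (g * h) x = act X g (act X h x)
  act_one : ∀ X x, act X 1 x = x
  act_fiberMap : ∀ {X Y : C} (f : X ⟶ Y) h x,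
    act Y h (fiberMap k f x) = fiberMap k f (act X h x)
  jointlyInjective : JointlyInjective
    (fun p : Σ X : C, fiber R X => LinearMap.applyₗ p.2 ∘ₗ act p.1)
  exists_act : ∀ θ : ∀ X : C, Module.End k (fiber R X),
    (∀ (X Y : C) (f : X ⟶ Y) (x : fiber R X), θ Y (fiberMap k f x) = fiberMap k f (θ X x)) →
    ∃ h, ∀ X, act X h = θ X
  /-- The left multiplications. -/
  left : R →ₗ[k] H
  /-- The right multiplications. -/
  right : R →ₗ[k] H
  act_left : ∀ r X x, act X (left r) x = r • x
  act_right : ∀ r X x, act X (right r) x = rightMul k X x r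

namespace FiberRep

variable {H : Type v} [Ring H] [Algebra k H] (ρ : FiberRep k R C H)

/-- The evaluation `h ↦ h x`. -/
def ev (X : C) (x : fiber R X) : H →ₗ[k] fiber R X := LinearMap.applyₗ x ∘ₗ ρ.act X

@[simp] lemma ev_apply (X : C) (x : fiber R X) (h : H) : ρ.ev X x h = ρ.act X h x := rfl

lemma jointlyInjective_ev : JointlyInjective (fun p : Σ X : C, fiber R X => ρ.ev p.1 p.2) :=
  ρ.jointlyInjective

/-- The action of `H ⊗ H` on `F(X) ⊗ F(Y)`. -/
def actTwo (X Y : C) : H ⊗[k] H →ₗ[k] Module.End k (fiber R X ⊗[k] fiber R Y) :=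
  tensorAct (ρ.act X) (ρ.act Y)

/-- `Nat(F, F ⊗ Q) = End(F) ⊗ Q`: the coordinates of `θ` in a basis of `Q` are natural endomorphisms
of `F`, hence given by elements of `H`. Both `Δ` and the coactions are obtained from this;
uniqueness is `tensor_ext`. -/
lemma exists_tensor_of_natural {Q : Type*} [AddCommGroup Q] [Module k Q] [FiniteDimensional k Q]
    (θ : ∀ X : C, fiber R X →ₗ[k] fiber R X ⊗[k] Q)
    (hθ : ∀ (X Y : C) (f : X ⟶ Y) (x : fiber R X),
      θ Y (fiberMap k f x) = (fiberMap k f).rTensor Q (θ X x)) :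
    ∃ t : H ⊗[k] Q, ∀ (X : C) (x : fiber R X),
      (ρ.ev X x).rTensor Q t = θ X x := by
  let b := Module.finBasis k Q
  have h1 (i : Fin (Module.finrank k Q)) : ∃ h : H, ∀ X, ρ.act X h =
      contract (fiber R X) (b.coord i) ∘ₗ θ X := ρ.exists_act _ fun X Y f x => by
    simp only [LinearMap.comp_apply, hθ, contract_rTensor]
  choose h hh using h1
  refine ⟨∑ i, h i ⊗ₜ b i, fun X x => ?_⟩
  rw [map_sum]
  simp only [LinearMap.rTensor_tmul, ev_apply, hh]
  exact sum_contract_basis b (θ X x)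

lemma tensor_ext {Q : Type*} [AddCommGroup Q] [Module k Q]
    {s t : H ⊗[k] Q}
    (h : ∀ (X : C) (x : fiber R X), (ρ.ev X x).rTensor Q s = (ρ.ev X x).rTensor Q t) :
    s = t :=
  ρ.jointlyInjective_ev.rTensor_ext fun p => h p.1 p.2

lemma tensorTwo_ext {s t : H ⊗[k] H}
    (h : ∀ (X Y : C) (x : fiber R X) (y : fiber R Y),
      TensorProduct.map (ρ.ev X x) (ρ.ev Y y) s =
        TensorProduct.map (ρ.ev X x) (ρ.ev Y y) t) : s = t :=
  (ρ.jointlyInjective_ev.map ρ.jointlyInjective_ev).ext fun _ => h _ _ _ _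

lemma actTwo_tmul (X Y : C) (t : H ⊗[k] H) (x : fiber R X)
    (y : fiber R Y) : ρ.actTwo X Y t (x ⊗ₜ y) =
      TensorProduct.map (ρ.ev X x) (ρ.ev Y y) t :=
  tensorAct_apply_tmul _ _ t x y

lemma actTwo_mul (X Y : C) (s t : H ⊗[k] H) :
    ρ.actTwo X Y (s * t) = ρ.actTwo X Y s ∘ₗ ρ.actTwo X Y t :=
  tensorAct_mul (fun a b => LinearMap.ext (ρ.act_mul X a b))
    (fun a b => LinearMap.ext (ρ.act_mul Y a b)) s t

section Unit

variable {X : C}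

/-- Inserting the unit of `F(𝟙)` is `F` of the inverse unitor, with which `h` commutes by
naturality. -/
lemma act_fiberMul_left (h : H) (x : fiber R X) :
    ρ.act _ h (fiberMul k _ X (unitElem R C ⊗ₜ x)) = fiberMul k _ X (unitElem R C ⊗ₜ ρ.act X h x) := by
  rw [fiberMul_unitElem_left, ρ.act_fiberMap, fiberMul_unitElem_left]

lemma act_fiberMul_right (h : H) (x : fiber R X) :
    ρ.act _ h (fiberMul k X _ (x ⊗ₜ unitElem R C)) = fiberMul k X _ (ρ.act X h x ⊗ₜ unitElem R C) := by
  rw [fiberMul_unitElem_right, ρ.act_fiberMap, fiberMul_unitElem_right]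

end Unit

section Comul

variable [IsSemisimpleRing R] (S : SeparabilityIdempotent k R)

/-- The comultiplication attached to `S`, acting on `F(X) ⊗ F(Y)` through `F(X ⊗ Y)`. -/
def IsComul (Δ : H →ₗ[k] H ⊗[k] H) : Prop :=
  ∀ (h : H) (X Y : C) (x : fiber R X) (y : fiber R Y),
    TensorProduct.map (ρ.ev X x) (ρ.ev Y y) (Δ h) =
      fiberSec S X Y (ρ.act (X ⊗ Y) h (fiberMul k X Y (x ⊗ₜ y)))

/-- `exists_tensor_of_natural` is used once in each variable: for fixed `y`, naturality in `X` gives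
an element of `H ⊗ F(Y)`; naturality of that element in `Y` gives one of `H ⊗ H`. This requires
`F(Y)` and `H` to be finite dimensional. -/
lemma exists_comul_apply [FiniteDimensional k R] [FiniteDimensional k H]
    (h : H) : ∃ t : H ⊗[k] H,
      ∀ (X Y : C) (x : fiber R X) (y : fiber R Y),
        TensorProduct.map (ρ.ev X x) (ρ.ev Y y) t =
          fiberSec S X Y (ρ.act (X ⊗ Y) h (fiberMul k X Y (x ⊗ₜ y))) := by
  have h1 (Y : C) (y : fiber R Y) : ∃ t : H ⊗[k] fiber R Y,
      ∀ (X : C) (x : fiber R X), (ρ.ev X x).rTensor _ t =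
        fiberSec S X Y (ρ.act (X ⊗ Y) h (fiberMul k X Y (x ⊗ₜ y))) := by
    have := finiteDimensional_fgModule (k := k) (fiber R Y)
    refine ρ.exists_tensor_of_natural (fun X => fiberSec S X Y ∘ₗ ρ.act (X ⊗ Y) h ∘ₗ fiberMul k X Y ∘ₗ
      (TensorProduct.mk k _ _).flip y) fun X X' f x => ?_
    simp only [LinearMap.comp_apply, LinearMap.flip_apply, TensorProduct.mk_apply,
      ← fiberMap_whiskerRight_fiberMul, ρ.act_fiberMap, fiberSec_whiskerRight]
  choose t ht using h1
  -- The factors are swapped so that the second application, with `Q = H`, has the same shape as the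
  -- first. Linearity in `y` follows from uniqueness.
  let θ (Y : C) : fiber R Y →ₗ[k] fiber R Y ⊗[k] H :=
    (TensorProduct.comm k _ _).toLinearMap ∘ₗ
      { toFun := t Y
        map_add' := fun y y' => ρ.tensor_ext fun X x => by
          simp only [map_add, ht, TensorProduct.tmul_add]
        map_smul' := fun c y => ρ.tensor_ext fun X x => by
          simp only [map_smul, ht, TensorProduct.tmul_smul, RingHom.id_apply] }
  obtain ⟨s, hs⟩ := ρ.exists_tensor_of_natural θ (fun Y Y' f y => by
    have h2 : t Y' (fiberMap k f y) = (fiberMap k f).lTensor _ (t Y y) :=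
      ρ.tensor_ext fun X x => by
        rw [ht, ← fiberMap_whiskerLeft_fiberMul, ρ.act_fiberMap, fiberSec_whiskerLeft, ← ht,
          ← LinearMap.comp_apply, ← LinearMap.comp_apply, LinearMap.rTensor_comp_lTensor,
          LinearMap.lTensor_comp_rTensor]
    change TensorProduct.comm k _ _ (t Y' (fiberMap k f y)) = (fiberMap k f).rTensor _
      (TensorProduct.comm k _ _ (t Y y))
    rw [h2, comm_lTensor])
  refine ⟨TensorProduct.comm k _ _ s, fun X Y x y => ?_⟩
  have h3 : t Y y = TensorProduct.comm k _ _ ((ρ.ev Y y).rTensor _ s) := by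
    rw [hs]
    exact ((TensorProduct.comm k _ _).symm_apply_apply (t Y y)).symm
  rw [← ht, h3, rTensor_comm_rTensor]

lemma exists_isComul [FiniteDimensional k R] [FiniteDimensional k H] :
    ∃ Δ : H →ₗ[k] H ⊗[k] H, ρ.IsComul S Δ := by
  choose t ht using ρ.exists_comul_apply S
  exact ⟨{ toFun := t
           map_add' := fun h g => ρ.tensorTwo_ext fun X Y x y => by
            rw [map_add, ht, ht, ht, ← map_add, map_add (ρ.act _), LinearMap.add_apply]
           map_smul' := fun c h => ρ.tensorTwo_ext fun X Y x y => by
            rw [RingHom.id_apply, map_smul, ht, ht, ← map_smul, map_smul (ρ.act _), LinearMap.smul_apply] }, ht⟩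

/-- The counit `h ↦ φ(h_𝟙(1))`. -/
def fiberCounit : H →ₗ[k] k :=
  S.form ∘ₗ unitVal k C ∘ₗ ρ.ev (𝟙_ C) (unitElem R C)

lemma fiberCounit_apply (h : H) :
    ρ.fiberCounit S h = S.form (unitVal k C (ρ.act _ h (unitElem R C))) := rfl

end Comul

end FiberRep

end Reconstruction

end

/-! ### Coassociativity, multiplicativity and the counit -/

noncomputable section

open MonoidalLeftAction

namespace Reconstruction

section TensorMaps

variable {k : Type*} [Field k] {A B D M N P Q : Type*} [AddCommGroup A] [Module k A]
  [AddCommGroup B] [Module k B] [AddCommGroup D] [Module k D] [AddCommGroup M] [Module k M]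
  [AddCommGroup N] [Module k N] [AddCommGroup P] [Module k P] [AddCommGroup Q] [Module k Q]

lemma map_map_assoc (f : A →ₗ[k] M) (g : B →ₗ[k] N) (h : D →ₗ[k] P) (t : (A ⊗[k] B) ⊗[k] D) :
    TensorProduct.map f (TensorProduct.map g h) (TensorProduct.assoc k A B D t) =
      TensorProduct.assoc k M N P (TensorProduct.map (TensorProduct.map f g) h t) :=
  LinearMap.congr_fun (f := TensorProduct.map f (TensorProduct.map g h) ∘ₗ
    (TensorProduct.assoc k A B D).toLinearMap) (g := (TensorProduct.assoc k M N P).toLinearMap ∘ₗ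
      TensorProduct.map (TensorProduct.map f g) h) (TensorProduct.ext_threefold fun _ _ _ => rfl) t

lemma map_rTensor_of_comp {f : B →ₗ[k] M} {δ : A →ₗ[k] B} {q : A →ₗ[k] Q} {s : Q →ₗ[k] M}
    (h : ∀ a, f (δ a) = s (q a)) (g : D →ₗ[k] N) (t : A ⊗[k] D) :
    TensorProduct.map f g (δ.rTensor D t) = s.rTensor N (TensorProduct.map q g t) := by
  have h2 : f ∘ₗ δ = s ∘ₗ q := LinearMap.ext h
  rw [← LinearMap.comp_apply, ← LinearMap.comp_apply, LinearMap.map_comp_rTensor,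
    LinearMap.rTensor_comp_map, h2]

lemma map_lTensor_of_comp {f : B →ₗ[k] M} {δ : A →ₗ[k] B} {q : A →ₗ[k] Q} {s : Q →ₗ[k] M}
    (h : ∀ a, f (δ a) = s (q a)) (g : D →ₗ[k] N) (t : D ⊗[k] A) :
    TensorProduct.map g f (δ.lTensor D t) = s.lTensor N (TensorProduct.map g q t) := by
  have h2 : f ∘ₗ δ = s ∘ₗ q := LinearMap.ext h
  rw [← LinearMap.comp_apply, ← LinearMap.comp_apply, LinearMap.map_comp_lTensor,
    LinearMap.lTensor_comp_map, h2]

lemma apply_lid_rTensor {ε : A →ₗ[k] k} {η : Q →ₗ[k] k} {q : A →ₗ[k] Q} (h : ∀ a, ε a = η (q a))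
    (f : B →ₗ[k] M) (t : A ⊗[k] B) : f (TensorProduct.lid k B (ε.rTensor B t)) =
      TensorProduct.lid k M (η.rTensor M (TensorProduct.map q f t)) := by
  induction t with
  | zero => simp
  | add a b ha hb => simp only [map_add, ha, hb]
  | tmul a b => simp [h]

lemma apply_rid_lTensor {ε : A →ₗ[k] k} {η : Q →ₗ[k] k} {q : A →ₗ[k] Q} (h : ∀ a, ε a = η (q a))
    (f : B →ₗ[k] M) (t : B ⊗[k] A) : f (TensorProduct.rid k B (ε.lTensor B t)) =
      TensorProduct.rid k M (η.lTensor M (TensorProduct.map f q t)) := by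
  induction t with
  | zero => simp
  | add a b ha hb => simp only [map_add, ha, hb]
  | tmul a b => simp [h]

lemma mul'_map_of_comp {α β : A →ₗ[k] k} {f : A →ₗ[k] M} {g : A →ₗ[k] N} {η : M →ₗ[k] k}
    {θ : N →ₗ[k] k} (hα : ∀ a, α a = η (f a)) (hβ : ∀ a, β a = θ (g a)) (t : A ⊗[k] A) :
    LinearMap.mul' k k (TensorProduct.map α β t) =
      LinearMap.mul' k k (TensorProduct.map η θ (TensorProduct.map f g t)) := by
  have h1 : α = η ∘ₗ f := LinearMap.ext hα
  have h2 : β = θ ∘ₗ g := LinearMap.ext hβ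
  rw [h1, h2, TensorProduct.map_comp, LinearMap.comp_apply]

lemma tensorAct_one_tmul_assoc_symm {A B D M N P : Type*} [Ring A] [Algebra k A] [Ring B]
    [Algebra k B] [Ring D] [Algebra k D] [AddCommGroup M] [Module k M] [AddCommGroup N]
    [Module k N] [AddCommGroup P] [Module k P] (ρ : A →ₗ[k] Module.End k M)
    (σ : B →ₗ[k] Module.End k N) (τ : D →ₗ[k] Module.End k P) (a : A) (t : B ⊗[k] D)
    (m : M) (z : N ⊗[k] P) :
    tensorAct (tensorAct ρ σ) τ ((TensorProduct.assoc k A B D).symm (a ⊗ₜ t))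
      ((TensorProduct.assoc k M N P).symm (m ⊗ₜ z)) =
      (TensorProduct.assoc k M N P).symm (ρ a m ⊗ₜ tensorAct σ τ t z) := by
  induction t with
  | zero => simp
  | add a b ha hb =>
    simp only [TensorProduct.tmul_add, map_add, LinearMap.add_apply, ha, hb]
  | tmul b d =>
    induction z with
    | zero => simp
    | add a b ha hb =>
      simp only [TensorProduct.tmul_add, map_add, ha, hb]
    | tmul n p => simp [tensorAct_tmul]

end TensorMaps

variable {k : Type u} [Field k] {R : Type w} [Ring R] [Algebra k R]
variable {C : Type u₁} [Category.{v₁} C] [Preadditive C] [Linear k C] [MonoidalCategory C]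
  [MonoidalLeftAction C (FGModuleCat.{w} R)] [BilinearAction k C (FGModuleCat.{w} R)]
variable [IsSemisimpleRing R] (S : SeparabilityIdempotent k R)

lemma fiberSec_smul {X Y : C} (r : R) (z : fiber R (X ⊗ Y)) :
    fiberSec S X Y (r • z) = (lmulHom k _ r).rTensor _ (fiberSec S X Y z) := by
  rw [fiberSec, LinearMap.comp_apply, linMap_smul, pairingSec_smul, LinearMap.comp_apply]

lemma rTensor_fiberSec_fiberSec {X Y Z : C} (x : fiber R X) (y : fiber R Y) (z : fiber R Z) :
    (fiberSec S X Y).rTensor _ (fiberSec S (X ⊗ Y) Z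
      (fiberMul k (X ⊗ Y) Z (fiberMul k X Y (x ⊗ₜ y) ⊗ₜ z))) =
      ∑ p ∈ S.support, ∑ q ∈ S.support,
        (rightMul k X x q.1 ⊗ₜ (q.2 • rightMul k Y y p.1)) ⊗ₜ (p.2 • z) := by
  simp only [fiberSec_fiberMul_tmul, map_sum, LinearMap.rTensor_tmul, rightMul_fiberMul,
    TensorProduct.sum_tmul]

lemma lTensor_fiberSec_fiberSec {X Y Z : C} (x : fiber R X) (y : fiber R Y) (z : fiber R Z) :
    (fiberSec S Y Z).lTensor _ (fiberSec S X (Y ⊗ Z)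
      (fiberMul k X (Y ⊗ Z) (x ⊗ₜ fiberMul k Y Z (y ⊗ₜ z)))) =
      ∑ p ∈ S.support, ∑ q ∈ S.support,
        rightMul k X x q.1 ⊗ₜ ((q.2 • rightMul k Y y p.1) ⊗ₜ (p.2 • z)) := by
  simp only [fiberSec_fiberMul_tmul, map_sum, LinearMap.lTensor_tmul, fiberSec_smul,
    TensorProduct.tmul_sum, LinearMap.rTensor_tmul, lmulHom_apply]
  exact Finset.sum_comm

/-- Either embedding of the triple product inserts `e` between `x` and `y` and between `y` and `z`.
The two insertions act on `y` from opposite sides, so their order is irrelevant. -/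
lemma assoc_fiberSec {X Y Z : C} (w : fiber R ((X ⊗ Y) ⊗ Z)) :
    TensorProduct.assoc k _ _ _ ((fiberSec S X Y).rTensor _ (fiberSec S (X ⊗ Y) Z w)) =
      (fiberSec S Y Z).lTensor _ (fiberSec S X (Y ⊗ Z) (fiberMap k (α_ X Y Z).hom w)) := by
  obtain ⟨t, rfl⟩ := fiberMul_surjective S (X ⊗ Y) Z w
  induction t with
  | zero => simp only [map_zero]
  | add a b ha hb => simp only [map_add, ha, hb]
  | tmul a z =>
    obtain ⟨s, rfl⟩ := fiberMul_surjective S X Y a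
    induction s with
    | zero => simp only [map_zero, TensorProduct.zero_tmul]
    | add a b ha hb => simp only [map_add, TensorProduct.add_tmul, ha, hb]
    | tmul x y =>
      rw [fiberMap_associator, rTensor_fiberSec_fiberSec, lTensor_fiberSec_fiberSec]
      simp only [map_sum, TensorProduct.assoc_tmul]

namespace FiberRep

variable {H : Type v} [Ring H] [Algebra k H] {ρ : FiberRep k R C H}

section IsComul

variable {S} {Δ : H →ₗ[k] H ⊗[k] H}
  (hΔ : ρ.IsComul S Δ)

include hΔ

lemma IsComul.actTwo_apply (h : H) (X Y : C) (t : fiber R X ⊗[k] fiber R Y) :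
    ρ.actTwo X Y (Δ h) t = fiberSec S X Y (ρ.act (X ⊗ Y) h (fiberMul k X Y t)) := by
  induction t with
  | zero => simp only [map_zero]
  | add a b ha hb => simp only [map_add, ha, hb]
  | tmul x y => rw [actTwo_tmul, hΔ]

lemma IsComul.actTwo_one (X Y : C) (x : fiber R X) (y : fiber R Y) :
    ρ.actTwo X Y (Δ 1) (x ⊗ₜ y) = ∑ p ∈ S.support, rightMul k X x p.1 ⊗ₜ (p.2 • y) := by
  rw [hΔ.actTwo_apply, ρ.act_one]
  exact fiberSec_fiberMul_tmul S x y

lemma IsComul.map_map_rTensor (X Y Z : C) (x : fiber R X) (y : fiber R Y) (z : fiber R Z)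
    (t : H ⊗[k] H) :
    TensorProduct.map (TensorProduct.map (ρ.ev X x) (ρ.ev Y y)) (ρ.ev Z z)
      (Δ.rTensor _ t) = (fiberSec S X Y).rTensor _
        (TensorProduct.map (ρ.ev (X ⊗ Y) (fiberMul k X Y (x ⊗ₜ y))) (ρ.ev Z z) t) :=
  map_rTensor_of_comp (fun h => hΔ h X Y x y) _ t

/-- Evaluated at `x`, `y`, `z`, both sides are embeddings of `h (x y z)`. They agree by
`assoc_fiberSec` and the naturality of `h` along the associator. -/
lemma IsComul.coassoc : (TensorProduct.assoc k _ _ _).toLinearMap ∘ₗ Δ.rTensor _ ∘ₗ Δ = Δ.lTensor _ ∘ₗ Δ := by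
  ext1 h
  refine (ρ.jointlyInjective_ev.map
    (ρ.jointlyInjective_ev.map ρ.jointlyInjective_ev)).ext ?_
  rintro ⟨⟨X, x⟩, ⟨Y, y⟩, ⟨Z, z⟩⟩
  have h1 : TensorProduct.map (ρ.ev X x) (TensorProduct.map (ρ.ev Y y) (ρ.ev Z z))
      (Δ.lTensor _ (Δ h)) = (fiberSec S Y Z).lTensor _ (TensorProduct.map (ρ.ev X x)
        (ρ.ev (Y ⊗ Z) (fiberMul k Y Z (y ⊗ₜ z))) (Δ h)) :=
    map_lTensor_of_comp (fun g => hΔ g Y Z y z) _ (Δ h)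
  have h2 := map_map_assoc (ρ.ev X x) (ρ.ev Y y) (ρ.ev Z z) (Δ.rTensor _ (Δ h))
  rw [hΔ.map_map_rTensor, hΔ, assoc_fiberSec, ← ρ.act_fiberMap, fiberMap_associator] at h2
  rw [hΔ] at h1
  exact h2.trans h1.symm

/-- Between the two actions the embedding is followed by the projection, and these cancel. -/
lemma IsComul.mul (g h : H) : Δ (g * h) = Δ g * Δ h := by
  refine ρ.tensorTwo_ext fun X Y x y => ?_
  rw [← actTwo_tmul, ← actTwo_tmul, actTwo_mul, LinearMap.comp_apply, hΔ.actTwo_apply,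
    hΔ.actTwo_apply, hΔ.actTwo_apply, fiberMul_fiberSec, ρ.act_mul]

/-- Evaluate `Δ(h)` at `1 ⊗ x` with `1 ∈ F(𝟙)`: the result is `∑ a ⊗ b (h x)`, and `φ` applied to
the first leg leaves `h x`. The right counit law is the mirror image. -/
lemma IsComul.lid_counit (h : H) :
    TensorProduct.lid k _ ((ρ.fiberCounit S).rTensor _ (Δ h)) = h := by
  refine ρ.jointlyInjective_ev.ext ?_
  rintro ⟨X, x⟩
  refine (apply_lid_rTensor (η := S.form ∘ₗ unitVal k C)
    (q := ρ.ev (𝟙_ C) (unitElem R C)) (fun _ => rfl) (ρ.ev X x) (Δ h)).trans ?_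
  rw [hΔ, ρ.act_fiberMul_left, fiberSec_fiberMul_tmul]
  simp only [map_sum, LinearMap.rTensor_tmul, TensorProduct.lid_tmul, LinearMap.comp_apply,
    unitVal_rightMul, unitVal_unitElem]
  simp only [← smul_assoc]
  rw [← Finset.sum_smul, S.sum_form_mul, one_smul, ev_apply]

lemma IsComul.rid_counit (h : H) :
    TensorProduct.rid k _ ((ρ.fiberCounit S).lTensor _ (Δ h)) = h := by
  refine ρ.jointlyInjective_ev.ext ?_
  rintro ⟨X, x⟩
  refine (apply_rid_lTensor (η := S.form ∘ₗ unitVal k C)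
    (q := ρ.ev (𝟙_ C) (unitElem R C)) (fun _ => rfl) (ρ.ev X x) (Δ h)).trans ?_
  rw [hΔ, ρ.act_fiberMul_right, fiberSec_fiberMul_tmul]
  simp only [map_sum, LinearMap.lTensor_tmul, TensorProduct.rid_tmul, LinearMap.comp_apply,
    unitVal_smul, unitVal_unitElem]
  simp only [← map_smul]
  rw [← map_sum, S.sum_form_mul_right, rightMul_one, ev_apply]

/-- Evaluate `Δ(g)` at `1 ⊗ h(1)` and put `y = g(h(1))`: the sum is `∑ φ(f(a)) φ(b y)`. By linearity
the scalar `φ(b y)` enters the argument of `f`, and `∑ φ(b y) a = y`. -/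
lemma IsComul.counit_mul_left (f g h : H) : ρ.fiberCounit S (f * g * h) =
    LinearMap.mul' k k (TensorProduct.map (ρ.fiberCounit S ∘ₗ LinearMap.mulLeft k f)
      (ρ.fiberCounit S ∘ₗ LinearMap.mulRight k h) (Δ g)) := by
  rw [mul'_map_of_comp (η := S.form ∘ₗ unitVal k C ∘ₗ ρ.act _ f) (θ := S.form ∘ₗ unitVal k C)
    (f := ρ.ev (𝟙_ C) (unitElem R C)) (g := ρ.ev (𝟙_ C) (ρ.act _ h (unitElem R C)))
    (fun a => congrArg (fun z => S.form (unitVal k C z)) (ρ.act_mul _ f a _))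
    (fun a => congrArg (fun z => S.form (unitVal k C z)) (ρ.act_mul _ a h _)),
    hΔ, ρ.act_fiberMul_left, fiberSec_fiberMul_tmul]
  simp only [map_sum, TensorProduct.map_tmul, LinearMap.mul'_apply, LinearMap.comp_apply,
    unitVal_smul]
  set y : fiber R (𝟙_ C) := ρ.act _ g (ρ.act _ h (unitElem R C)) with hy
  -- The second factor is a scalar, so it can be moved inside the linear map applied to the first
  -- leg.
  have e : ∀ p : R × R, S.form (unitVal k C (ρ.act _ f (rightMul k _ (unitElem R C) p.1))) *
      S.form (p.2 * unitVal k C y) = S.form (unitVal k C (ρ.act _ f (rightMul k _ (unitElem R C)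
        (S.form (p.2 * unitVal k C y) • p.1)))) := fun p => by
    rw [map_smul, map_smul, map_smul, map_smul, smul_eq_mul, mul_comm]
  simp only [e]
  rw [← map_sum, ← map_sum, ← map_sum, ← map_sum, S.sum_form_mul_right, rightMul_unitElem,
    unitVal_smul_unitElem, hy,
    fiberCounit_apply, ρ.act_mul, ρ.act_mul]

/-- Here `Δ(g)` is evaluated at `h(1) ⊗ 1`, and the dual expansion `∑ φ(y a) b = y` is used. -/
lemma IsComul.counit_mul_right (f g h : H) : ρ.fiberCounit S (f * g * h) =
    LinearMap.mul' k k (TensorProduct.map (ρ.fiberCounit S ∘ₗ LinearMap.mulRight k h)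
      (ρ.fiberCounit S ∘ₗ LinearMap.mulLeft k f) (Δ g)) := by
  rw [mul'_map_of_comp (η := S.form ∘ₗ unitVal k C) (θ := S.form ∘ₗ unitVal k C ∘ₗ ρ.act _ f)
    (f := ρ.ev (𝟙_ C) (ρ.act _ h (unitElem R C))) (g := ρ.ev (𝟙_ C) (unitElem R C))
    (fun a => congrArg (fun z => S.form (unitVal k C z)) (ρ.act_mul _ a h _))
    (fun a => congrArg (fun z => S.form (unitVal k C z)) (ρ.act_mul _ f a _)),
    hΔ, ρ.act_fiberMul_right, fiberSec_fiberMul_tmul]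
  simp only [map_sum, TensorProduct.map_tmul, LinearMap.mul'_apply, LinearMap.comp_apply,
    unitVal_rightMul]
  set y : fiber R (𝟙_ C) := ρ.act _ g (ρ.act _ h (unitElem R C)) with hy
  have e : ∀ p : R × R, S.form (unitVal k C y * p.1) *
      S.form (unitVal k C (ρ.act _ f (p.2 • unitElem R C))) = S.form (unitVal k C (ρ.act _ f
        ((S.form (unitVal k C y * p.1) • p.2) • unitElem R C))) := fun p => by
    rw [smul_assoc (S.form (unitVal k C y * p.1)) p.2 (unitElem R C)]
    exact ((S.form ∘ₗ unitVal k C ∘ₗ ρ.act _ f).map_smul _ _).symm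
  simp only [e]
  rw [← map_sum, ← map_sum, ← map_sum, ← Finset.sum_smul, S.sum_form_mul, unitVal_smul_unitElem, hy,
    fiberCounit_apply, ρ.act_mul, ρ.act_mul]

/-- The action of `H ⊗ H ⊗ H` on `F(X) ⊗ F(Y) ⊗ F(Z)`. -/
lemma IsComul.actThree_comul_one {X Y Z : C} (x : fiber R X) (y : fiber R Y) (z : fiber R Z) :
    tensorAct (ρ.actTwo X Y) (ρ.act Z) (Δ.rTensor _ (Δ 1)) ((x ⊗ₜ y) ⊗ₜ z) =
      ∑ p ∈ S.support, ∑ q ∈ S.support,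
        (rightMul k X x q.1 ⊗ₜ (q.2 • rightMul k Y y p.1)) ⊗ₜ (p.2 • z) := by
  rw [← rTensor_fiberSec_fiberSec, tensorAct_apply_tmul]
  have h1 : LinearMap.applyₗ (x ⊗ₜ[k] y) ∘ₗ ρ.actTwo X Y =
      TensorProduct.map (ρ.ev X x) (ρ.ev Y y) :=
    LinearMap.ext fun t => ρ.actTwo_tmul X Y t x y
  rw [h1]
  refine (hΔ.map_map_rTensor X Y Z x y z (Δ 1)).trans ?_
  rw [hΔ, ρ.act_one]

end IsComul

end FiberRep

end Reconstruction

end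

/-! ### The axioms for `Δ(1)` and the weak bialgebra `H` -/

noncomputable section

open MonoidalLeftAction

namespace Reconstruction

variable {k : Type u} [Field k] {R : Type w} [Ring R] [Algebra k R]
variable {C : Type u₁} [Category.{v₁} C] [Preadditive C] [Linear k C] [MonoidalCategory C]
  [MonoidalLeftAction C (FGModuleCat.{w} R)] [BilinearAction k C (FGModuleCat.{w} R)]
variable [IsSemisimpleRing R] {S : SeparabilityIdempotent k R}

namespace FiberRep

variable {H : Type v} [Ring H] [Algebra k H] {ρ : FiberRep k R C H}

variable (ρ) in
lemma tensorThree_ext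
    {s t : (H ⊗[k] H) ⊗[k] H}
    (h : ∀ (X Y Z : C) (x : fiber R X) (y : fiber R Y) (z : fiber R Z),
      tensorAct (ρ.actTwo X Y) (ρ.act Z) s ((x ⊗ₜ y) ⊗ₜ z) =
        tensorAct (ρ.actTwo X Y) (ρ.act Z) t ((x ⊗ₜ y) ⊗ₜ z)) : s = t := by
  refine ((ρ.jointlyInjective_ev.map ρ.jointlyInjective_ev).map
    ρ.jointlyInjective_ev).ext ?_
  rintro ⟨⟨⟨X, x⟩, ⟨Y, y⟩⟩, ⟨Z, z⟩⟩
  have h1 : LinearMap.applyₗ (x ⊗ₜ[k] y) ∘ₗ ρ.actTwo X Y =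
      TensorProduct.map (ρ.ev X x) (ρ.ev Y y) :=
    LinearMap.ext fun t => ρ.actTwo_tmul X Y t x y
  have h2 := h X Y Z x y z
  rw [tensorAct_apply_tmul, tensorAct_apply_tmul, h1] at h2
  exact h2

variable (ρ) in
lemma tensorAct_actTwo_mul (X Y Z : C)
    (s t : (H ⊗[k] H) ⊗[k] H) :
    tensorAct (ρ.actTwo X Y) (ρ.act Z) (s * t) =
      tensorAct (ρ.actTwo X Y) (ρ.act Z) s ∘ₗ
        tensorAct (ρ.actTwo X Y) (ρ.act Z) t :=
  tensorAct_mul (ρ.actTwo_mul X Y) (fun a b => LinearMap.ext (ρ.act_mul Z a b)) s t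

section IsComul

variable {Δ : H →ₗ[k] H ⊗[k] H}
  (hΔ : ρ.IsComul S Δ)

include hΔ

lemma IsComul.actThree_tmul_one {X Y Z : C} (x : fiber R X) (y : fiber R Y) (z : fiber R Z) :
    tensorAct (ρ.actTwo X Y) (ρ.act Z) (Δ 1 ⊗ₜ 1) ((x ⊗ₜ y) ⊗ₜ z) =
      ∑ q ∈ S.support, (rightMul k X x q.1 ⊗ₜ (q.2 • y)) ⊗ₜ z := by
  rw [tensorAct_tmul, TensorProduct.map_tmul, hΔ.actTwo_one, TensorProduct.sum_tmul, ρ.act_one]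

lemma IsComul.actThree_one_tmul {X Y Z : C} (x : fiber R X) (y : fiber R Y) (z : fiber R Z) :
    tensorAct (ρ.actTwo X Y) (ρ.act Z)
      ((TensorProduct.assoc k _ _ _).symm (1 ⊗ₜ Δ 1)) ((x ⊗ₜ y) ⊗ₜ z) =
      ∑ p ∈ S.support, (x ⊗ₜ rightMul k Y y p.1) ⊗ₜ (p.2 • z) := by
  refine (tensorAct_one_tmul_assoc_symm (ρ.act X) (ρ.act Y) (ρ.act Z) 1 (Δ 1)
    x (y ⊗ₜ z)).trans ?_
  have h := hΔ.actTwo_one Y Z y z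
  rw [ρ.act_one]
  change (TensorProduct.assoc k _ _ _).symm (x ⊗ₜ ρ.actTwo Y Z (Δ 1) (y ⊗ₜ z)) = _
  rw [h]
  simp only [TensorProduct.tmul_sum, map_sum, TensorProduct.assoc_symm_tmul]

/-- On triple tensors `1 ⊗ Δ(1)` inserts `e` in the second gap and `Δ(1) ⊗ 1` in the first.
Performed in this order they give directly the double insertion of `actThree_comul_one`. -/
lemma IsComul.comul_one_left : Δ.rTensor _ (Δ 1) =
    (Δ 1 ⊗ₜ[k] 1) * (TensorProduct.assoc k _ _ _).symm (1 ⊗ₜ[k] Δ 1) := by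
  refine ρ.tensorThree_ext fun X Y Z x y z => ?_
  rw [ρ.tensorAct_actTwo_mul, LinearMap.comp_apply, hΔ.actThree_one_tmul,
    hΔ.actThree_comul_one, map_sum]
  exact Finset.sum_congr rfl fun p _ => (hΔ.actThree_tmul_one _ _ _).symm

/-- In the opposite order the middle factor appears as `(b y) a'` instead of `b (y a')`; that these
agree is the bimodule law `rightMul_smul`. -/
lemma IsComul.comul_one_right : Δ.rTensor _ (Δ 1) =
    (TensorProduct.assoc k _ _ _).symm (1 ⊗ₜ[k] Δ 1) * (Δ 1 ⊗ₜ[k] 1) := by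
  refine ρ.tensorThree_ext fun X Y Z x y z => ?_
  rw [ρ.tensorAct_actTwo_mul, LinearMap.comp_apply, hΔ.actThree_tmul_one,
    hΔ.actThree_comul_one, map_sum, Finset.sum_comm]
  refine Finset.sum_congr rfl fun p _ => ?_
  rw [hΔ.actThree_one_tmul]
  simp only [rightMul_smul]

/-- The weak bialgebra structure on the endomorphisms of the fiber functor. -/
abbrev IsComul.weakBialgebra [FiniteDimensional k H] :
    WeakBialgebra k H where
  comul := Δ
  counit := ρ.fiberCounit S
  coassoc := hΔ.coassoc
  rTensor_counit_comp_comul := LinearMap.ext fun h =>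
    (TensorProduct.lid k _).injective <| (hΔ.lid_counit h).trans <| by
      rw [TensorProduct.mk_apply, TensorProduct.lid_tmul, one_smul]
  lTensor_counit_comp_comul := LinearMap.ext fun h =>
    (TensorProduct.rid k _).injective <| (hΔ.rid_counit h).trans <| by
      rw [LinearMap.flip_apply, TensorProduct.mk_apply, TensorProduct.rid_tmul, one_smul]
  finiteDimensional := inferInstance
  comul_mul := hΔ.mul
  comul_one_left := hΔ.comul_one_left
  comul_one_right := hΔ.comul_one_right
  counit_mul_left := hΔ.counit_mul_left
  counit_mul_right := hΔ.counit_mul_right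

end IsComul

end FiberRep

lemma map_idem_eq_sum {P Q : Type*} [AddCommGroup P] [Module k P] [AddCommGroup Q] [Module k Q]
    (f : R →ₗ[k] P) (g : R →ₗ[k] Q) :
    TensorProduct.map f g S.idem = ∑ p ∈ S.support, f p.1 ⊗ₜ g p.2 := by
  rw [S.idem_eq_sum, map_sum]
  simp only [TensorProduct.map_tmul]

/-- The identity of every `X` is a sum of maps factoring through `G`, so a natural endomorphism is
determined by its component at `G`, and `H` embeds into `End(F(G))`. -/
lemma finiteDimensional_naturalEnd [FiniteDimensional k R] (G : C)
    (hG : ∀ X : C, ∃ (n : ℕ) (p : Fin n → (X ⟶ G)) (q : Fin n → (G ⟶ X)),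
      ∑ j, p j ≫ q j = 𝟙 X) : FiniteDimensional k (naturalEnd k R C) := by
  have := finiteDimensional_fgModule (k := k) (fiber R G)
  refine FiniteDimensional.of_injective (evalAt k R C G) ?_
  rw [← LinearMap.ker_eq_bot, LinearMap.ker_eq_bot']
  intro h hh
  apply Subtype.ext
  funext X
  ext x
  obtain ⟨n, p, q, hpq⟩ := hG X
  have hsum : ∀ (s : Finset (Fin n)) (g : Fin n → (X ⟶ X)) (z : fiber R X),
      fiberMap k (∑ j ∈ s, g j) z = ∑ j ∈ s, fiberMap k (g j) z := by
    intro s g z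
    induction s using Finset.induction_on with
    | empty =>
      -- Bilinearity of the action speaks of sums and scalar multiples only; the zero morphism is
      -- treated as `0 • 0`.
      have h0 : (0 : X ⟶ X) = (0 : k) • 0 := (zero_smul k _).symm
      rw [Finset.sum_empty, Finset.sum_empty, h0, fiberMap, BilinearAction.smul_actionHomLeft,
        zero_smul]
      rfl
    | insert a s ha ih =>
      rw [Finset.sum_insert ha, Finset.sum_insert ha, ← ih, fiberMap,
        BilinearAction.add_actionHomLeft k]
      rfl
  have hG0 : h.1 G = 0 := hh
  rw [← fiberMap_id_apply (k := k) (h.1 X x), ← hpq, hsum]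
  refine Finset.sum_eq_zero fun j _ => ?_
  rw [fiberMap_comp_apply, ← naturalEnd_fiberMap, hG0, LinearMap.zero_apply, map_zero]

variable (k R C) in
/-- The algebra of natural endomorphisms acts on the fiber functor. -/
def naturalRep : FiberRep k R C (naturalEnd k R C) where
  act := evalAt k R C
  act_mul _ _ _ _ := rfl
  act_one _ _ := rfl
  act_fiberMap f h x := naturalEnd_fiberMap h f x
  jointlyInjective := jointlyInjective_evalElem
  exists_act θ hθ := ⟨⟨θ, fun X Y f => LinearMap.ext (hθ X Y f)⟩, fun _ => rfl⟩
  left := leftEnd k C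
  right := rightEnd k C
  act_left _ _ _ := rfl
  act_right _ _ _ := rfl

variable (C S) in
lemma exists_weakBialgebra [FiniteDimensional k R] [FiniteDimensional k (naturalEnd k R C)] :
    ∃ _ : WeakBialgebra k (naturalEnd k R C), IsAttached (C := C) S := by
  obtain ⟨Δ, hΔ⟩ := (naturalRep k R C).exists_isComul S
  refine ⟨hΔ.weakBialgebra, ?_⟩
  let _ := hΔ.weakBialgebra
  refine ⟨fun h X Y => LinearMap.ext fun t => ?_, fun X Y x y => ?_, fun h => rfl⟩
  · exact (congrArg (fiberMul k X Y) (hΔ.actTwo_apply h X Y t)).trans (fiberMul_fiberSec S _)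
  · rw [map_idem_eq_sum]
    exact hΔ.actTwo_one X Y x y

/-- A weak bialgebra acting on the fiber functor by all of its natural endomorphisms, with
comultiplication and counit given by a separability idempotent. -/
structure FiberRep.IsReconstruction {H : Type v} [Ring H] [Algebra k H] [WeakBialgebra k H]
    (ρ : FiberRep k R C H) (S : SeparabilityIdempotent k R) : Prop where
  isComul : ρ.IsComul S (Coalgebra.comul (R := k) (A := H))
  counit_eq : ∀ h : H, Coalgebra.counit (R := k) h = ρ.fiberCounit S h

/-- The hypotheses give the action of `Δ(1)`, which is the embedding after the projection, and the
projection of the action of `Δ(h)`. As `Δ(h) = Δ(1) Δ(h)`, they determine `Δ(h)` itself. -/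
lemma IsAttached.isReconstruction [WeakBialgebra k (naturalEnd k R C)]
    (hS : IsAttached (C := C) S) : (naturalRep k R C).IsReconstruction S where
  counit_eq := hS.counit_eq
  isComul h X Y x y := by
    have h1 : ∀ t, (naturalRep k R C).actTwo X Y
        (Coalgebra.comul (R := k) (1 : naturalEnd k R C)) t =
        fiberSec S X Y (fiberMul k X Y t) := by
      intro t
      rw [fiberSec_fiberMul]
      refine LinearMap.congr_fun (TensorProduct.ext' fun x y => ?_) t
      rw [pairingSplit_tmul]
      exact (hS.comul_one X Y x y).trans (map_idem_eq_sum _ _)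
    have h2 : fiberMul k X Y ((naturalRep k R C).actTwo X Y (Coalgebra.comul (R := k) h)
        (x ⊗ₜ y)) = (naturalRep k R C).act (X ⊗ Y) h (fiberMul k X Y (x ⊗ₜ y)) :=
      LinearMap.congr_fun (hS.comul_mul h X Y) (x ⊗ₜ y)
    have h3 : Coalgebra.comul (R := k) h =
        Coalgebra.comul (R := k) (1 : naturalEnd k R C) * Coalgebra.comul (R := k) h :=
      (WeakBialgebra.comul_one_mul k h).symm
    rw [← FiberRep.actTwo_tmul, h3, FiberRep.actTwo_mul, LinearMap.comp_apply, h1, h2]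

end Reconstruction

end

/-! ### The base `H_t ≅ R` and the bimodule structure of comodules -/

noncomputable section

open MonoidalLeftAction WeakBialgebra

namespace Reconstruction

section TensorMaps

variable {k : Type*} [Field k] {H P : Type*} [Ring H] [Algebra k H] [AddCommGroup P] [Module k P]

lemma map_mulLeft_assoc (a b : H) (s : H ⊗[k] H) (p : P) :
    TensorProduct.map (LinearMap.mulLeft k a) ((LinearMap.mulLeft k b).rTensor P)
      (TensorProduct.assoc k H H P (s ⊗ₜ p)) =
      TensorProduct.assoc k H H P (((a ⊗ₜ b) * s) ⊗ₜ p) := by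
  induction s with
  | zero => simp
  | add a b ha hb => simp only [TensorProduct.add_tmul, mul_add, map_add, ha, hb]
  | tmul a b => simp

lemma map_mulRight_assoc (a b : H) (s : H ⊗[k] H) (p : P) :
    TensorProduct.map (LinearMap.mulRight k a) ((LinearMap.mulRight k b).rTensor P)
      (TensorProduct.assoc k H H P (s ⊗ₜ p)) =
      TensorProduct.assoc k H H P ((s * (a ⊗ₜ b)) ⊗ₜ p) := by
  induction s with
  | zero => simp
  | add a b ha hb => simp only [TensorProduct.add_tmul, add_mul, map_add, ha, hb]
  | tmul a b => simp

end TensorMaps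

variable {k : Type u} [Field k] {R : Type w} [Ring R] [Algebra k R]
variable {C : Type u₁} [Category.{v₁} C] [Preadditive C] [Linear k C] [MonoidalCategory C]
  [MonoidalLeftAction C (FGModuleCat.{w} R)] [BilinearAction k C (FGModuleCat.{w} R)]
variable {H : Type v} [Ring H] [Algebra k H]

namespace FiberRep

variable (ρ : FiberRep k R C H)

section Base

lemma ext {g h : H} (e : ∀ X x, ρ.act X g x = ρ.act X h x) : g = h :=
  ρ.jointlyInjective_ev.ext fun p => e p.1 p.2

lemma left_mul (r s : R) : ρ.left (r * s) = ρ.left r * ρ.left s :=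
  ρ.ext fun X x => by simp only [ρ.act_mul, ρ.act_left, mul_smul]

lemma left_one : ρ.left 1 = 1 := ρ.ext fun X x => by simp only [ρ.act_one, ρ.act_left, one_smul]

lemma right_mul (r s : R) : ρ.right (r * s) = ρ.right s * ρ.right r :=
  ρ.ext fun X x => by simp only [ρ.act_mul, ρ.act_right, rightMul_mul]

end Base

variable {ρ} [WeakBialgebra k H] [IsSemisimpleRing R] {S : SeparabilityIdempotent k R}

namespace IsReconstruction

variable (hρ : ρ.IsReconstruction S)

include hρ

/-- On `F(X) ⊗ F(Y)` the action of `Δ(1)` inserts `e`, that is, multiplies by `a` on the right of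
`x` and by `b` on the left of `y`. -/
lemma comul_one : Coalgebra.comul (R := k) (1 : H) =
    ∑ p ∈ S.support, ρ.right p.1 ⊗ₜ ρ.left p.2 :=
  ρ.tensorTwo_ext fun X Y x y => by
    rw [hρ.isComul, ρ.act_one, fiberSec_fiberMul_tmul, map_sum]
    simp only [TensorProduct.map_tmul, ev_apply, ρ.act_left, ρ.act_right]

lemma counit_apply (h : H) : Coalgebra.counit (R := k) h =
    S.form (unitVal k C (ρ.act _ h (unitElem R C))) := hρ.counit_eq h

/-- By the formula for `Δ(1)`, `ε_t(h) = ∑ φ(h(1) a) left(b)`, and the dual expansion of `h(1) ∈ R`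
collapses the sum. So `H_t` consists of the left multiplications. -/
lemma targetCounit_eq (h : H) :
    targetCounit k H h = ρ.left (unitVal k C (ρ.act _ h (unitElem R C))) := by
  rw [targetCounit_apply, hρ.comul_one, Finset.sum_mul, map_sum, map_sum]
  simp only [Algebra.TensorProduct.tmul_mul_tmul, mul_one, LinearMap.rTensor_tmul,
    TensorProduct.lid_tmul, hρ.counit_apply, ρ.act_mul, ρ.act_right, unitVal_rightMul]
  simp only [← map_smul]
  rw [← map_sum, S.sum_form_mul]

lemma targetCounit_left (r : R) : targetCounit k H (ρ.left r) = ρ.left r := by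
  rw [hρ.targetCounit_eq, ρ.act_left, unitVal_smul, unitVal_unitElem, mul_one]

/-- The isomorphism of `R` with the base of `H`, given by the left multiplications. -/
def base : R ≃ₗ[k] targetBase k H :=
  LinearEquiv.ofLinearMap
    (ρ.left.codRestrict (targetBase k H) fun r => ⟨ρ.left r, hρ.targetCounit_left r⟩)
    (unitVal k C ∘ₗ ρ.ev _ (unitElem R C) ∘ₗ (targetBase k H).subtype)
    (LinearMap.ext fun z => Subtype.ext <| by
      obtain ⟨_, h, rfl⟩ := z
      change ρ.left (unitVal k C (ρ.act _ (targetCounit k H h) (unitElem R C))) =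
        targetCounit k H h
      simp only [hρ.targetCounit_eq, ρ.act_left, unitVal_smul, unitVal_unitElem, mul_one])
    (LinearMap.ext fun r => by
      change unitVal k C (ρ.act _ (ρ.left r) (unitElem R C)) = r
      rw [ρ.act_left, unitVal_smul, unitVal_unitElem, mul_one])

@[simp] lemma coe_base (r : R) : (hρ.base r : H) = ρ.left r := rfl

section Comodule

variable {P : Type*} [AddCommGroup P] [Module k P] (δ : P →ₗ[k] H ⊗[k] P)

/-- The left action of `R` on a comodule, `r • v = ε(r v₋₁) v₀`. -/
def lact : R →ₗ[k] Module.End k P :=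
  (TensorProduct.mk k (targetBase k H) P).compr₂ (leftUnit δ) ∘ₗ hρ.base.toLinearMap

/-- The right action of `R` on a comodule, `v • r = ε(v₋₁ r) v₀`. -/
def ract : R →ₗ[k] Module.End k P :=
  ((TensorProduct.mk k P (targetBase k H)).compr₂ (rightUnit δ)).flip ∘ₗ hρ.base.toLinearMap

variable {δ} (hδ : IsCoassoc δ) (hc : counitPart δ = LinearMap.id)

include hc in
omit hρ in
-- The counit is a left inverse of `δ`. Identities in a comodule can hence be tested after `δ`,
-- where the two actions of `R` become left and right multiplication by `left r` in `H`.
lemma _root_.Reconstruction.coaction_injective : Function.Injective δ := fun v v' h => by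
  have h1 : ∀ v, TensorProduct.lid k P
      ((Coalgebra.counit (R := k) (A := H)).rTensor P (δ v)) = v := LinearMap.congr_fun hc
  rw [← h1 v, h, h1]

include hδ in
lemma coaction_lact (r : R) (v : P) :
    δ (hρ.lact δ r v) = (LinearMap.mulLeft k (ρ.left r)).rTensor P (δ v) :=
  coaction_leftUnit hδ (hρ.base r) v

include hδ in
lemma coaction_ract (r : R) (v : P) :
    δ (hρ.ract δ r v) = (LinearMap.mulRight k (ρ.left r)).rTensor P (δ v) :=
  coaction_rightUnit hδ (hρ.base r) v

include hδ hc

lemma lact_mul (r s : R) : hρ.lact δ (r * s) = hρ.lact δ r * hρ.lact δ s :=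
  LinearMap.ext fun v => coaction_injective hc <| by
    rw [Module.End.mul_apply, hρ.coaction_lact hδ, hρ.coaction_lact hδ, hρ.coaction_lact hδ,
      ρ.left_mul, LinearMap.mulLeft_mul, LinearMap.rTensor_comp, LinearMap.comp_apply]

lemma ract_mul (r s : R) : hρ.ract δ (r * s) = hρ.ract δ s * hρ.ract δ r :=
  LinearMap.ext fun v => coaction_injective hc <| by
    rw [Module.End.mul_apply, hρ.coaction_ract hδ, hρ.coaction_ract hδ, hρ.coaction_ract hδ,
      ρ.left_mul, LinearMap.mulRight_mul, LinearMap.rTensor_comp, LinearMap.comp_apply]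

lemma lact_one : hρ.lact δ 1 = 1 :=
  LinearMap.ext fun v => coaction_injective hc <| by
    rw [hρ.coaction_lact hδ, ρ.left_one, LinearMap.mulLeft_one, LinearMap.rTensor_id]
    rfl

lemma ract_one : hρ.ract δ 1 = 1 :=
  LinearMap.ext fun v => coaction_injective hc <| by
    rw [hρ.coaction_ract hδ, ρ.left_one, LinearMap.mulRight_one, LinearMap.rTensor_id]
    rfl

lemma lact_ract (r s : R) (v : P) :
    hρ.lact δ r (hρ.ract δ s v) = hρ.ract δ s (hρ.lact δ r v) :=
  coaction_injective hc <| by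
    rw [hρ.coaction_ract hδ, hρ.coaction_lact hδ, hρ.coaction_lact hδ, hρ.coaction_ract hδ,
      ← LinearMap.rTensor_comp_apply, ← LinearMap.rTensor_comp_apply]
    congr 2
    ext h
    simp [mul_assoc]

/-- Apply `δ` to the second leg: coassociativity turns the left side into `Δ(1) Δ(v₋₁) ⊗ v₀`, and
`Δ(1) Δ(h) = Δ(h)`. The meaning is that `δ(v)` is already fixed by the insertion of `e`. -/
lemma sum_map_lact (v : P) :
    ∑ p ∈ S.support, TensorProduct.map (LinearMap.mulLeft k (ρ.right p.1)) (hρ.lact δ p.2) (δ v) =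
      δ v := by
  have hinj : Function.Injective (δ.lTensor H) :=
    Module.Flat.lTensor_preserves_injective_linearMap _ (coaction_injective hc)
  refine hinj ?_
  have h1 : ∀ p : R × R, δ.lTensor H (TensorProduct.map (LinearMap.mulLeft k (ρ.right p.1))
      (hρ.lact δ p.2) (δ v)) = TensorProduct.map (LinearMap.mulLeft k (ρ.right p.1))
      ((LinearMap.mulLeft k (ρ.left p.2)).rTensor P) (δ.lTensor H (δ v)) := fun p =>
    (map_lTensor_of_comp (f := (LinearMap.mulLeft k (ρ.left p.2)).rTensor P) (δ := δ)
      (q := hρ.lact δ p.2) (s := δ) (fun v => (hρ.coaction_lact hδ p.2 v).symm) _ _).symm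
  have h3 : δ.lTensor H (δ v) = TensorProduct.assoc k H H P
      ((Coalgebra.comul (R := k) (A := H)).rTensor P (δ v)) := LinearMap.congr_fun hδ v
  rw [map_sum]
  simp only [h1]
  rw [h3]
  generalize δ v = t
  induction t with
  | zero => simp
  | add a b ha hb => simp only [map_add, Finset.sum_add_distrib, ha, hb]
  | tmul h p =>
    simp only [LinearMap.rTensor_tmul, map_mulLeft_assoc]
    rw [← map_sum, ← TensorProduct.sum_tmul, ← Finset.sum_mul, ← hρ.comul_one, comul_one_mul]

/-- Same computation with `Δ(h) Δ(1) = Δ(h)`. It is used to move right multiplications from `v₋₁` to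
`v₀`. -/
lemma sum_map_ract (v : P) :
    ∑ p ∈ S.support, TensorProduct.map (LinearMap.mulRight k (ρ.right p.1)) (hρ.ract δ p.2) (δ v) =
      δ v := by
  have hinj : Function.Injective (δ.lTensor H) :=
    Module.Flat.lTensor_preserves_injective_linearMap _ (coaction_injective hc)
  refine hinj ?_
  have h1 : ∀ p : R × R, δ.lTensor H (TensorProduct.map (LinearMap.mulRight k (ρ.right p.1))
      (hρ.ract δ p.2) (δ v)) = TensorProduct.map (LinearMap.mulRight k (ρ.right p.1))
      ((LinearMap.mulRight k (ρ.left p.2)).rTensor P) (δ.lTensor H (δ v)) := fun p =>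
    (map_lTensor_of_comp (f := (LinearMap.mulRight k (ρ.left p.2)).rTensor P) (δ := δ)
      (q := hρ.ract δ p.2) (s := δ) (fun v => (hρ.coaction_ract hδ p.2 v).symm) _ _).symm
  have h3 : δ.lTensor H (δ v) = TensorProduct.assoc k H H P
      ((Coalgebra.comul (R := k) (A := H)).rTensor P (δ v)) := LinearMap.congr_fun hδ v
  rw [map_sum]
  simp only [h1]
  rw [h3]
  generalize δ v = t
  induction t with
  | zero => simp
  | add a b ha hb => simp only [map_add, Finset.sum_add_distrib, ha, hb]
  | tmul h p =>
    simp only [LinearMap.rTensor_tmul, map_mulRight_assoc]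
    rw [← map_sum, ← TensorProduct.sum_tmul, ← Finset.mul_sum, ← hρ.comul_one, comul_mul_one]

/-- `v₋₁ r ⊗ v₀ = v₋₁ ⊗ v₀ r`. -/
lemma rTensor_right_coaction (r : R) (v : P) :
    (LinearMap.mulRight k (ρ.right r)).rTensor P (δ v) = (hρ.ract δ r).lTensor H (δ v) := by
  have h1 := hρ.sum_map_ract hδ hc v
  conv_lhs => rw [← h1]
  conv_rhs => rw [← h1]
  rw [map_sum, map_sum]
  -- After expanding `δ(v)` by `sum_map_ract`, both sides depend bilinearly on the legs of `e`, so
  -- the claim is the relation `r e = e r` pushed through `Φ`.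
  let Φ : R →ₗ[k] R →ₗ[k] H ⊗[k] P :=
    LinearMap.mk₂ k (fun a b => TensorProduct.map (LinearMap.mulRight k (ρ.right a))
      (hρ.ract δ b) (δ v))
      (fun a a' b => by
        have : LinearMap.mulRight k (ρ.right (a + a')) =
            LinearMap.mulRight k (ρ.right a) + LinearMap.mulRight k (ρ.right a') := by
          ext; simp [mul_add]
        rw [this, TensorProduct.map_add_left, LinearMap.add_apply])
      (fun c a b => by
        have : LinearMap.mulRight k (ρ.right (c • a)) =
            c • LinearMap.mulRight k (ρ.right a) := by
          ext; simp
        rw [this, TensorProduct.map_smul_left, LinearMap.smul_apply])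
      (fun a b b' => by
        rw [map_add, TensorProduct.map_add_right, LinearMap.add_apply])
      (fun c a b => by
        rw [map_smul, TensorProduct.map_smul_right, LinearMap.smul_apply])
  have h2 := congrArg (TensorProduct.lift Φ) (S.sum_mul_tmul LinearMap.id LinearMap.id r)
  simp only [map_sum, TensorProduct.lift.tmul, LinearMap.id_apply] at h2
  refine Eq.trans (Finset.sum_congr rfl fun p _ => ?_)
    (h2.trans (Finset.sum_congr rfl fun p _ => ?_))
  · change _ = TensorProduct.map (LinearMap.mulRight k (ρ.right (r * p.1))) (hρ.ract δ p.2) (δ v)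
    rw [ρ.right_mul, LinearMap.mulRight_mul, ← LinearMap.comp_apply, LinearMap.rTensor_comp_map]
  · change TensorProduct.map (LinearMap.mulRight k (ρ.right p.1)) (hρ.ract δ (p.2 * r)) (δ v) = _
    rw [hρ.ract_mul hδ hc]
    exact (LinearMap.congr_fun (LinearMap.lTensor_comp_map _ _ _ _) (δ v)).symm

end Comodule

end IsReconstruction

end FiberRep

end Reconstruction

end

/-! ### The coaction on `T(R)` attached to a module functor -/

noncomputable section

open MonoidalLeftAction WeakBialgebra

namespace Reconstruction

section TensorMaps

variable {k : Type*} [Field k] {A B P Q N : Type*} [AddCommGroup A] [Module k A]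
  [AddCommGroup B] [Module k B] [AddCommGroup P] [Module k P] [AddCommGroup Q] [Module k Q]
  [AddCommGroup N] [Module k N]

lemma rTensor_lTensor_apply (f : A →ₗ[k] B) (g : P →ₗ[k] Q) (t : A ⊗[k] P) :
    f.rTensor Q (g.lTensor A t) = g.lTensor B (f.rTensor P t) := by
  rw [← LinearMap.comp_apply, ← LinearMap.comp_apply, LinearMap.rTensor_comp_lTensor,
    LinearMap.lTensor_comp_rTensor]

lemma map_lTensor_apply (f : A →ₗ[k] B) (g : Q →ₗ[k] N) (h : P →ₗ[k] Q) (t : A ⊗[k] P) :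
    TensorProduct.map f g (h.lTensor A t) = (g ∘ₗ h).lTensor B (f.rTensor P t) := by
  rw [← LinearMap.comp_apply, ← LinearMap.comp_apply, LinearMap.map_comp_lTensor,
    LinearMap.lTensor_comp_rTensor]

end TensorMaps

variable {k : Type u} [Field k] {R : Type w} [Ring R] [Algebra k R]
variable {C : Type u₁} [Category.{v₁} C] [Preadditive C] [Linear k C] [MonoidalCategory C]
  [MonoidalLeftAction C (FGModuleCat.{w} R)] [BilinearAction k C (FGModuleCat.{w} R)]

section AssocSec

variable [IsSemisimpleRing R] (S : SeparabilityIdempotent k R) {X Y : C} {M : FGModuleCat.{w} R}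

/-- The computation of `assoc_fiberSec` with an arbitrary module in the third place: the two
insertions of `e` commute. -/
lemma assoc_fiberSec_pairingSec (z : (X ⊙ₗ Y ⊙ₗ M : FGModuleCat.{w} R)) :
    TensorProduct.assoc k _ _ _ ((fiberSec S X Y).rTensor M
      (pairingSec S (X ⊗ Y) M (linMap (k := k) (αₗ X Y M).inv z))) =
      (pairingSec S Y M).lTensor _ (pairingSec S X (Y ⊙ₗ M) z) := by
  obtain ⟨t, rfl⟩ := pairing_surjective k X (Y ⊙ₗ M) z
  induction t with
  | zero => simp only [map_zero]
  | add a b ha hb => simp only [map_add, ha, hb]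
  | tmul x z =>
    obtain ⟨s, rfl⟩ := pairing_surjective k Y M z
    induction s with
    | zero => simp only [map_zero, TensorProduct.tmul_zero]
    | add a b ha hb => simp only [map_add, TensorProduct.tmul_add, ha, hb]
    | tmul y m =>
      rw [← pairing_assoc, linMap_hom_inv, pairing_assoc, pairingSec_pairing, pairingSec_pairing,
        pairingSplit_tmul, pairingSplit_tmul]
      simp only [map_sum, LinearMap.rTensor_tmul, LinearMap.lTensor_tmul, rightMul_fiberMul,
        fiberSec_fiberMul_tmul, TensorProduct.sum_tmul, TensorProduct.assoc_tmul, pairingSec_smul,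
        pairingSec_pairing, pairingSplit_tmul, lmulHom_apply, TensorProduct.tmul_sum]
      exact Finset.sum_comm

end AssocSec

section Twist

variable (T T' : ModuleEndofunctor k C (FGModuleCat.{w} R))

/-- The map `v ⊗ x ↦ c_{X,R}(v ⊗ x)`. -/
def twist (X : C) : T.functor.obj (regular R) ⊗[k] fiber R X →ₗ[k]
    (X ⊙ₗ T.functor.obj (regular R) : FGModuleCat.{w} R) :=
  linMap (k := k) (T.lineator X (regular R)) ∘ₗ pair k T.functor (fiber R X)

variable {T T'} {X Y : C}

lemma twist_tmul (v : T.functor.obj (regular R)) (x : fiber R X) :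
    twist T X (v ⊗ₜ x) = linMap (k := k) (T.lineator X (regular R))
      (linMap (k := k) (T.functor.map (orbit R x)) v) := rfl

lemma twist_fiberMap (f : X ⟶ Y) (v : T.functor.obj (regular R)) (x : fiber R X) :
    twist T Y (v ⊗ₜ fiberMap k f x) =
      linMap (k := k) (f ⊵ₗ T.functor.obj (regular R)) (twist T X (v ⊗ₜ x)) := by
  rw [twist, LinearMap.comp_apply, fiberMap, ← pair_map, ← linMap_comp,
    Functor.OplaxLeftLinear.δₗ_naturality_left, linMap_comp]
  rfl

lemma twist_smul (r : R) (v : T.functor.obj (regular R)) (x : fiber R X) :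
    twist T X ((r • v) ⊗ₜ x) = r • twist T X (v ⊗ₜ x) := by
  rw [twist, LinearMap.comp_apply, pair_smul, linMap_smul]
  rfl

lemma twist_rmul (r : R) (v : T.functor.obj (regular R)) (x : fiber R X) :
    twist T X (rmul k T.functor v r ⊗ₜ x) = twist T X (v ⊗ₜ (r • x)) := by
  rw [twist, LinearMap.comp_apply, pair_rmul, LinearMap.comp_apply]

lemma twist_hom (f : T ⟶ T') (v : T.functor.obj (regular R)) (x : fiber R X) :
    twist T' X (linMap (k := k) (f.natTrans.app (regular R)) v ⊗ₜ x) =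
      linMap (k := k) (X ⊴ₗ f.natTrans.app (regular R)) (twist T X (v ⊗ₜ x)) := by
  rw [twist, LinearMap.comp_apply, ← pair_natTrans, ← linMap_comp, f.comm, linMap_comp]
  rfl

/-- The associativity axiom of `c` together with its naturality along `R ⟶ F(Y)`. It expresses `c`
for `X ⊗ Y` by those for `X` and `Y` and is the source of coassociativity. -/
lemma twist_fiberMul (v : T.functor.obj (regular R)) (x : fiber R X) (y : fiber R Y) :
    twist T (X ⊗ Y) (v ⊗ₜ fiberMul k X Y (x ⊗ₜ y)) =
      linMap (k := k) (αₗ X Y (T.functor.obj (regular R))).inv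
        (linMap (k := k) (X ⊴ₗ (T.functor.map (orbit R y) ≫ T.lineator Y (regular R)))
          (twist T X (v ⊗ₜ x))) := by
  rw [twist_tmul, orbit_fiberMul k, Functor.map_comp, Functor.map_comp, linMap_comp, linMap_comp,
    ← linMap_comp (T.functor.map (αₗ X Y (regular R)).inv),
    ← Functor.OplaxLeftLinear.δₗ_associativity_inv, linMap_comp, linMap_comp,
    ← linMap_comp (T.functor.map (X ⊴ₗ orbit R y)), Functor.OplaxLeftLinear.δₗ_naturality_right,
    linMap_comp, ← linMap_comp _ (X ⊴ₗ T.lineator Y (regular R)), ← actionHomRight_comp]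
  rfl

/-- The unit axiom of `c`, evaluated at the unit of `F(𝟙)`; it is the source of counitality. -/
lemma twist_unitElem (v : T.functor.obj (regular R)) :
    twist T (𝟙_ C) (v ⊗ₜ unitElem R C) = pairing k (𝟙_ C) _ (unitElem R C ⊗ₜ v) := by
  rw [twist_tmul, orbit_unitElem, ← linMap_comp, ← Functor.OplaxLeftLinear.δₗ_unitality_inv,
    ← linMap_hom_inv (k := k) (λₗ (T.functor.obj (regular R))) (pairing k _ _ _), unit_pairing,
    unitVal_unitElem, one_smul]

end Twist

namespace FiberRep

variable {H : Type v} [Ring H] [Algebra k H] {ρ : FiberRep k R C H} [WeakBialgebra k H]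
  [IsSemisimpleRing R] {S : SeparabilityIdempotent k R}
  {T T' : ModuleEndofunctor k C (FGModuleCat.{w} R)}

variable (ρ S T) in
/-- The coaction on `T(R)` given by the structure morphisms of `T`. -/
def IsCoact (δ : T.functor.obj (regular R) →ₗ[k] H ⊗[k] T.functor.obj (regular R)) : Prop :=
  ∀ v X x, (ρ.ev X x).rTensor _ (δ v) = pairingSec S X _ (twist T X (v ⊗ₜ x))

variable (ρ S T) in
-- For fixed `v`, the map `x ↦ c(v ⊗ x)` followed by the section is natural in `X`, so it comes from
-- an element of `H ⊗ T(R)`.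
lemma exists_isCoact [FiniteDimensional k R] : ∃ δ, ρ.IsCoact S T δ := by
  have := finiteDimensional_fgModule (k := k) (T.functor.obj (regular R))
  have h (v : T.functor.obj (regular R)) : ∃ t : H ⊗[k] T.functor.obj (regular R), ∀ X x,
      (ρ.ev X x).rTensor _ t = pairingSec S X _ (twist T X (v ⊗ₜ x)) :=
    ρ.exists_tensor_of_natural (fun X => pairingSec S X _ ∘ₗ twist T X ∘ₗ TensorProduct.mk k _ _ v)
      fun X Y f x => by
        simp only [LinearMap.comp_apply, TensorProduct.mk_apply, twist_fiberMap, pairingSec_mapLeft]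
  choose t ht using h
  exact ⟨{ toFun := t
           map_add' := fun v v' => ρ.tensor_ext fun X x => by
            rw [map_add, ht, ht, ht, TensorProduct.add_tmul, map_add, map_add]
           map_smul' := fun c v => ρ.tensor_ext fun X x => by
            rw [RingHom.id_apply, map_smul, ht, ht, ← TensorProduct.smul_tmul', map_smul,
              map_smul] }, ht⟩

variable {δ : T.functor.obj (regular R) →ₗ[k] H ⊗[k] T.functor.obj (regular R)}
  {δ' : T'.functor.obj (regular R) →ₗ[k] H ⊗[k] T'.functor.obj (regular R)}
  (hδ : ρ.IsCoact S T δ) (hδ' : ρ.IsCoact S T' δ')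

include hδ in
lemma IsCoact.twist_eq (v : T.functor.obj (regular R)) (X : C) (x : fiber R X) :
    twist T X (v ⊗ₜ x) = pairing k X _ ((ρ.ev X x).rTensor _ (δ v)) := by
  rw [hδ, pairing_pairingSec]

include hδ hδ' in
lemma IsCoact.isColinear (f : T ⟶ T') :
    IsColinear δ δ' (linMap (k := k) (f.natTrans.app (regular R))) :=
  LinearMap.ext fun v => ρ.tensor_ext fun X x => by
    rw [LinearMap.comp_apply, hδ', twist_hom, pairingSec_map, ← hδ, LinearMap.comp_apply,
      rTensor_lTensor_apply]

include hδ in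
-- Evaluated at `x` and `y`, the iterated coaction applies `c` for `X` and then for `Y`, while the
-- other side applies `c` for `X ⊗ Y`. These agree by `twist_fiberMul` and the compatibility of the
-- sections.
lemma IsCoact.isCoassoc (hρ : ρ.IsReconstruction S) : IsCoassoc δ := by
  refine LinearMap.ext fun v => (ρ.jointlyInjective_ev.map
    (ρ.jointlyInjective_ev.map (jointlyInjective_id (k := k)))).ext ?_
  rintro ⟨⟨X, x⟩, ⟨Y, y⟩, i⟩
  have h1 : TensorProduct.map (ρ.ev X x) (TensorProduct.map (ρ.ev Y y) LinearMap.id)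
      (δ.lTensor H (δ v)) = (pairingSec S Y _ ∘ₗ twist T Y ∘ₗ
        (TensorProduct.mk k _ _).flip y).lTensor _ ((ρ.ev X x).rTensor _ (δ v)) := by
    have h2 : TensorProduct.map (ρ.ev Y y) LinearMap.id ∘ₗ δ = pairingSec S Y _ ∘ₗ twist T Y ∘ₗ
        (TensorProduct.mk k _ _).flip y := LinearMap.ext fun v => hδ v Y y
    rw [← h2, map_lTensor_apply]
  have h3 := map_map_assoc (ρ.ev X x) (ρ.ev Y y) LinearMap.id
    ((Coalgebra.comul (R := k) (A := H)).rTensor _ (δ v))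
  rw [map_rTensor_of_comp (f := TensorProduct.map (ρ.ev X x) (ρ.ev Y y))
    (q := ρ.ev (X ⊗ Y) (fiberMul k X Y (x ⊗ₜ y))) (s := fiberSec S X Y)
    (fun h => hρ.isComul h X Y x y)] at h3
  have h4 : TensorProduct.map (ρ.ev (X ⊗ Y) (fiberMul k X Y (x ⊗ₜ y))) LinearMap.id (δ v) =
      pairingSec S _ _ (twist T _ (v ⊗ₜ fiberMul k X Y (x ⊗ₜ y))) := hδ v _ _
  rw [h4, twist_fiberMul, assoc_fiberSec_pairingSec, pairingSec_map, ← LinearMap.lTensor_comp_apply]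
    at h3
  refine h1.trans (Eq.trans ?_ h3.symm)
  rw [hδ]
  rfl

include hδ in
-- At the unit of `F(𝟙)` the coaction becomes `∑ a ⊗ b v`, and `∑ φ(a) b = 1`.
lemma IsCoact.counitPart_eq (hρ : ρ.IsReconstruction S) : counitPart δ = LinearMap.id := by
  refine LinearMap.ext fun v => ?_
  have h1 := apply_lid_rTensor (ε := Coalgebra.counit (R := k) (A := H))
    (η := S.form ∘ₗ unitVal k C) (q := ρ.ev (𝟙_ C) (unitElem R C)) hρ.counit_eq
    LinearMap.id (δ v)
  refine h1.trans ?_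
  have h2 := hδ v (𝟙_ C) (unitElem R C)
  rw [twist_unitElem, pairingSec_pairing, pairingSplit_tmul] at h2
  refine (congrArg (fun t => TensorProduct.lid k _ ((S.form ∘ₗ unitVal k C).rTensor _ t))
    h2).trans ?_
  simp only [map_sum, LinearMap.rTensor_tmul, LinearMap.comp_apply, TensorProduct.lid_tmul,
    unitVal_rightMul, unitVal_unitElem, ← smul_assoc]
  rw [← Finset.sum_smul, S.sum_form_mul, one_smul]
  rfl

end FiberRep

end Reconstruction

end

/-! ### The functor to comodules is fully faithful -/

noncomputable section

open MonoidalLeftAction WeakBialgebra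

namespace Reconstruction

variable {k : Type u} [Field k] {R : Type w} [Ring R] [Algebra k R]
variable {C : Type u₁} [Category.{v₁} C] [Preadditive C] [Linear k C] [MonoidalCategory C]
  [MonoidalLeftAction C (FGModuleCat.{w} R)] [BilinearAction k C (FGModuleCat.{w} R)]

section Lineator

variable {T T' : ModuleEndofunctor k C (FGModuleCat.{w} R)} {X : C} {M : FGModuleCat.{w} R}

/-- Naturality of `c` in the module variable along `R ⟶ M`: every `c_{X,M}` is determined by
`c_{X,R}`. -/
lemma lineator_pair (v : T.functor.obj (regular R)) (x : fiber R X) (m : M) :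
    linMap (k := k) (T.lineator X M) (pair k T.functor _ (v ⊗ₜ pairing k X M (x ⊗ₜ m))) =
      linMap (k := k) (X ⊴ₗ T.functor.map (orbit R m)) (twist T X (v ⊗ₜ x)) := by
  rw [pairing_tmul, ← pair_map, ← linMap_comp, Functor.OplaxLeftLinear.δₗ_naturality_right,
    linMap_comp]
  rfl

variable [IsSemisimpleRing R]

/-- A natural transformation between module endofunctors is a morphism as soon as it commutes with
the structure morphisms `c_{X,R}`. -/
lemma comm_of_twist (η : T.functor ⟶ T'.functor)
    (h : ∀ v X (x : fiber R X), twist T' X (linMap (k := k) (η.app (regular R)) v ⊗ₜ x) =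
      linMap (k := k) (X ⊴ₗ η.app (regular R)) (twist T X (v ⊗ₜ x))) (X : C)
    (M : FGModuleCat.{w} R) :
    η.app (X ⊙ₗ M) ≫ T'.lineator X M = T.lineator X M ≫ X ⊴ₗ η.app M := by
  refine pair_hom_ext (k := k) fun v z => ?_
  obtain ⟨t, rfl⟩ := pairing_surjective k X M z
  induction t with
  | zero => simp only [map_zero, TensorProduct.tmul_zero]
  | add a b ha hb => simp only [map_add, TensorProduct.tmul_add, ha, hb]
  | tmul x m =>
    rw [linMap_comp, linMap_comp, pair_natTrans, lineator_pair, lineator_pair, h, ← linMap_comp,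
      ← linMap_comp, ← actionHomRight_comp, ← actionHomRight_comp, η.naturality]

end Lineator

namespace FiberRep

section

variable {H : Type v} [Ring H] [Algebra k H] {ρ : FiberRep k R C H} [WeakBialgebra k H]
  [IsSemisimpleRing R] {S : SeparabilityIdempotent k R}
  {T T' : ModuleEndofunctor k C (FGModuleCat.{w} R)}
  {δ : T.functor.obj (regular R) →ₗ[k] H ⊗[k] T.functor.obj (regular R)}
  {δ' : T'.functor.obj (regular R) →ₗ[k] H ⊗[k] T'.functor.obj (regular R)}
  (hδ : ρ.IsCoact S T δ) (hδ' : ρ.IsCoact S T' δ')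

include hδ

lemma IsCoact.coaction_smul (r : R) (v : T.functor.obj (regular R)) :
    δ (r • v) = (LinearMap.mulLeft k (ρ.left r)).rTensor _ (δ v) :=
  ρ.tensor_ext fun X x => by
    have h : ρ.ev X x ∘ₗ LinearMap.mulLeft k (ρ.left r) = lmulHom k _ r ∘ₗ ρ.ev X x :=
      LinearMap.ext fun h => by
        simp only [LinearMap.comp_apply, LinearMap.mulLeft_apply, ev_apply, ρ.act_mul, ρ.act_left,
          lmulHom_apply]
    rw [hδ, twist_smul, pairingSec_smul, ← hδ, ← LinearMap.rTensor_comp_apply,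
      ← LinearMap.rTensor_comp_apply, h]

lemma IsCoact.coaction_rmul (r : R) (v : T.functor.obj (regular R)) :
    δ (rmul k T.functor v r) = (LinearMap.mulRight k (ρ.left r)).rTensor _ (δ v) :=
  ρ.tensor_ext fun X x => by
    have h : ρ.ev X x ∘ₗ LinearMap.mulRight k (ρ.left r) = ρ.ev X (r • x) :=
      LinearMap.ext fun h => by
        simp only [LinearMap.comp_apply, LinearMap.mulRight_apply, ev_apply, ρ.act_mul, ρ.act_left]
    rw [hδ, twist_rmul, ← hδ, ← LinearMap.rTensor_comp_apply, h]

variable (hρ : ρ.IsReconstruction S)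

/-- Both actions have the same effect after the injective map `δ`. With the right-handed version,
the bimodule structure of `T(R)` is recovered from its coaction alone. -/
lemma IsCoact.lact_apply (r : R) (v : T.functor.obj (regular R)) :
    hρ.lact δ r v = r • v :=
  coaction_injective (hδ.counitPart_eq hρ) <| by
    rw [hρ.coaction_lact (hδ.isCoassoc hρ), hδ.coaction_smul]

lemma IsCoact.ract_apply (r : R) (v : T.functor.obj (regular R)) :
    hρ.ract δ r v = rmul k T.functor v r :=
  coaction_injective (hδ.counitPart_eq hρ) <| by
    rw [hρ.coaction_ract (hδ.isCoassoc hρ), hδ.coaction_rmul]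

include hδ' hρ

/-- Colinear maps come from morphisms of module functors. -/
lemma IsCoact.exists_hom {g : T.functor.obj (regular R) →ₗ[k] T'.functor.obj (regular R)}
    (hg : IsColinear δ δ' g) :
    ∃ f : T ⟶ T', linMap (k := k) (f.natTrans.app (regular R)) = g := by
  -- Colinear maps commute with the actions of `R` defined through the coactions, which here are the
  -- given ones. So `g` is a bimodule map and extends to a natural transformation.
  let g' : T.functor.obj (regular R) ⟶ T'.functor.obj (regular R) := FGModuleCat.ofHom
    { toFun := g
      map_add' := g.map_add
      map_smul' := fun r v => by
        rw [← hδ.lact_apply hρ, RingHom.id_apply, ← hδ'.lact_apply hρ]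
        exact (leftUnit_natural hg (hρ.base r) v).symm }
  have hg' (v : T.functor.obj (regular R)) : linMap (k := k) g' v = g v := rfl
  obtain ⟨η, hη⟩ := exists_natTrans_of_rmul (k := k) g' fun v r => by
    rw [hg', hg', ← hδ.ract_apply hρ, ← hδ'.ract_apply hρ]
    exact (rightUnit_natural hg (hρ.base r) v).symm
  refine ⟨⟨η, comm_of_twist η fun v X x => ?_⟩, ?_⟩
  · rw [hη, hδ'.twist_eq, hδ.twist_eq, hg', ← LinearMap.comp_apply δ' g, hg,
      LinearMap.comp_apply, rTensor_lTensor_apply]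
    generalize (ρ.ev X x).rTensor _ (δ v) = t
    induction t with
    | zero => simp only [map_zero]
    | add a b ha hb => simp only [map_add, ha, hb]
    | tmul y v => rw [pairing_map, LinearMap.lTensor_tmul, hg']
  · rw [hη]
    rfl

end

end FiberRep

/-! ### Comodules in the universe of `H` -/

section Lift

variable {H : Type (max u₁ w)} [Ring H] [Algebra k H] [WeakBialgebra k H]
  {P : Type w} [AddCommGroup P] [Module k P] {Q : Type w} [AddCommGroup Q] [Module k Q]
  {δ : P →ₗ[k] H ⊗[k] P} {δ' : Q →ₗ[k] H ⊗[k] Q}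

variable (k P) in
/-- The equivalence `ULift P ≃ P`. -/
abbrev liftEquiv : ULift.{u₁} P ≃ₗ[k] P := ULift.moduleEquiv

/-- Transport of a coaction to a larger universe. -/
def liftCoaction (δ : P →ₗ[k] H ⊗[k] P) : ULift.{u₁} P →ₗ[k] H ⊗[k] ULift.{u₁} P :=
  (liftEquiv k P).symm.toLinearMap.lTensor H ∘ₗ δ ∘ₗ
    (liftEquiv k P).toLinearMap

lemma isColinear_up : IsColinear δ (liftCoaction δ)
    (liftEquiv k P).symm.toLinearMap := rfl

lemma isColinear_down : IsColinear (liftCoaction δ) δ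
    (liftEquiv k P).toLinearMap :=
  (isColinear_up (δ := δ)).symm

variable (δ) in
/-- The comodule in a larger universe given by a coaction. -/
def comoduleOf [FiniteDimensional k P] (h : IsCoassoc δ) (hc : counitPart δ = LinearMap.id) :
    LeftComodule k H where
  -- `H` is indexed by the objects of `C` and lives in a larger universe than `T(R)`; comodules are
  -- required to live where `H` does.
  carrier := ULift.{u₁} P
  coaction := liftCoaction δ
  finiteDimensional := Module.Finite.equiv (liftEquiv k P).symm
  coassoc := isCoassoc_of_injective (liftEquiv k P).injective
    isColinear_down h
  counital := LinearMap.ext fun v => (liftEquiv k P).injective <| by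
    have h1 := LinearMap.congr_fun (isColinear_down (δ := δ)).counitPart_comp v
    rw [hc] at h1
    exact h1.symm

end Lift

namespace FiberRep.IsReconstruction

variable {H : Type (max u₁ w)} [Ring H] [Algebra k H] {ρ : FiberRep k R C H} [WeakBialgebra k H]
  [IsSemisimpleRing R] [FiniteDimensional k R] {S : SeparabilityIdempotent k R}
  (hρ : ρ.IsReconstruction S)
  {T T' : ModuleEndofunctor k C (FGModuleCat.{w} R)}

variable (ρ S T) in
/-- The coaction on `T(R)`. -/
def _root_.Reconstruction.FiberRep.coact :
    T.functor.obj (regular R) →ₗ[k] H ⊗[k] T.functor.obj (regular R) :=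
  (ρ.exists_isCoact S T).choose

variable (ρ S T) in
lemma _root_.Reconstruction.FiberRep.isCoact_coact : ρ.IsCoact S T (ρ.coact S T) :=
  (ρ.exists_isCoact S T).choose_spec

/-- The comodule `T(R)`. -/
def comodule (T : ModuleEndofunctor k C (FGModuleCat.{w} R)) : LeftComodule k H :=
  haveI := finiteDimensional_fgModule (k := k) (T.functor.obj (regular R))
  comoduleOf (ρ.coact S T) ((ρ.isCoact_coact S T).isCoassoc hρ)
    ((ρ.isCoact_coact S T).counitPart_eq hρ)

/-- The identification of the comodule attached to `T` with `T(R)`. -/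
def comoduleEquiv (T : ModuleEndofunctor k C (FGModuleCat.{w} R)) :
    (hρ.comodule T).carrier ≃ₗ[k] T.functor.obj (regular R) := liftEquiv k _

lemma isColinear_comoduleEquiv (T : ModuleEndofunctor k C (FGModuleCat.{w} R)) :
    IsColinear (hρ.comodule T).coaction (ρ.coact S T) (hρ.comoduleEquiv T).toLinearMap :=
  isColinear_down

/-- The functor from module endofunctors to comodules. -/
def functor : ModuleEndofunctor k C (FGModuleCat.{w} R) ⥤ LeftComodule k H where
  obj := hρ.comodule
  map {T T'} f := ⟨(hρ.comoduleEquiv T').symm.toLinearMap ∘ₗ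
    linMap (k := k) (f.natTrans.app (regular R)) ∘ₗ (hρ.comoduleEquiv T).toLinearMap,
    (hρ.isColinear_comoduleEquiv T').symm.comp
      (((ρ.isCoact_coact S T).isColinear (ρ.isCoact_coact S T') f).comp
        (hρ.isColinear_comoduleEquiv T))⟩

lemma comoduleEquiv_map (f : T ⟶ T') (v : (hρ.comodule T).carrier) :
    hρ.comoduleEquiv T' ((hρ.functor.map f).toLinearMap v) =
      linMap (k := k) (f.natTrans.app (regular R)) (hρ.comoduleEquiv T v) := rfl

/-- The comodule map reads off the component at `R`, which determines a natural transformation of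
linear functors. -/
instance : hρ.functor.Faithful where
  map_injective {T T'} f g h := by
    have h1 : f.natTrans = g.natTrans := natTrans_ext_regular k <| linMap_ext (k := k) fun v => by
      rw [← (hρ.comoduleEquiv T).apply_symm_apply v, ← hρ.comoduleEquiv_map,
        ← hρ.comoduleEquiv_map, h]
    exact ModuleEndofunctor.Hom.ext h1

instance : hρ.functor.Full where
  map_surjective {T T'} g := by
    obtain ⟨f, hf⟩ := (ρ.isCoact_coact S T).exists_hom (ρ.isCoact_coact S T') hρ
      (((hρ.isColinear_comoduleEquiv T').comp g.colinear).comp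
        (hρ.isColinear_comoduleEquiv T).symm)
    refine ⟨f, LeftComodule.hom_ext <| LinearMap.ext fun v =>
      (hρ.comoduleEquiv T').injective ?_⟩
    refine (hρ.comoduleEquiv_map f v).trans ?_
    rw [hf]
    rfl

end FiberRep.IsReconstruction

end Reconstruction

end

/-! ### The functor `A ⊗_R -` of a bimodule -/

noncomputable section

open MonoidalLeftAction WeakBialgebra

namespace Reconstruction

variable {k : Type u} [Field k] {R : Type w} [Ring R] [Algebra k R]

section BalancedTensor

variable {A : FGModuleCat.{w} R} (q : R →ₗ[k] Module.End k A)

/-- The relations `v r ⊗ m = v ⊗ r m`. -/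
def balanced (M : FGModuleCat.{w} R) : Submodule R (A ⊗[k] M) :=
  Submodule.span R {t | ∃ v r m, t = q r v ⊗ₜ m - v ⊗ₜ (r • m)}

variable [FiniteDimensional k R]

instance (M : FGModuleCat.{w} R) : Module.Finite R ((A ⊗[k] M) ⧸ balanced q M) :=
  haveI := finiteDimensional_fgModule (k := k) A
  haveI := finiteDimensional_fgModule (k := k) M
  haveI : Module.Finite R (A ⊗[k] M) := Module.Finite.of_restrictScalars_finite k R _
  inferInstance

/-- The module `A ⊗_R M`, for an `R`-bimodule `A`. -/
def balancedTensor (M : FGModuleCat.{w} R) : FGModuleCat.{w} R :=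
  FGModuleCat.of R ((A ⊗[k] M) ⧸ balanced q M)

/-- The projection `A ⊗ M → A ⊗_R M`. -/
def balancedProj (M : FGModuleCat.{w} R) : A ⊗[k] M →ₗ[k] balancedTensor q M :=
  let g : A ⊗[k] M →ₗ[R] balancedTensor q M := (balanced q M).mkQ
  g.restrictScalars k

lemma balancedProj_surjective (M : FGModuleCat.{w} R) : Function.Surjective (balancedProj q M) :=
  (balanced q M).mkQ_surjective

variable {q} {M N : FGModuleCat.{w} R}

lemma balancedProj_smul (r : R) (v : A) (m : M) :
    balancedProj q M ((r • v) ⊗ₜ m) = r • balancedProj q M (v ⊗ₜ m) := rfl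

lemma balancedProj_balanced (r : R) (v : A) (m : M) :
    balancedProj q M (q r v ⊗ₜ m) = balancedProj q M (v ⊗ₜ (r • m)) :=
  (Submodule.Quotient.eq (balanced q M)).2 (Submodule.subset_span ⟨v, r, m, rfl⟩)

lemma balancedTensor_hom_ext {f g : balancedTensor q M ⟶ N}
    (h : ∀ v m, linMap (k := k) f (balancedProj q M (v ⊗ₜ m)) =
      linMap (k := k) g (balancedProj q M (v ⊗ₜ m))) : f = g := by
  refine linMap_ext (k := k) fun z => ?_
  obtain ⟨t, rfl⟩ := balancedProj_surjective q M z
  induction t with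
  | zero => simp only [map_zero]
  | add a b ha hb => simp only [map_add, ha, hb]
  | tmul v m => exact h v m

lemma exists_balancedDesc (f : A ⊗[k] M →ₗ[k] N)
    (h1 : ∀ (r : R) v m, f ((r • v) ⊗ₜ m) = r • f (v ⊗ₜ m))
    (h2 : ∀ (r : R) v m, f (q r v ⊗ₜ m) = f (v ⊗ₜ (r • m))) :
    ∃ g : balancedTensor q M ⟶ N, ∀ t, linMap (k := k) g (balancedProj q M t) = f t := by
  let f' : A ⊗[k] M →ₗ[R] N :=
    { toFun := f
      map_add' := f.map_add
      map_smul' := fun r t => by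
        induction t with
        | zero => simp only [smul_zero, map_zero]
        | add a b ha hb => simp only [smul_add, map_add, ha, hb]
        | tmul v m => rw [TensorProduct.smul_tmul', h1]; rfl }
  have hf : balanced q M ≤ LinearMap.ker f' := Submodule.span_le.2 <| by
    rintro _ ⟨v, r, m, rfl⟩
    change f _ = 0
    rw [map_sub, h2, sub_self]
  exact ⟨FGModuleCat.ofHom ((balanced q M).liftQ f' hf), fun t => rfl⟩

/-- The morphism out of `A ⊗_R M` given by a balanced map. -/
def balancedDesc (f : A ⊗[k] M →ₗ[k] N)
    (h1 : ∀ (r : R) v m, f ((r • v) ⊗ₜ m) = r • f (v ⊗ₜ m))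
    (h2 : ∀ (r : R) v m, f (q r v ⊗ₜ m) = f (v ⊗ₜ (r • m))) : balancedTensor q M ⟶ N :=
  (exists_balancedDesc f h1 h2).choose

lemma balancedDesc_proj {f : A ⊗[k] M →ₗ[k] N}
    {h1 : ∀ (r : R) v m, f ((r • v) ⊗ₜ m) = r • f (v ⊗ₜ m)}
    {h2 : ∀ (r : R) v m, f (q r v ⊗ₜ m) = f (v ⊗ₜ (r • m))} (t : A ⊗[k] M) :
    linMap (k := k) (balancedDesc f h1 h2) (balancedProj q M t) = f t :=
  (exists_balancedDesc f h1 h2).choose_spec t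

variable (q) in
/-- The map `A ⊗_R f`. -/
def balancedMap (f : M ⟶ N) : balancedTensor q M ⟶ balancedTensor q N :=
  balancedDesc (balancedProj q N ∘ₗ (linMap (k := k) f).lTensor A)
    (fun r v m => by
      simp only [LinearMap.comp_apply, LinearMap.lTensor_tmul, balancedProj_smul])
    (fun r v m => by
      simp only [LinearMap.comp_apply, LinearMap.lTensor_tmul, balancedProj_balanced, linMap_smul])

lemma balancedMap_proj (f : M ⟶ N) (v : A) (m : M) :
    linMap (k := k) (balancedMap q f) (balancedProj q M (v ⊗ₜ m)) =
      balancedProj q N (v ⊗ₜ linMap (k := k) f m) :=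
  balancedDesc_proj _

variable (q) in
/-- The functor `M ↦ A ⊗_R M`. -/
def balancedFunctor : FGModuleCat.{w} R ⥤ FGModuleCat.{w} R where
  obj := balancedTensor q
  map := balancedMap q
  map_id M := balancedTensor_hom_ext (k := k) fun v m => by
    rw [balancedMap_proj, linMap_id, linMap_id]
  map_comp f g := balancedTensor_hom_ext (k := k) fun v m => by
    rw [balancedMap_proj, linMap_comp, linMap_comp, balancedMap_proj, balancedMap_proj]

instance : (balancedFunctor q).Additive where
  map_add {M N f g} := balancedTensor_hom_ext (k := k) fun v m =>
    (balancedMap_proj (f + g) v m).trans <| by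
      rw [linMap_add, TensorProduct.tmul_add, map_add, ← balancedMap_proj, ← balancedMap_proj]
      exact (linMap_add _ _ _).symm

instance : (balancedFunctor q).Linear k where
  map_smul {M N} f c := balancedTensor_hom_ext (k := k) fun v m =>
    (balancedMap_proj (c • f) v m).trans <| by
      have h : linMap (k := k) (c • f) m = c • linMap (k := k) f m := rfl
      rw [h, TensorProduct.tmul_smul, map_smul, ← balancedMap_proj]
      rfl

variable (q) in
/-- The map `v ↦ v ⊗ m`. -/
def balancedAt (m : M) : A →ₗ[k] balancedTensor q M :=
  balancedProj q M ∘ₗ (TensorProduct.mk k A M).flip m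

lemma balancedAt_smul (r : R) (m : M) : balancedAt q (r • m) = balancedAt q m ∘ₗ q r :=
  LinearMap.ext fun v => (balancedProj_balanced r v m).symm

lemma linMap_balancedMap_comp_balancedAt (f : M ⟶ N) (m : M) :
    linMap (k := k) (balancedMap q f) ∘ₗ balancedAt q m = balancedAt q (linMap (k := k) f m) :=
  LinearMap.ext fun v => balancedMap_proj f v m

/-- The linear map underlying a morphism to `R`. -/
def valMap (p : M ⟶ regular R) : M →ₗ[k] R where
  toFun m := linMap (k := k) p m
  map_add' m m' := map_add (linMap (k := k) p) m m'
  map_smul' c m := by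
    have h : linMap (k := k) p (c • m) = algebraMap k R c • linMap (k := k) p m :=
      linMap_smul (k := k) p (algebraMap k R c) m
    exact h.trans (Algebra.smul_def (A := R) c _).symm

lemma valMap_smul (p : M ⟶ regular R) (r : R) (m : M) :
    valMap (k := k) p (r • m) = r * valMap (k := k) p m :=
  linMap_smul (k := k) p r m

/-- The map `v ⊗ m ↦ v p(m)` is balanced because the right action is multiplicative, and left linear
because the two actions commute. For `p` the identity it inverts `v ↦ v ⊗ 1`. -/
lemma exists_hom_of_val (hq : ∀ r s, q (r * s) = q s * q r)
    (hc : ∀ (r s : R) v, q s (r • v) = r • q s v) (p : M ⟶ regular R) :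
    ∃ g : balancedTensor q M ⟶ A, ∀ v m,
      linMap (k := k) g (balancedProj q M (v ⊗ₜ m)) = q (valMap (k := k) p m) v := by
  obtain ⟨g, hg⟩ := exists_balancedDesc (q := q) (M := M)
    (TensorProduct.lift (q ∘ₗ valMap (k := k) p).flip) (fun r v m => hc r _ v)
    (fun r v m => by
      simp only [TensorProduct.lift.tmul, LinearMap.flip_apply, LinearMap.comp_apply, valMap_smul,
        hq, Module.End.mul_apply])
  exact ⟨g, fun v m => hg _⟩

lemma balancedAt_one_bijective (hq1 : q 1 = 1) (hq : ∀ r s, q (r * s) = q s * q r)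
    (hc : ∀ (r s : R) v, q s (r • v) = r • q s v) :
    Function.Bijective (balancedAt q (M := regular R) (1 : R)) := by
  have hsmul (r : R) : balancedAt q (M := regular R) r =
      balancedAt q (M := regular R) (1 : R) ∘ₗ q r := by
    rw [← balancedAt_smul]
    exact congrArg (balancedAt q (M := regular R)) (mul_one r).symm
  constructor
  · obtain ⟨g, hg⟩ := exists_hom_of_val hq hc (𝟙 (regular R))
    intro v v' h
    have h1 (v : A) : linMap (k := k) g (balancedAt q (M := regular R) (1 : R) v) = v :=
      (hg v _).trans (LinearMap.congr_fun hq1 v)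
    rw [← h1 v, h, h1]
  · intro z
    obtain ⟨t, rfl⟩ := balancedProj_surjective q _ z
    induction t with
    | zero => exact ⟨0, by simp only [map_zero]⟩
    | add a b ha hb =>
      obtain ⟨v, hv⟩ := ha
      obtain ⟨v', hv'⟩ := hb
      exact ⟨v + v', by simp only [map_add, hv, hv']⟩
    | tmul v r => exact ⟨q (r : R) v, (LinearMap.congr_fun (hsmul r) v).symm⟩

end BalancedTensor

end Reconstruction

end

/-! ### Structure morphisms of `A ⊗_R -` from a coaction -/

noncomputable section

open MonoidalLeftAction WeakBialgebra

namespace Reconstruction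

section TensorMaps

variable {k : Type*} [Field k] {A H F M N : Type*} [AddCommGroup A] [Module k A]
  [AddCommGroup H] [Module k H] [AddCommGroup F] [Module k F] [AddCommGroup M] [Module k M]
  [AddCommGroup N] [Module k N]

lemma map_lift_tensorTensorTensorComm (a : H →ₗ[k] Module.End k F) (p : A ⊗[k] M →ₗ[k] N)
    (t : H ⊗[k] A) (x : F) (m : M) :
    TensorProduct.map (TensorProduct.lift a) p
      (TensorProduct.tensorTensorTensorComm k H A F M (t ⊗ₜ (x ⊗ₜ m))) =
      TensorProduct.map (LinearMap.applyₗ x ∘ₗ a) (p ∘ₗ (TensorProduct.mk k A M).flip m) t := by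
  induction t with
  | zero => simp
  | add a b ha hb => simp only [TensorProduct.add_tmul, map_add, ha, hb]
  | tmul h v => simp

end TensorMaps

variable {k : Type u} [Field k] {R : Type w} [Ring R] [Algebra k R]
variable {C : Type u₁} [Category.{v₁} C] [Preadditive C] [Linear k C] [MonoidalCategory C]
  [MonoidalLeftAction C (FGModuleCat.{w} R)] [BilinearAction k C (FGModuleCat.{w} R)]

section Pairing

variable {X Y : C} {M N : FGModuleCat.{w} R}

lemma pairing_rTensor_lmulHom (r : R) (t : fiber R X ⊗[k] M) :
    pairing k X M ((lmulHom k _ r).rTensor M t) = r • pairing k X M t := by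
  induction t with
  | zero => simp only [map_zero, smul_zero]
  | add a b ha hb => simp only [map_add, smul_add, ha, hb]
  | tmul x m => rw [LinearMap.rTensor_tmul, lmulHom_apply, pairing_smul]

lemma pairing_lTensor (f : M ⟶ N) (t : fiber R X ⊗[k] M) :
    pairing k X N ((linMap (k := k) f).lTensor _ t) = linMap (k := k) (X ⊴ₗ f) (pairing k X M t) := by
  induction t with
  | zero => simp only [map_zero]
  | add a b ha hb => simp only [map_add, ha, hb]
  | tmul x m => rw [LinearMap.lTensor_tmul, pairing_map]

lemma pairing_rTensor (f : X ⟶ Y) (t : fiber R X ⊗[k] M) :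
    pairing k Y M ((fiberMap k f).rTensor _ t) = linMap (k := k) (f ⊵ₗ M) (pairing k X M t) := by
  induction t with
  | zero => simp only [map_zero]
  | add a b ha hb => simp only [map_add, ha, hb]
  | tmul x m => rw [LinearMap.rTensor_tmul, pairing_mapLeft]

lemma pairing_assoc_tensor (t : (fiber R X ⊗[k] fiber R Y) ⊗[k] M) :
    linMap (k := k) (αₗ X Y M).hom (pairing k (X ⊗ Y) M ((fiberMul k X Y).rTensor M t)) =
      pairing k X (Y ⊙ₗ M) ((pairing k Y M).lTensor _ (TensorProduct.assoc k _ _ _ t)) := by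
  induction t with
  | zero => simp only [map_zero]
  | add a b ha hb => simp only [map_add, ha, hb]
  | tmul s m =>
    induction s with
    | zero => simp only [map_zero, TensorProduct.zero_tmul]
    | add a b ha hb => simp only [map_add, TensorProduct.add_tmul, ha, hb]
    | tmul x y =>
      rw [LinearMap.rTensor_tmul, pairing_assoc, TensorProduct.assoc_tmul, LinearMap.lTensor_tmul]

lemma pairing_assoc_fiberSec [IsSemisimpleRing R] (S : SeparabilityIdempotent k R)
    (t : fiber R (X ⊗ Y) ⊗[k] M) :
    linMap (k := k) (αₗ X Y M).hom (pairing k (X ⊗ Y) M t) =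
      pairing k X (Y ⊙ₗ M) ((pairing k Y M).lTensor _ (TensorProduct.assoc k _ _ _
        ((fiberSec S X Y).rTensor M t))) := by
  have h : fiberMul k X Y ∘ₗ fiberSec S X Y = LinearMap.id :=
    LinearMap.ext fun z => fiberMul_fiberSec S z
  rw [← pairing_assoc_tensor, ← LinearMap.rTensor_comp_apply, h, LinearMap.rTensor_id_apply]

lemma unit_pairing_tensor (t : fiber R (𝟙_ C) ⊗[k] M) :
    linMap (k := k) (λₗ[C] M).hom (pairing k (𝟙_ C) M t) =
      TensorProduct.lift (lmulHom k M) ((unitVal k C).rTensor M t) := by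
  induction t with
  | zero => simp only [map_zero]
  | add a b ha hb => simp only [map_add, ha, hb]
  | tmul x m => rw [unit_pairing, LinearMap.rTensor_tmul, TensorProduct.lift.tmul, lmulHom_apply]

lemma actionUnitIso_inv_eq_pairing (m : M) :
    linMap (k := k) (λₗ[C] M).inv m = pairing k (𝟙_ C) M (unitElem R C ⊗ₜ m) := by
  rw [← linMap_hom_inv (k := k) (λₗ M) (pairing k _ _ _), unit_pairing, unitVal_unitElem, one_smul]

omit [Preadditive C] [Linear k C] [MonoidalCategory C] [MonoidalLeftAction C (FGModuleCat.{w} R)]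
  [BilinearAction k C (FGModuleCat.{w} R)] in
lemma lift_lmulHom_lTensor (f : M →ₗ[k] N) (hf : ∀ (r : R) m, f (r • m) = r • f m) (t : R ⊗[k] M) :
    TensorProduct.lift (lmulHom k N) (f.lTensor R t) = f (TensorProduct.lift (lmulHom k M) t) := by
  induction t with
  | zero => simp only [map_zero]
  | add a b ha hb => simp only [map_add, ha, hb]
  | tmul r m => exact (hf r m).symm

end Pairing

namespace FiberRep.IsReconstruction

variable {H : Type v} [Ring H] [Algebra k H] {ρ : FiberRep k R C H} [WeakBialgebra k H]
  [IsSemisimpleRing R] [FiniteDimensional k R] {S : SeparabilityIdempotent k R}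
  (hρ : ρ.IsReconstruction S)

section Ev

variable {X Y : C}

omit [WeakBialgebra k H] [IsSemisimpleRing R] [FiniteDimensional k R] in
variable (ρ) in
lemma _root_.Reconstruction.FiberRep.ev_comp_mulLeft_left (r : R) (x : fiber R X) :
    ρ.ev X x ∘ₗ LinearMap.mulLeft k (ρ.left r) = lmulHom k _ r ∘ₗ ρ.ev X x :=
  LinearMap.ext fun h => by
    simp only [LinearMap.comp_apply, LinearMap.mulLeft_apply, ev_apply, ρ.act_mul, ρ.act_left,
      lmulHom_apply]

variable (ρ) in
lemma _root_.Reconstruction.FiberRep.ev_comp_mulRight_left (r : R) (x : fiber R X) :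
    ρ.ev X x ∘ₗ LinearMap.mulRight k (ρ.left r) = ρ.ev X (r • x) :=
  LinearMap.ext fun h => by
    simp only [LinearMap.comp_apply, LinearMap.mulRight_apply, ev_apply, ρ.act_mul, ρ.act_left]

variable (ρ) in
lemma _root_.Reconstruction.FiberRep.ev_comp_mulRight_right (r : R) (x : fiber R X) :
    ρ.ev X x ∘ₗ LinearMap.mulRight k (ρ.right r) = ρ.ev X (rightMul k X x r) :=
  LinearMap.ext fun h => by
    simp only [LinearMap.comp_apply, LinearMap.mulRight_apply, ev_apply, ρ.act_mul, ρ.act_right]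

variable (ρ) in
lemma _root_.Reconstruction.FiberRep.ev_comp_mulLeft_right (r : R) (x : fiber R X) :
    ρ.ev X x ∘ₗ LinearMap.mulLeft k (ρ.right r) = rmulHom k (actionFunctor X) r ∘ₗ ρ.ev X x :=
  LinearMap.ext fun h => by
    simp only [LinearMap.comp_apply, LinearMap.mulLeft_apply, ev_apply, ρ.act_mul, ρ.act_right]
    rfl

variable (ρ) in
lemma _root_.Reconstruction.FiberRep.ev_fiberMap (f : X ⟶ Y) (x : fiber R X) :
    ρ.ev Y (fiberMap k f x) = fiberMap k f ∘ₗ ρ.ev X x :=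
  LinearMap.ext fun h => ρ.act_fiberMap f h x

end Ev

variable {A : FGModuleCat.{w} R} (δ : A →ₗ[k] H ⊗[k] A) {X Y : C} {M N : FGModuleCat.{w} R}

variable (X M) in
/-- The map `v ⊗ (x ⊗ m) ↦ v₋₁ x ⊗ (v₀ ⊗ m)`. -/
def twistTensor : A ⊗[k] (fiber R X ⊗[k] M) →ₗ[k]
    (X ⊙ₗ balancedTensor (hρ.ract δ) M : FGModuleCat.{w} R) :=
  pairing k X (balancedTensor (hρ.ract δ) M) ∘ₗ
    TensorProduct.map (TensorProduct.lift (ρ.act X)) (balancedProj (hρ.ract δ) M) ∘ₗ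
      (TensorProduct.tensorTensorTensorComm k H A (fiber R X) M).toLinearMap ∘ₗ
        δ.rTensor (fiber R X ⊗[k] M)

lemma twistTensor_tmul (v : A) (x : fiber R X) (m : M) :
    hρ.twistTensor δ X M (v ⊗ₜ (x ⊗ₜ m)) =
      pairing k X _ (TensorProduct.map (ρ.ev X x) (balancedAt (hρ.ract δ) m) (δ v)) :=
  congrArg (pairing k X _) (map_lift_tensorTensorTensorComm (ρ.act X) _ (δ v) x m)

variable {δ} (hδ : IsCoassoc δ) (hc : counitPart δ = LinearMap.id)
  (hl : ∀ r v, hρ.lact δ r v = r • v)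

include hδ hc in
-- This is `v₋₁ right(r) ⊗ v₀ = v₋₁ ⊗ v₀ r` applied to `x`, followed by `v₀ r ⊗ m = v₀ ⊗ r m` in `A
-- ⊗_R M`.
lemma twistTensor_balanced (r : R) (v : A) (x : fiber R X) (m : M) :
    hρ.twistTensor δ X M (v ⊗ₜ (rightMul k X x r ⊗ₜ m)) =
      hρ.twistTensor δ X M (v ⊗ₜ (x ⊗ₜ (r • m))) := by
  rw [twistTensor_tmul, twistTensor_tmul, balancedAt_smul, ← ev_comp_mulRight_right,
    ← LinearMap.map_comp_rTensor, LinearMap.comp_apply, hρ.rTensor_right_coaction hδ hc,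
    ← LinearMap.comp_apply (TensorProduct.map _ _), LinearMap.map_comp_lTensor]

variable (δ X M) in
/-- The map `v ⊗ z ↦ v₋₁ z₁ ⊗ (v₀ ⊗ z₂)` on `A ⊗ (X ⊙ M)`. -/
def twistMap : A ⊗[k] (X ⊙ₗ M : FGModuleCat.{w} R) →ₗ[k]
    (X ⊙ₗ balancedTensor (hρ.ract δ) M : FGModuleCat.{w} R) :=
  hρ.twistTensor δ X M ∘ₗ (pairingSec S X M).lTensor A

include hδ hc in
-- The definition passes through the section attached to `e`; since `twistTensor` is balanced, the
-- insertion of `e` is invisible.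
lemma twistMap_pairing (v : A) (x : fiber R X) (m : M) :
    hρ.twistMap δ X M (v ⊗ₜ pairing k X M (x ⊗ₜ m)) =
      pairing k X _ (TensorProduct.map (ρ.ev X x) (balancedAt (hρ.ract δ) m) (δ v)) := by
  rw [twistMap, LinearMap.comp_apply, LinearMap.lTensor_tmul, pairingSec_pairing,
    ← twistTensor_tmul]
  exact LinearMap.congr_fun (S.comp_split (ρ := rmulHom k (actionFunctor X)) (l := lmulHom k M)
    (g := hρ.twistTensor δ X M ∘ₗ TensorProduct.mk k A _ v) (lmulHom_one M) (lmulHom_mul M)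
    (fun r x m => hρ.twistTensor_balanced hδ hc r v x m)) (x ⊗ₜ m)

include hδ hl in
lemma coaction_smul (r : R) (v : A) :
    δ (r • v) = (LinearMap.mulLeft k (ρ.left r)).rTensor _ (δ v) := by
  rw [← hl, hρ.coaction_lact hδ]

include hδ hc hl in
lemma twistMap_smul (r : R) (v : A) (z : (X ⊙ₗ M : FGModuleCat.{w} R)) :
    hρ.twistMap δ X M ((r • v) ⊗ₜ z) = r • hρ.twistMap δ X M (v ⊗ₜ z) := by
  obtain ⟨t, rfl⟩ := pairing_surjective k X M z
  induction t with
  | zero => simp only [map_zero, TensorProduct.tmul_zero, smul_zero]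
  | add a b ha hb => simp only [map_add, TensorProduct.tmul_add, smul_add, ha, hb]
  | tmul x m =>
    rw [hρ.twistMap_pairing hδ hc, hρ.twistMap_pairing hδ hc, hρ.coaction_smul hδ hl,
      ← LinearMap.comp_apply (TensorProduct.map _ _), LinearMap.map_comp_rTensor,
      ev_comp_mulLeft_left, ← LinearMap.rTensor_comp_map, LinearMap.comp_apply,
      pairing_rTensor_lmulHom]

include hδ hc in
-- The right action multiplies `v₋₁` on the right by `left r`, so evaluating the result at `x` is
-- evaluating `v₋₁` at `r x`.
lemma twistMap_ract (r : R) (v : A) (z : (X ⊙ₗ M : FGModuleCat.{w} R)) :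
    hρ.twistMap δ X M (hρ.ract δ r v ⊗ₜ z) = hρ.twistMap δ X M (v ⊗ₜ (r • z)) := by
  obtain ⟨t, rfl⟩ := pairing_surjective k X M z
  induction t with
  | zero => simp only [map_zero, TensorProduct.tmul_zero, smul_zero]
  | add a b ha hb => simp only [map_add, TensorProduct.tmul_add, smul_add, ha, hb]
  | tmul x m =>
    rw [← pairing_smul, hρ.twistMap_pairing hδ hc, hρ.twistMap_pairing hδ hc,
      hρ.coaction_ract hδ, ← LinearMap.comp_apply (TensorProduct.map _ _),
      LinearMap.map_comp_rTensor, ev_comp_mulRight_left]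

variable (X M) in
/-- The structure morphism `A ⊗_R (X ⊙ M) ⟶ X ⊙ (A ⊗_R M)`. -/
def twistHom : balancedTensor (hρ.ract δ) (X ⊙ₗ M) ⟶ X ⊙ₗ balancedTensor (hρ.ract δ) M :=
  balancedDesc (hρ.twistMap δ X M) (hρ.twistMap_smul hδ hc hl) (hρ.twistMap_ract hδ hc)

lemma twistHom_proj (v : A) (x : fiber R X) (m : M) :
    linMap (k := k) (hρ.twistHom X M hδ hc hl)
      (balancedProj (hρ.ract δ) (X ⊙ₗ M) (v ⊗ₜ pairing k X M (x ⊗ₜ m))) =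
      pairing k X _ (TensorProduct.map (ρ.ev X x) (balancedAt (hρ.ract δ) m) (δ v)) :=
  (balancedDesc_proj _).trans (hρ.twistMap_pairing hδ hc v x m)

omit hδ hc hl in
include hρ in
lemma balancedTensor_action_hom_ext
    {f g : balancedTensor (hρ.ract δ) (X ⊙ₗ M) ⟶ N}
    (h : ∀ v x m, linMap (k := k) f
      (balancedProj (hρ.ract δ) (X ⊙ₗ M) (v ⊗ₜ pairing k X M (x ⊗ₜ m))) = linMap (k := k) g
        (balancedProj (hρ.ract δ) (X ⊙ₗ M) (v ⊗ₜ pairing k X M (x ⊗ₜ m)))) : f = g := by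
  refine balancedTensor_hom_ext (k := k) fun v z => ?_
  obtain ⟨t, rfl⟩ := pairing_surjective k X M z
  induction t with
  | zero => simp only [map_zero, TensorProduct.tmul_zero]
  | add a b ha hb => simp only [map_add, TensorProduct.tmul_add, ha, hb]
  | tmul x m => exact h v x m

lemma twistHom_naturality_left (f : X ⟶ Y) (M : FGModuleCat.{w} R) :
    balancedMap (hρ.ract δ) (f ⊵ₗ M) ≫ hρ.twistHom Y M hδ hc hl =
      hρ.twistHom X M hδ hc hl ≫ f ⊵ₗ balancedTensor (hρ.ract δ) M :=
  hρ.balancedTensor_action_hom_ext fun v x m => by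
    rw [linMap_comp, linMap_comp, balancedMap_proj, pairing_mapLeft, twistHom_proj, twistHom_proj,
      ← pairing_rTensor, ev_fiberMap, ← LinearMap.comp_apply (LinearMap.rTensor _ _),
      LinearMap.rTensor_comp_map]

lemma twistHom_naturality_right (X : C) (f : M ⟶ N) :
    balancedMap (hρ.ract δ) (X ⊴ₗ f) ≫ hρ.twistHom X N hδ hc hl =
      hρ.twistHom X M hδ hc hl ≫ X ⊴ₗ balancedMap (hρ.ract δ) f :=
  hρ.balancedTensor_action_hom_ext fun v x m => by
    rw [linMap_comp, linMap_comp, balancedMap_proj, pairing_map, twistHom_proj, twistHom_proj,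
      ← pairing_lTensor, ← linMap_balancedMap_comp_balancedAt,
      ← LinearMap.comp_apply (LinearMap.lTensor _ _), LinearMap.lTensor_comp_map]

/-- Both composites evaluate the two `H`-legs of an iterated coaction at `x` and `y`, in one case
through `Δ` and in the other through `δ` again. Coassociativity identifies them. -/
lemma twistHom_associativity (X Y : C) (M : FGModuleCat.{w} R) :
    hρ.twistHom (X ⊗ Y) M hδ hc hl ≫ (αₗ X Y (balancedTensor (hρ.ract δ) M)).hom =
      balancedMap (hρ.ract δ) (αₗ X Y M).hom ≫ hρ.twistHom X (Y ⊙ₗ M) hδ hc hl ≫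
        X ⊴ₗ hρ.twistHom Y M hδ hc hl :=
  hρ.balancedTensor_action_hom_ext fun v z m => by
    obtain ⟨t, rfl⟩ := fiberMul_surjective S X Y z
    induction t with
    | zero => simp only [map_zero, TensorProduct.tmul_zero, TensorProduct.zero_tmul]
    | add a b ha hb =>
      simp only [map_add, TensorProduct.tmul_add, TensorProduct.add_tmul, ha, hb]
    | tmul x y =>
      rw [linMap_comp, linMap_comp, linMap_comp, twistHom_proj, balancedMap_proj, pairing_assoc,
        twistHom_proj, pairing_assoc_fiberSec S, ← pairing_lTensor]
      have h1 : linMap (k := k) (hρ.twistHom Y M hδ hc hl) ∘ₗ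
          balancedAt (hρ.ract δ) (pairing k Y M (y ⊗ₜ m)) = pairing k Y _ ∘ₗ
            TensorProduct.map (ρ.ev Y y) (balancedAt (hρ.ract δ) m) ∘ₗ δ :=
        LinearMap.ext fun v => hρ.twistHom_proj hδ hc hl v y m
      rw [← LinearMap.comp_apply (LinearMap.lTensor _ (linMap _)), LinearMap.lTensor_comp_map, h1,
        ← map_rTensor_of_comp (f := TensorProduct.map (ρ.ev X x) (ρ.ev Y y))
          (q := ρ.ev (X ⊗ Y) (fiberMul k X Y (x ⊗ₜ y))) (s := fiberSec S X Y)
          (fun h => hρ.isComul h X Y x y), ← map_map_assoc]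
      have h2 : TensorProduct.assoc k H H A
          ((Coalgebra.comul (R := k) (A := H)).rTensor A (δ v)) = δ.lTensor H (δ v) :=
        (LinearMap.congr_fun hδ v).symm
      rw [h2, ← LinearMap.comp_apply (LinearMap.lTensor _ (pairing k Y _)),
        LinearMap.lTensor_comp_map, ← LinearMap.comp_apply (TensorProduct.map _ _),
        LinearMap.map_comp_lTensor, LinearMap.comp_assoc]

include hδ hc hl in
-- The claim is `v₋₁(1) v₀ = v`. Write `v = ε(v₋₁) v₀` and replace `δ(v)` by its expansion from
-- `sum_map_lact`: the scalar becomes `φ(v₋₁(1) a)`, the vector `b v₀`, and `∑ φ(r a) b = r`.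
lemma lift_unitVal_coaction (v : A) : TensorProduct.lift (lmulHom k A)
    ((unitVal k C ∘ₗ ρ.ev _ (unitElem R C)).rTensor A (δ v)) = v := by
  have h1 := hρ.sum_map_lact hδ hc v
  have h2 : TensorProduct.lid k A ((Coalgebra.counit (R := k) (A := H)).rTensor A (δ v)) = v :=
    LinearMap.congr_fun hc v
  conv_rhs => rw [← h2, ← h1]
  generalize δ v = t
  induction t with
  | zero => simp
  | add a b ha hb => simp only [map_add, Finset.sum_add_distrib, ha, hb]
  | tmul h v =>
    simp only [map_sum, TensorProduct.map_tmul, LinearMap.rTensor_tmul, TensorProduct.lid_tmul,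
      LinearMap.mulLeft_apply, hρ.counit_apply, ρ.act_mul, ρ.act_right, unitVal_rightMul, hl,
      TensorProduct.lift.tmul, LinearMap.comp_apply, ev_apply, lmulHom_apply, ← smul_assoc]
    rw [← Finset.sum_smul, S.sum_form_mul]

/-- After composing with the unit isomorphism, the statement is `v₋₁(1) v₀ = v` tensored with `m`.
-/
lemma twistHom_unitality_inv (M : FGModuleCat.{w} R) :
    (λₗ[C] (balancedTensor (hρ.ract δ) M)).inv =
      balancedMap (hρ.ract δ) (λₗ[C] M).inv ≫ hρ.twistHom (𝟙_ C) M hδ hc hl := by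
  rw [← cancel_mono (λₗ[C] (balancedTensor (hρ.ract δ) M)).hom, Iso.inv_hom_id, eq_comm]
  refine balancedTensor_hom_ext (k := k) fun v m => ?_
  rw [linMap_comp, linMap_comp, balancedMap_proj, actionUnitIso_inv_eq_pairing, twistHom_proj,
    unit_pairing_tensor, ← LinearMap.comp_apply (LinearMap.rTensor _ _),
    LinearMap.rTensor_comp_map, ← LinearMap.lTensor_comp_rTensor, LinearMap.comp_apply,
    lift_lmulHom_lTensor (balancedAt (hρ.ract δ) m) (fun r v => balancedProj_smul r v m),
    hρ.lift_unitVal_coaction hδ hc hl, linMap_id]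
  rfl

end FiberRep.IsReconstruction

end Reconstruction

end

/-! ### Essential surjectivity -/

noncomputable section

open MonoidalLeftAction WeakBialgebra

namespace Reconstruction

lemma map_map_apply {k A B D M N P : Type*} [Field k] [AddCommGroup A] [Module k A]
    [AddCommGroup B] [Module k B] [AddCommGroup D] [Module k D] [AddCommGroup M] [Module k M]
    [AddCommGroup N] [Module k N] [AddCommGroup P] [Module k P] (f : B →ₗ[k] D) (g : N →ₗ[k] P)
    (f' : A →ₗ[k] B) (g' : M →ₗ[k] N) (t : A ⊗[k] M) : TensorProduct.map f g
      (TensorProduct.map f' g' t) = TensorProduct.map (f ∘ₗ f') (g ∘ₗ g') t := by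
  rw [TensorProduct.map_comp, LinearMap.comp_apply]

variable {k : Type u} [Field k] {R : Type w} [Ring R] [Algebra k R]
variable {C : Type u₁} [Category.{v₁} C] [Preadditive C] [Linear k C] [MonoidalCategory C]
  [MonoidalLeftAction C (FGModuleCat.{w} R)] [BilinearAction k C (FGModuleCat.{w} R)]

/-- A comodule lives in the universe of `H`, but as a quotient of some `Rⁿ` it has a copy in the
universe of `R`. -/
lemma exists_fgModule_equiv {P : Type*} [AddCommGroup P] [Module k P] [Module R P]
    [IsScalarTower k R P] [FiniteDimensional k P] :
    ∃ (A : FGModuleCat.{w} R) (e : P ≃ₗ[k] A), ∀ (r : R) v, e (r • v) = r • e v := by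
  have _ : Module.Finite R P := Module.Finite.of_restrictScalars_finite k R P
  have _ : Small.{w} P := by
    obtain ⟨n, g, hg⟩ := Module.Finite.exists_fin' R P
    exact small_of_surjective hg
  have _ : Module.Finite R (Shrink.{w} P) := Module.Finite.equiv (Shrink.linearEquiv R P).symm
  obtain ⟨A, ⟨e⟩⟩ : ∃ A : FGModuleCat.{w} R, Nonempty (P ≃ₗ[R] A) :=
    ⟨FGModuleCat.of R (Shrink.{w} P), ⟨(Shrink.linearEquiv R P).symm⟩⟩
  have hk (c : k) (v : P) : e (c • v) = c • e v := by
    rw [← algebraMap_smul R c v, map_smul, algebraMap_smul]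
  exact ⟨A, e.toAddEquiv.toLinearEquiv hk, e.map_smul⟩

namespace FiberRep.IsReconstruction

section

variable {H : Type v} [Ring H] [Algebra k H] {ρ : FiberRep k R C H} [WeakBialgebra k H]
  [IsSemisimpleRing R] [FiniteDimensional k R] {S : SeparabilityIdempotent k R}
  (hρ : ρ.IsReconstruction S)

variable {A : FGModuleCat.{w} R} {δ : A →ₗ[k] H ⊗[k] A} (hδ : IsCoassoc δ)
  (hc : counitPart δ = LinearMap.id) (hl : ∀ r v, hρ.lact δ r v = r • v)

/-- The module endofunctor `M ↦ A ⊗_R M` attached to a comodule. -/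
def tensorFunctor : ModuleEndofunctor k C (FGModuleCat.{w} R) where
  functor := balancedFunctor (hρ.ract δ)
  oplax :=
    { δₗ X M := hρ.twistHom X M hδ hc hl
      δₗ_naturality_left f M := hρ.twistHom_naturality_left hδ hc hl f M
      δₗ_naturality_right X _ _ f := hρ.twistHom_naturality_right hδ hc hl X f
      δₗ_associativity X Y M := hρ.twistHom_associativity hδ hc hl X Y M
      δₗ_unitality_inv M := hρ.twistHom_unitality_inv hδ hc hl M }

/-- The map `A → A ⊗_R R`. -/
def toTensorFunctor : A →ₗ[k] (hρ.tensorFunctor hδ hc hl).functor.obj (regular R) :=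
  balancedAt (hρ.ract δ) (M := regular R) (1 : R)

lemma toTensorFunctor_bijective : Function.Bijective (hρ.toTensorFunctor hδ hc hl) :=
  balancedAt_one_bijective (hρ.ract_one hδ hc) (hρ.ract_mul hδ hc) fun r s v => by
    rw [← hl, ← hl, hρ.lact_ract hδ hc]

lemma toTensorFunctor_smul (r : R) (v : A) :
    hρ.toTensorFunctor hδ hc hl (r • v) = r • hρ.toTensorFunctor hδ hc hl v :=
  balancedProj_smul r v _

lemma twist_toTensorFunctor (v : A) {X : C} (x : fiber R X) :
    twist (hρ.tensorFunctor hδ hc hl) X (hρ.toTensorFunctor hδ hc hl v ⊗ₜ x) =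
      pairing k X _ (TensorProduct.map (ρ.ev X x) (hρ.toTensorFunctor hδ hc hl) (δ v)) := by
  refine Eq.trans ?_ (hρ.twistHom_proj hδ hc hl (M := regular R) v x (1 : R))
  refine congrArg (linMap (k := k) (hρ.twistHom X (regular R) hδ hc hl)) ?_
  refine (balancedMap_proj (orbit R x) v (1 : R)).trans ?_
  refine congrArg (fun z => balancedProj (hρ.ract δ) (X ⊙ₗ regular R) (v ⊗ₜ z)) ?_
  exact (one_smul R x).trans (rightMul_one (k := k) x).symm

/-- By `sum_map_lact`, `δ(v)` is fixed by the insertion of `e`, so the pairing followed by its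
section gives it back. This is why the coaction extracted from `A ⊗_R -` is the original one. -/
lemma pairingSplit_map_ev (v : A) {X : C} (x : fiber R X) :
    pairingSplit S X _ (TensorProduct.map (ρ.ev X x) (hρ.toTensorFunctor hδ hc hl) (δ v)) =
      TensorProduct.map (ρ.ev X x) (hρ.toTensorFunctor hδ hc hl) (δ v) := by
  conv_rhs => rw [← hρ.sum_map_lact hδ hc v]
  rw [pairingSplit, SeparabilityIdempotent.split, LinearMap.sum_apply, map_sum]
  refine Finset.sum_congr rfl fun p _ => ?_
  have h1 : lmulHom k _ p.2 ∘ₗ hρ.toTensorFunctor hδ hc hl =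
      hρ.toTensorFunctor hδ hc hl ∘ₗ hρ.lact δ p.2 := LinearMap.ext fun v => by
    rw [LinearMap.comp_apply, LinearMap.comp_apply, lmulHom_apply, hl, toTensorFunctor_smul]
  rw [map_map_apply, map_map_apply, h1, ev_comp_mulLeft_right]

lemma isColinear_toTensorFunctor {δ' : (hρ.tensorFunctor hδ hc hl).functor.obj (regular R) →ₗ[k]
    H ⊗[k] (hρ.tensorFunctor hδ hc hl).functor.obj (regular R)}
    (hδ' : ρ.IsCoact S (hρ.tensorFunctor hδ hc hl) δ') :
    IsColinear δ δ' (hρ.toTensorFunctor hδ hc hl) :=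
  LinearMap.ext fun v => ρ.tensor_ext fun X x => by
    rw [LinearMap.comp_apply, hδ', twist_toTensorFunctor, pairingSec_pairing,
      pairingSplit_map_ev, LinearMap.comp_apply, ← LinearMap.comp_apply (LinearMap.rTensor _ _),
      LinearMap.rTensor_comp_lTensor]

end

section EssSurj

variable {H : Type v} [Ring H] [Algebra k H] {ρ : FiberRep k R C H} [WeakBialgebra k H]
  [IsSemisimpleRing R] [FiniteDimensional k R] {S : SeparabilityIdempotent k R}
  (hρ : ρ.IsReconstruction S)

include hρ in
/-- The underlying `R`-module of a comodule. -/
lemma exists_module {P : Type*} [AddCommGroup P] [Module k P] [FiniteDimensional k P]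
    {δ : P →ₗ[k] H ⊗[k] P} (hδ : IsCoassoc δ) (hc : counitPart δ = LinearMap.id) :
    ∃ (A : FGModuleCat.{w} R) (e : P ≃ₗ[k] A), ∀ r v, e (hρ.lact δ r v) = r • e v := by
  let f : R →+* Module.End k P :=
    { toFun := hρ.lact δ
      map_one' := hρ.lact_one hδ hc
      map_mul' := hρ.lact_mul hδ hc
      map_zero' := map_zero _
      map_add' := map_add _ }
  let _ : Module R P := Module.compHom P f
  have _ : IsScalarTower k R P := ⟨fun c r v => by
    change hρ.lact δ (c • r) v = c • hρ.lact δ r v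
    rw [map_smul, LinearMap.smul_apply]⟩
  exact exists_fgModule_equiv

end EssSurj

variable {H : Type (max u₁ w)} [Ring H] [Algebra k H] {ρ : FiberRep k R C H} [WeakBialgebra k H]
  [IsSemisimpleRing R] [FiniteDimensional k R] {S : SeparabilityIdempotent k R}
  (hρ : ρ.IsReconstruction S)

/-- Make `V` an `R`-module by its coaction, move it to the universe of `R` as `A`, and take `A ⊗_R
-`. The resulting comodule `A ⊗_R R` is identified with `V` by colinear bijections. -/
instance : hρ.functor.EssSurj where
  mem_essImage V := by
    obtain ⟨A, e, he⟩ := hρ.exists_module V.isCoassoc V.counitPart_eq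
    let δ : A →ₗ[k] H ⊗[k] A := e.toLinearMap.lTensor H ∘ₗ V.coaction ∘ₗ e.symm.toLinearMap
    have h1 : IsColinear V.coaction δ e.toLinearMap := LinearMap.ext fun v => by
      simp only [δ, LinearMap.comp_apply, LinearEquiv.coe_coe, LinearEquiv.symm_apply_apply]
    have hδ : IsCoassoc δ := isCoassoc_of_injective e.symm.injective h1.symm V.isCoassoc
    have hc : counitPart δ = LinearMap.id := LinearMap.ext fun v => e.symm.injective <| by
      have h2 := LinearMap.congr_fun h1.symm.counitPart_comp v
      rw [V.counitPart_eq] at h2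
      exact h2.symm
    -- The action defined by a coaction is natural under colinear maps, so it is transported along
    -- `e` like the module structure.
    have hl : ∀ r v, hρ.lact δ r v = r • v := fun r v => by
      obtain ⟨v, rfl⟩ := e.surjective v
      rw [← he]
      exact leftUnit_natural h1 (hρ.base r) v
    let j := LinearEquiv.ofBijective _ (hρ.toTensorFunctor_bijective hδ hc hl)
    have hj : IsColinear δ (ρ.coact S (hρ.tensorFunctor hδ hc hl)) j.toLinearMap :=
      hρ.isColinear_toTensorFunctor hδ hc hl (ρ.isCoact_coact S _)
    let T := hρ.tensorFunctor hδ hc hl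
    let f : V.carrier ≃ₗ[k] (hρ.comodule T).carrier := (e.trans j).trans (hρ.comoduleEquiv T).symm
    have hf : IsColinear V.coaction (hρ.comodule T).coaction f.toLinearMap :=
      (hρ.isColinear_comoduleEquiv T).symm.comp (hj.comp h1)
    exact ⟨T, ⟨{ hom := ⟨f.symm.toLinearMap, hf.symm⟩
                 inv := ⟨f.toLinearMap, hf⟩
                 hom_inv_id := LeftComodule.hom_ext <| LinearMap.ext f.apply_symm_apply
                 inv_hom_id := LeftComodule.hom_ext <| LinearMap.ext f.symm_apply_apply }⟩⟩

instance : hρ.functor.IsEquivalence where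

end FiberRep.IsReconstruction

end Reconstruction

end

/-! ### Coactions on composites and on the identity functor -/

noncomputable section

open MonoidalLeftAction WeakBialgebra

namespace Reconstruction

variable {k : Type u} [Field k] {R : Type w} [Ring R] [Algebra k R]
variable {C : Type u₁} [Category.{v₁} C] [Preadditive C] [Linear k C] [MonoidalCategory C]
  [MonoidalLeftAction C (FGModuleCat.{w} R)] [BilinearAction k C (FGModuleCat.{w} R)]

namespace FiberRep

variable {H : Type v} [Ring H] [Algebra k H] {ρ : FiberRep k R C H}

lemma ev_mul {X : C} (g h : H) (x : fiber R X) : ρ.ev X x (g * h) = ρ.ev X (ρ.act X h x) g :=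
  ρ.act_mul X g h x

variable [WeakBialgebra k H] [IsSemisimpleRing R] {S : SeparabilityIdempotent k R}
  {T T' : ModuleEndofunctor k C (FGModuleCat.{w} R)}

lemma twist_composition {X : C} (v : T.functor.obj (regular R)) (w : T'.functor.obj (regular R))
    (x : fiber R X) :
    twist (ModuleEndofunctor.composition T T') X (pair k T.functor _ (v ⊗ₜ w) ⊗ₜ x) =
      linMap (k := k) (T.lineator X (T'.functor.obj (regular R)))
        (pair k T.functor _ (v ⊗ₜ twist T' X (w ⊗ₜ x))) := by
  have h1 := pair_map (k := k) (T := T.functor)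
    (T'.functor.map (orbit R x) ≫ T'.lineator X (regular R)) v w
  rw [T.functor.map_comp, linMap_comp] at h1
  exact congrArg (linMap (k := k) (T.lineator X (T'.functor.obj (regular R)))) h1

section

variable {δ : T.functor.obj (regular R) →ₗ[k] H ⊗[k] T.functor.obj (regular R)}
  (hδ : ρ.IsCoact S T δ) {M : FGModuleCat.{w} R} {X : C}

include hδ

/-- The lineator turns `v ⊗ (h x ⊗ w)` into `v₋₁ (h x) ⊗ v₀ w`, and `v₋₁ (h x) = (v₋₁ h) x`. This is
how the product of `H` in the diagonal coaction arises. -/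
lemma IsCoact.lineator_pair_pairing (v : T.functor.obj (regular R)) (x : fiber R X)
    (t : H ⊗[k] M) :
    linMap (k := k) (T.lineator X M)
        (pair k T.functor _ (v ⊗ₜ pairing k X _ ((ρ.ev X x).rTensor _ t))) =
      pairing k X _ (TensorProduct.map (ρ.ev X x) (pair k T.functor M)
        (mulMap k H _ _ (δ v ⊗ₜ t))) := by
  induction t with
  | zero => simp only [map_zero, TensorProduct.tmul_zero]
  | add a b ha hb => simp only [map_add, TensorProduct.tmul_add, ha, hb]
  | tmul h w =>
    rw [LinearMap.rTensor_tmul, lineator_pair, hδ.twist_eq, ev_apply]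
    generalize δ v = s
    induction s with
    | zero => simp only [map_zero, TensorProduct.zero_tmul]
    | add a b ha hb => simp only [map_add, TensorProduct.add_tmul, ha, hb]
    | tmul g v =>
      rw [LinearMap.rTensor_tmul, pairing_map, mulMap_tmul, TensorProduct.map_tmul, ev_mul]
      rfl

/-- The insertion of `e` acts only on the leg coming from `δ(v)`, which is fixed by it
(`sum_map_lact`). -/
lemma IsCoact.pairingSplit_mulMap (hρ : ρ.IsReconstruction S)
    (v : T.functor.obj (regular R)) (x : fiber R X) (t : H ⊗[k] M) :
    pairingSplit S X _ (TensorProduct.map (ρ.ev X x) (pair k T.functor M)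
        (mulMap k H _ _ (δ v ⊗ₜ t))) =
      TensorProduct.map (ρ.ev X x) (pair k T.functor M) (mulMap k H _ _ (δ v ⊗ₜ t)) := by
  induction t with
  | zero => simp only [map_zero, TensorProduct.tmul_zero]
  | add a b ha hb => simp only [map_add, TensorProduct.tmul_add, ha, hb]
  | tmul h w =>
    conv_rhs => rw [← hρ.sum_map_lact (hδ.isCoassoc hρ) (hδ.counitPart_eq hρ) v]
    generalize δ v = s
    rw [TensorProduct.sum_tmul, map_sum, map_sum]
    induction s with
    | zero => simp only [map_zero, TensorProduct.zero_tmul, Finset.sum_const_zero]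
    | add a b ha hb => simp only [map_add, TensorProduct.add_tmul, Finset.sum_add_distrib, ha, hb]
    | tmul g v =>
      rw [mulMap_tmul, TensorProduct.map_tmul, pairingSplit_tmul]
      refine Finset.sum_congr rfl fun p _ => ?_
      rw [TensorProduct.map_tmul, mulMap_tmul, TensorProduct.map_tmul, hδ.lact_apply hρ, pair_smul,
        LinearMap.mulLeft_apply, mul_assoc, ev_apply, ev_apply, ρ.act_mul _ (ρ.right _), ρ.act_right]

end

variable {δ : T.functor.obj (regular R) →ₗ[k] H ⊗[k] T.functor.obj (regular R)}
  {δ' : T'.functor.obj (regular R) →ₗ[k] H ⊗[k] T'.functor.obj (regular R)}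
  {δ₂ : (ModuleEndofunctor.composition T T').functor.obj (regular R) →ₗ[k]
    H ⊗[k] (ModuleEndofunctor.composition T T').functor.obj (regular R)}

/-- Composing the structure morphisms of `T'` and `T` gives the diagonal coaction after pairing; as
the tensor in question is fixed by the splitting, the pairing can be removed. -/
lemma IsCoact.isColinear_pair (hρ : ρ.IsReconstruction S) (hδ : ρ.IsCoact S T δ)
    (hδ' : ρ.IsCoact S T' δ') (hδ₂ : ρ.IsCoact S (ModuleEndofunctor.composition T T') δ₂) :
    IsColinear (tensorCoaction δ δ') δ₂ (pair k T.functor (T'.functor.obj (regular R))) := by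
  refine TensorProduct.ext' fun v w => ρ.tensor_ext fun X x => ?_
  have h1 := (twist_composition v w x).trans ((congrArg (fun z =>
    linMap (k := k) (T.lineator X (T'.functor.obj (regular R))) (pair k T.functor _ (v ⊗ₜ z)))
      (hδ'.twist_eq w X x)).trans (hδ.lineator_pair_pairing v x (δ' w)))
  have h2 := (congrArg (pairingSec S X _) h1).trans ((pairingSec_pairing S _).trans
    (hδ.pairingSplit_mulMap hρ v x (δ' w)))
  rw [← LinearMap.rTensor_comp_lTensor] at h2
  exact (hδ₂ _ X x).trans h2

variable (k R C) in
/-- The identification of `R` with the value at `R` of the identity functor. -/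
def idEquiv : R ≃ₗ[k] (ModuleEndofunctor.idFunctor k C (FGModuleCat.{w} R)).functor.obj
    (regular R) where
  toFun r := r
  invFun r := r
  map_add' _ _ := rfl
  map_smul' c r := Algebra.smul_def (A := R) c r
  left_inv _ := rfl
  right_inv _ := rfl

lemma idEquiv_mul (r s : R) : idEquiv k R C (r * s) = r • idEquiv k R C s := rfl

lemma twist_idFunctor {X : C} (r : R) (x : fiber R X) :
    twist (ModuleEndofunctor.idFunctor k C (FGModuleCat.{w} R)) X (idEquiv k R C r ⊗ₜ x) =
      pairing k X _ ((r • x) ⊗ₜ idEquiv k R C 1) :=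
  (rightMul_one (k := k) (r • x)).symm

/-- The left multiplications `R → H` are colinear. -/
lemma IsCoact.isColinear_left (hρ : ρ.IsReconstruction S)
    {δ : (ModuleEndofunctor.idFunctor k C (FGModuleCat.{w} R)).functor.obj (regular R) →ₗ[k]
      H ⊗[k] (ModuleEndofunctor.idFunctor k C (FGModuleCat.{w} R)).functor.obj (regular R)}
    (hδ : ρ.IsCoact S (ModuleEndofunctor.idFunctor k C (FGModuleCat.{w} R)) δ) :
    IsColinear δ (Coalgebra.comul (R := k) (A := H))
      (ρ.left ∘ₗ (idEquiv k R C).symm.toLinearMap) := by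
  refine LinearMap.ext fun r => ρ.tensor_ext fun X x => ?_
  obtain ⟨r, rfl⟩ := (idEquiv k R C).surjective r
  rw [LinearMap.comp_apply, LinearMap.comp_apply, LinearMap.comp_apply, rTensor_lTensor_apply, hδ,
    twist_idFunctor, pairingSec_pairing, pairingSplit_tmul, LinearEquiv.coe_coe,
    LinearEquiv.symm_apply_apply, ← hρ.coe_base, comul_base_left, hρ.comul_one, Finset.sum_mul,
    map_sum, map_sum]
  refine Finset.sum_congr rfl fun p _ => ?_
  rw [Algebra.TensorProduct.tmul_mul_tmul, mul_one, LinearMap.rTensor_tmul, LinearMap.lTensor_tmul,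
    ev_apply, ρ.act_mul, ρ.act_right, hρ.coe_base, ρ.act_left, LinearMap.comp_apply,
    ← idEquiv_mul, mul_one, LinearEquiv.coe_coe, LinearEquiv.symm_apply_apply]

/-- Tensoring with the inclusion of `H_t` in `H` is injective, so the inverse map can be tested in
`H ⊗ H`, where it is the colinearity of the left multiplications. -/
lemma IsCoact.isColinear_base (hρ : ρ.IsReconstruction S)
    {δ : (ModuleEndofunctor.idFunctor k C (FGModuleCat.{w} R)).functor.obj (regular R) →ₗ[k]
      H ⊗[k] (ModuleEndofunctor.idFunctor k C (FGModuleCat.{w} R)).functor.obj (regular R)}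
    (hδ : ρ.IsCoact S (ModuleEndofunctor.idFunctor k C (FGModuleCat.{w} R)) δ) :
    IsColinear (baseCoaction k H) δ (hρ.base.symm.trans (idEquiv k R C)).toLinearMap := by
  refine IsColinear.symm (f := (hρ.base.symm.trans (idEquiv k R C)).symm) ?_
  refine LinearMap.ext fun r => Module.Flat.lTensor_preserves_injective_linearMap
    (targetBase k H).subtype Subtype.val_injective ?_
  refine (LinearMap.congr_fun (WeakBialgebra.isColinear_base (k := k) (H := H)) _).symm.trans
    ((LinearMap.congr_fun (hδ.isColinear_left hρ) r).trans ?_)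
  rw [LinearMap.comp_apply, LinearMap.comp_apply, ← LinearMap.lTensor_comp_apply]
  rfl

end FiberRep

end Reconstruction

end

/-! ### The monoidal structure of the functor -/

noncomputable section

open MonoidalLeftAction WeakBialgebra

namespace Reconstruction

variable {k : Type u} [Field k] {R : Type w} [Ring R] [Algebra k R]
variable {C : Type u₁} [Category.{v₁} C] [Preadditive C] [Linear k C] [MonoidalCategory C]
  [MonoidalLeftAction C (FGModuleCat.{w} R)] [BilinearAction k C (FGModuleCat.{w} R)]

namespace FiberRep.IsReconstruction

variable {H : Type (max u₁ w)} [Ring H] [Algebra k H] {ρ : FiberRep k R C H} [WeakBialgebra k H]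
  [IsSemisimpleRing R] [FiniteDimensional k R] {S : SeparabilityIdempotent k R}
  (hρ : ρ.IsReconstruction S)
  {T T' T'' : ModuleEndofunctor k C (FGModuleCat.{w} R)}

lemma comoduleEquiv_lact (r : R) (v : (hρ.comodule T).carrier) :
    hρ.comoduleEquiv T (hρ.lact (hρ.comodule T).coaction r v) = r • hρ.comoduleEquiv T v :=
  (leftUnit_natural (hρ.isColinear_comoduleEquiv T) (hρ.base r) v).symm.trans
    ((ρ.isCoact_coact S T).lact_apply hρ r _)

lemma comoduleEquiv_ract (r : R) (v : (hρ.comodule T).carrier) :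
    hρ.comoduleEquiv T (hρ.ract (hρ.comodule T).coaction r v) =
      rmul k T.functor (hρ.comoduleEquiv T v) r :=
  (rightUnit_natural (hρ.isColinear_comoduleEquiv T) (hρ.base r) v).symm.trans
    ((ρ.isCoact_coact S T).ract_apply hρ r _)

lemma tm_lact {V W : LeftComodule k H} (r : R) (v : V.carrier) (w : W.carrier) :
    LeftComodule.tm v (hρ.lact W.coaction r w) = LeftComodule.tm (hρ.ract V.coaction r v) w :=
  LeftComodule.tm_triangle (hρ.base r) v w

/-- The product `⊠` is balanced over `R` by `tm_lact`, so the two legs of `e` meet on one side and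
`∑ a b = 1`. -/
lemma sum_tm_ract_lact {V W : LeftComodule k H} (v : V.carrier) (w : W.carrier) :
    ∑ p ∈ S.support, LeftComodule.tm (hρ.ract V.coaction p.1 v) (hρ.lact W.coaction p.2 w) =
      LeftComodule.tm v w := by
  let f : R →ₗ[k] (LeftComodule.tensor V W).carrier := LeftComodule.proj V W ∘ₗ
    (TensorProduct.mk k _ _).flip w ∘ₗ LinearMap.applyₗ v ∘ₗ hρ.ract V.coaction
  have h (p : R × R) : LeftComodule.tm (hρ.ract V.coaction p.1 v) (hρ.lact W.coaction p.2 w) =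
      f (p.1 * p.2) := by
    rw [tm_lact, ← Module.End.mul_apply, ← hρ.ract_mul V.isCoassoc V.counitPart_eq]
    rfl
  simp only [h]
  rw [← map_sum, S.sum_mul]
  change LeftComodule.tm (hρ.ract V.coaction 1 v) w = _
  rw [hρ.ract_one V.isCoassoc V.counitPart_eq]
  rfl

variable (T T') in
/-- The map `v ⊗ w ↦ v ⊗ w` from `T(R) ⊗ T'(R)` to `(T ∘ T')(R)`. -/
def tensorHomAux : (hρ.comodule T).carrier ⊗[k] (hρ.comodule T').carrier →ₗ[k]
    (hρ.comodule (T ⊗ T')).carrier :=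
  (hρ.comoduleEquiv (T ⊗ T')).symm.toLinearMap ∘ₗ
    pair k T.functor (T'.functor.obj (regular R)) ∘ₗ
      TensorProduct.map (hρ.comoduleEquiv T).toLinearMap (hρ.comoduleEquiv T').toLinearMap

lemma isColinear_tensorHomAux :
    IsColinear (tensorCoaction (hρ.comodule T).coaction (hρ.comodule T').coaction)
      (hρ.comodule (T ⊗ T')).coaction (hρ.tensorHomAux T T') :=
  (hρ.isColinear_comoduleEquiv _).symm.comp
    (((ρ.isCoact_coact S T).isColinear_pair hρ (ρ.isCoact_coact S T')
      (ρ.isCoact_coact S (T ⊗ T'))).comp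
      ((hρ.isColinear_comoduleEquiv T).map (hρ.isColinear_comoduleEquiv T')))

variable (T T') in
/-- The tensorator. -/
def tensorHom : LeftComodule.tensor (hρ.comodule T) (hρ.comodule T') ⟶ hρ.comodule (T ⊗ T') where
  toLinearMap := LeftComodule.desc (hρ.tensorHomAux T T')
  colinear := LeftComodule.colinear_desc hρ.isColinear_tensorHomAux

lemma comoduleEquiv_tensorHom (v : (hρ.comodule T).carrier) (w : (hρ.comodule T').carrier) :
    hρ.comoduleEquiv (T ⊗ T') ((hρ.tensorHom T T').toLinearMap (LeftComodule.tm v w)) =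
      pair k T.functor (T'.functor.obj (regular R))
        (hρ.comoduleEquiv T v ⊗ₜ hρ.comoduleEquiv T' w) :=
  congrArg (hρ.comoduleEquiv (T ⊗ T')) (LeftComodule.desc_tm hρ.isColinear_tensorHomAux v w)

variable (T T') in
/-- The inverse of the tensorator. -/
def tensorInv : (hρ.comodule (T ⊗ T')).carrier →ₗ[k]
    (LeftComodule.tensor (hρ.comodule T) (hρ.comodule T')).carrier :=
  LeftComodule.proj _ _ ∘ₗ TensorProduct.map (hρ.comoduleEquiv T).symm.toLinearMap
    (hρ.comoduleEquiv T').symm.toLinearMap ∘ₗ sec S T.functor (T'.functor.obj (regular R)) ∘ₗ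
      (hρ.comoduleEquiv (T ⊗ T')).toLinearMap

/-- The section of `pair` replaces `v ⊗ w` by `∑ v a ⊗ b w`, and this has the same image in `⊠` as
`v ⊗ w`. -/
lemma tensorInv_tensorHom :
    hρ.tensorInv T T' ∘ₗ (hρ.tensorHom T T').toLinearMap = LinearMap.id := by
  refine LeftComodule.tensor_ext fun v w => ?_
  have h1 := congrArg (sec S T.functor (T'.functor.obj (regular R)))
    (hρ.comoduleEquiv_tensorHom v w)
  rw [sec_pair_tmul] at h1
  refine (congrArg (fun t => LeftComodule.proj _ _ (TensorProduct.map
    (hρ.comoduleEquiv T).symm.toLinearMap (hρ.comoduleEquiv T').symm.toLinearMap t)) h1).trans ?_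
  rw [map_sum, map_sum]
  refine (Finset.sum_congr rfl fun p _ => ?_).trans (hρ.sum_tm_ract_lact v w)
  rw [TensorProduct.map_tmul, ← comoduleEquiv_ract, ← comoduleEquiv_lact]
  rfl

lemma tensorHom_proj (t : (hρ.comodule T).carrier ⊗[k] (hρ.comodule T').carrier) :
    (hρ.tensorHom T T').toLinearMap (LeftComodule.proj _ _ t) = hρ.tensorHomAux T T' t :=
  LinearMap.congr_fun (TensorProduct.ext' (g := (hρ.tensorHom T T').toLinearMap ∘ₗ
    LeftComodule.proj _ _) (h := hρ.tensorHomAux T T')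
      fun v w => LeftComodule.desc_tm hρ.isColinear_tensorHomAux v w) t

lemma comoduleEquiv_tensorHomAux (t : T.functor.obj (regular R) ⊗[k] T'.functor.obj (regular R)) :
    hρ.comoduleEquiv (T ⊗ T') (hρ.tensorHomAux T T' (TensorProduct.map
      (hρ.comoduleEquiv T).symm.toLinearMap (hρ.comoduleEquiv T').symm.toLinearMap t)) =
      pair k T.functor (T'.functor.obj (regular R)) t := by
  refine (congrArg (pair k T.functor (T'.functor.obj (regular R))) (map_map_apply _ _ _ _ t)).trans ?_
  rw [LinearEquiv.comp_symm, LinearEquiv.comp_symm, TensorProduct.map_id, LinearMap.id_apply]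

lemma tensorHom_tensorInv :
    (hρ.tensorHom T T').toLinearMap ∘ₗ hρ.tensorInv T T' = LinearMap.id := by
  refine LinearMap.ext fun v => (hρ.comoduleEquiv (T ⊗ T')).injective ?_
  refine (congrArg (hρ.comoduleEquiv (T ⊗ T')) (hρ.tensorHom_proj _)).trans ?_
  exact (hρ.comoduleEquiv_tensorHomAux _).trans (pair_sec S _)

variable (T T') in
/-- The tensorator as an isomorphism. -/
def tensorIso : hρ.functor.obj T ⊗ hρ.functor.obj T' ≅ hρ.functor.obj (T ⊗ T') :=
  LeftComodule.isoOfInverse (hρ.tensorHom T T') (hρ.tensorInv T T') hρ.tensorInv_tensorHom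
    hρ.tensorHom_tensorInv

/-- The map `z ↦ z` from the unit comodule to `R`. -/
def unitEquiv : targetBase k H ≃ₗ[k]
    (hρ.comodule (𝟙_ (ModuleEndofunctor k C (FGModuleCat.{w} R)))).carrier :=
  (hρ.base.symm.trans (idEquiv k R C)).trans (hρ.comoduleEquiv _).symm

lemma isColinear_unitEquiv : IsColinear (baseCoaction k H)
    (hρ.comodule (𝟙_ (ModuleEndofunctor k C (FGModuleCat.{w} R)))).coaction
      hρ.unitEquiv.toLinearMap :=
  (hρ.isColinear_comoduleEquiv _).symm.comp ((ρ.isCoact_coact S _).isColinear_base hρ)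

/-- The comparison of the units. -/
def unitHom : LeftComodule.unit k H ⟶
    hρ.comodule (𝟙_ (ModuleEndofunctor k C (FGModuleCat.{w} R))) :=
  ⟨hρ.unitEquiv.toLinearMap, hρ.isColinear_unitEquiv⟩

/-- The comparison of the units, as an isomorphism. -/
def unitIso : 𝟙_ (LeftComodule k H) ≅ hρ.functor.obj (𝟙_ (ModuleEndofunctor k C _)) :=
  LeftComodule.isoOfInverse hρ.unitHom hρ.unitEquiv.symm.toLinearMap
    (LinearMap.ext hρ.unitEquiv.symm_apply_apply) (LinearMap.ext hρ.unitEquiv.apply_symm_apply)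

/-- The morphism of comodules attached to a morphism of module functors. -/
def comoduleMap (f : T ⟶ T') : hρ.comodule T ⟶ hρ.comodule T' := hρ.functor.map f

lemma comoduleEquiv_comoduleMap (f : T ⟶ T') (v : (hρ.comodule T).carrier) :
    hρ.comoduleEquiv T' ((hρ.comoduleMap f).toLinearMap v) =
      linMap (k := k) (f.natTrans.app (regular R)) (hρ.comoduleEquiv T v) := rfl

lemma tensorHom_natural {T₁ T₂ T₁' T₂' : ModuleEndofunctor k C (FGModuleCat.{w} R)} (f : T₁ ⟶ T₂)
    (g : T₁' ⟶ T₂') :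
    LeftComodule.map (hρ.comoduleMap f) (hρ.comoduleMap g) ≫ hρ.tensorHom T₂ T₂' =
      hρ.tensorHom T₁ T₁' ≫ hρ.comoduleMap (f ⊗ₘ g) := by
  refine LeftComodule.hom_ext (LeftComodule.tensor_ext fun v w =>
    (hρ.comoduleEquiv (T₂ ⊗ T₂')).injective ?_)
  rw [LeftComodule.comp_toLinearMap, LinearMap.comp_apply, LeftComodule.map_tm,
    LeftComodule.comp_toLinearMap, LinearMap.comp_apply, comoduleEquiv_tensorHom,
    comoduleEquiv_comoduleMap, comoduleEquiv_comoduleMap, comoduleEquiv_comoduleMap,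
    comoduleEquiv_tensorHom, ← pair_map, ← pair_natTrans]
  rfl

lemma comoduleMap_id : hρ.comoduleMap (𝟙 T) = 𝟙 _ := hρ.functor.map_id T

lemma comoduleEquiv_associator (v : (hρ.comodule ((T ⊗ T') ⊗ T'')).carrier) :
    hρ.comoduleEquiv _ ((hρ.comoduleMap (α_ T T' T'').hom).toLinearMap v) =
      hρ.comoduleEquiv _ v := rfl

lemma pair_pair_tmul (F G : FGModuleCat.{w} R ⥤ FGModuleCat.{w} R) [IsLinearFunctor k F]
    [IsLinearFunctor k G] {M : FGModuleCat.{w} R} (v : F.obj (regular R)) (w : G.obj (regular R))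
    (m : M) :
    linMap (k := k) ((G ⋙ F).map (orbit R m)) (pair k F (G.obj (regular R)) (v ⊗ₜ w)) =
      pair k F (G.obj M) (v ⊗ₜ pair k G M (w ⊗ₜ m)) :=
  pair_map (G.map (orbit R m)) v w

/-- On `v ⊠ w ⊠ u` both sides are the iterated pairing of `v`, `w`, `u`, since the associator of
module functors has identity components. The identity left over is the naturality of `pair` in the
module variable. -/
lemma tensorHom_associativity :
    LeftComodule.map (hρ.tensorHom T T') (𝟙 (hρ.comodule T'')) ≫ hρ.tensorHom (T ⊗ T') T'' ≫
        hρ.comoduleMap (α_ T T' T'').hom =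
      (LeftComodule.assocIso _ _ _).hom ≫
        LeftComodule.map (𝟙 (hρ.comodule T)) (hρ.tensorHom T' T'') ≫ hρ.tensorHom T (T' ⊗ T'') := by
  refine LeftComodule.hom_ext (LeftComodule.tensor_ext_left fun v w u =>
    (hρ.comoduleEquiv (T ⊗ T' ⊗ T'')).injective ?_)
  simp only [LeftComodule.comp_toLinearMap, LinearMap.comp_apply, LeftComodule.map_tm,
    LeftComodule.assocIso_hom_tm, LeftComodule.id_toLinearMap, LinearMap.id_apply]
  rw [comoduleEquiv_tensorHom, comoduleEquiv_tensorHom, comoduleEquiv_associator,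
    comoduleEquiv_tensorHom, pair_tmul, comoduleEquiv_tensorHom]
  exact pair_pair_tmul T.functor T'.functor _ _ _

lemma comoduleEquiv_unitEquiv_base (r : R) :
    hρ.comoduleEquiv _ (hρ.unitEquiv (hρ.base r)) = idEquiv k R C r :=
  congrArg (idEquiv k R C) (hρ.base.symm_apply_apply r)

lemma comoduleEquiv_leftUnitor (v : (hρ.comodule (𝟙_ _ ⊗ T)).carrier) :
    hρ.comoduleEquiv _ ((hρ.comoduleMap (λ_ T).hom).toLinearMap v) = hρ.comoduleEquiv _ v := rfl

lemma comoduleEquiv_rightUnitor (v : (hρ.comodule (T ⊗ 𝟙_ _)).carrier) :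
    hρ.comoduleEquiv _ ((hρ.comoduleMap (ρ_ T).hom).toLinearMap v) = hρ.comoduleEquiv _ v := rfl

/-- An element of `H_t` is `left r` for some `r`. The unitor of comodules acts by `r` through the
coaction, and the tensorator multiplies by `r` in `T(R)`; the two actions coincide. The right unitor
is treated likewise with the right action. -/
lemma tensorHom_left_unitality :
    (LeftComodule.leftUnitIso (hρ.comodule T)).hom =
      LeftComodule.map hρ.unitHom (𝟙 (hρ.comodule T)) ≫
        hρ.tensorHom (𝟙_ _) T ≫ hρ.comoduleMap (λ_ T).hom := by
  refine LeftComodule.hom_ext (LeftComodule.tensor_ext (V := LeftComodule.unit k H) fun z v =>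
    (hρ.comoduleEquiv T).injective ?_)
  rw [LeftComodule.comp_toLinearMap, LeftComodule.comp_toLinearMap, LinearMap.comp_apply,
    LinearMap.comp_apply, LeftComodule.map_tm, comoduleEquiv_leftUnitor, comoduleEquiv_tensorHom,
    pair_tmul]
  obtain ⟨r, rfl⟩ := hρ.base.surjective z
  refine (congrArg (hρ.comoduleEquiv T) (LeftComodule.leftUnitIso_hom_tm _ v)).trans ?_
  refine (hρ.comoduleEquiv_lact r v).trans ?_
  exact congrArg (fun a => (idEquiv k R C).symm a • hρ.comoduleEquiv T v)
    (hρ.comoduleEquiv_unitEquiv_base r).symm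

lemma tensorHom_right_unitality :
    (LeftComodule.rightUnitIso (hρ.comodule T)).hom =
      LeftComodule.map (𝟙 (hρ.comodule T)) hρ.unitHom ≫
        hρ.tensorHom T (𝟙_ _) ≫ hρ.comoduleMap (ρ_ T).hom := by
  refine LeftComodule.hom_ext (LeftComodule.tensor_ext (W := LeftComodule.unit k H) fun v z =>
    (hρ.comoduleEquiv T).injective ?_)
  rw [LeftComodule.comp_toLinearMap, LeftComodule.comp_toLinearMap, LinearMap.comp_apply,
    LinearMap.comp_apply, LeftComodule.map_tm, comoduleEquiv_rightUnitor, comoduleEquiv_tensorHom,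
    pair_tmul]
  obtain ⟨r, rfl⟩ := hρ.base.surjective z
  refine (congrArg (hρ.comoduleEquiv T) (LeftComodule.rightUnitIso_hom_tm v _)).trans ?_
  refine (hρ.comoduleEquiv_ract r v).trans ?_
  exact congrArg (fun a => rmul k T.functor (hρ.comoduleEquiv T v) ((idEquiv k R C).symm a))
    (hρ.comoduleEquiv_unitEquiv_base r).symm

/-- The monoidal structure of the functor. -/
def coreMonoidal : hρ.functor.CoreMonoidal where
  εIso := hρ.unitIso
  μIso T T' := hρ.tensorIso T T'
  μIso_hom_natural_left f _ := by
    refine Eq.trans ?_ ((hρ.tensorHom_natural f (𝟙 _)).trans ?_)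
    · rw [comoduleMap_id]
      rfl
    · rw [tensorHom_id]
      rfl
  μIso_hom_natural_right _ f := by
    refine Eq.trans ?_ ((hρ.tensorHom_natural (𝟙 _) f).trans ?_)
    · rw [comoduleMap_id]
      rfl
    · rw [id_tensorHom]
      rfl
  associativity _ _ _ := hρ.tensorHom_associativity
  left_unitality _ := hρ.tensorHom_left_unitality
  right_unitality _ := hρ.tensorHom_right_unitality

end FiberRep.IsReconstruction

end Reconstruction

end

/-! ### Existence of a nondegenerate separability idempotent -/

noncomputable section

namespace SeparabilityIdempotent

variable {k : Type u} [Field k]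

/-- Transport of a separability idempotent along an isomorphism of algebras. -/
def transport {A : Type v} {B : Type w} [Ring A] [Algebra k A] [Ring B] [Algebra k B]
    (S : SeparabilityIdempotent k A) (f : A ≃ₐ[k] B) : SeparabilityIdempotent k B where
  idem := Algebra.TensorProduct.map f.toAlgHom f.toAlgHom S.idem
  form := S.form ∘ₗ f.symm.toLinearMap
  mul_idem := by
    have h : ∀ t, LinearMap.mul' k B (Algebra.TensorProduct.map f.toAlgHom f.toAlgHom t) =
        f (LinearMap.mul' k A t) := fun t => by
      induction t with
      | zero => simp
      | add a b ha hb => simp only [map_add, ha, hb]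
      | tmul a b => simp
    rw [h, S.mul_idem, map_one]
  comm r := by
    have h := congrArg (Algebra.TensorProduct.map f.toAlgHom f.toAlgHom) (S.comm (f.symm r))
    simpa only [map_mul, Algebra.TensorProduct.map_tmul, map_one, AlgEquiv.coe_toAlgHom,
      AlgEquiv.apply_symm_apply] using h
  form_left := by
    have h : ∀ t, TensorProduct.lid k B ((S.form ∘ₗ f.symm.toLinearMap).rTensor B
        (Algebra.TensorProduct.map f.toAlgHom f.toAlgHom t)) =
        f (TensorProduct.lid k A (S.form.rTensor A t)) := fun t => by
      induction t with
      | zero => simp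
      | add a b ha hb => simp only [map_add, ha, hb]
      | tmul a b => simp
    rw [h, S.form_left, map_one]
  form_right := by
    have h : ∀ t, TensorProduct.rid k B ((S.form ∘ₗ f.symm.toLinearMap).lTensor B
        (Algebra.TensorProduct.map f.toAlgHom f.toAlgHom t)) =
        f (TensorProduct.rid k A (S.form.lTensor A t)) := fun t => by
      induction t with
      | zero => simp
      | add a b ha hb => simp only [map_add, ha, hb]
      | tmul a b => simp
    rw [h, S.form_right, map_one]

lemma sum_form_single {ι : Type*} [Fintype ι] [DecidableEq ι] {A : ι → Type v} [∀ i, Ring (A i)]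
    [∀ i, Algebra k (A i)] (S : ∀ i, SeparabilityIdempotent k (A i)) (i : ι) (a : A i) :
    (∑ i, (S i).form ∘ₗ LinearMap.proj i) (Pi.single i a) = (S i).form a := by
  rw [LinearMap.sum_apply, Finset.sum_eq_single i]
  · simp
  · intro j _ h
    simp [Pi.single_eq_of_ne h]
  · simp

/-- The separability idempotent of a finite product. -/
def pi {ι : Type*} [Fintype ι] [DecidableEq ι] {A : ι → Type v} [∀ i, Ring (A i)]
    [∀ i, Algebra k (A i)] (S : ∀ i, SeparabilityIdempotent k (A i)) :
    SeparabilityIdempotent k (∀ i, A i) where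
  idem := ∑ i, TensorProduct.map (LinearMap.single k A i) (LinearMap.single k A i) (S i).idem
  form := ∑ i, (S i).form ∘ₗ LinearMap.proj i
  mul_idem := by
    have h (i) : ∀ t, LinearMap.mul' k (∀ i, A i) (TensorProduct.map (LinearMap.single k A i)
        (LinearMap.single k A i) t) = Pi.single i (LinearMap.mul' k (A i) t) := fun t => by
      induction t with
      | zero => simp
      | add a b ha hb => simp only [map_add, ha, hb, Pi.single_add]
      | tmul a b => simp [Pi.single_mul]
    rw [map_sum]
    simp only [h, mul_idem]
    exact Finset.univ_sum_single 1
  comm r := by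
    have h1 (i) : ∀ t, (r ⊗ₜ[k] (1 : ∀ i, A i)) * TensorProduct.map (LinearMap.single k A i)
        (LinearMap.single k A i) t = TensorProduct.map (LinearMap.single k A i)
          (LinearMap.single k A i) ((r i ⊗ₜ 1) * t) := fun t => by
      induction t with
      | zero => simp
      | add a b ha hb => simp only [map_add, mul_add, ha, hb]
      | tmul a b => simp [Pi.single_mul_right]
    have h2 (i) : ∀ t, TensorProduct.map (LinearMap.single k A i)
        (LinearMap.single k A i) t * ((1 : ∀ i, A i) ⊗ₜ[k] r) =
          TensorProduct.map (LinearMap.single k A i)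
          (LinearMap.single k A i) (t * (1 ⊗ₜ r i)) := fun t => by
      induction t with
      | zero => simp
      | add a b ha hb => simp only [map_add, add_mul, ha, hb]
      | tmul a b => simp [Pi.single_mul_left]
    rw [Finset.mul_sum, Finset.sum_mul]
    simp only [h1, h2, (S _).comm]
  form_left := by
    have h (i) : ∀ t, TensorProduct.lid k (∀ i, A i) (LinearMap.rTensor (∀ i, A i)
        (∑ i, (S i).form ∘ₗ LinearMap.proj i) (TensorProduct.map (LinearMap.single k A i)
          (LinearMap.single k A i) t)) =
        Pi.single i (TensorProduct.lid k (A i) ((S i).form.rTensor (A i) t)) := fun t => by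
      induction t with
      | zero => simp
      | add a b ha hb => simp only [map_add, ha, hb, Pi.single_add]
      | tmul a b =>
        rw [TensorProduct.map_tmul, LinearMap.rTensor_tmul, LinearMap.single_apply,
          sum_form_single, LinearMap.rTensor_tmul, TensorProduct.lid_tmul, TensorProduct.lid_tmul,
          Pi.single_smul, LinearMap.single_apply]
    rw [map_sum, map_sum]
    simp only [h, form_left]
    exact Finset.univ_sum_single 1
  form_right := by
    have h (i) : ∀ t, TensorProduct.rid k (∀ i, A i) (LinearMap.lTensor (∀ i, A i)
        (∑ i, (S i).form ∘ₗ LinearMap.proj i) (TensorProduct.map (LinearMap.single k A i)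
          (LinearMap.single k A i) t)) =
        Pi.single i (TensorProduct.rid k (A i) ((S i).form.lTensor (A i) t)) := fun t => by
      induction t with
      | zero => simp
      | add a b ha hb => simp only [map_add, ha, hb, Pi.single_add]
      | tmul a b =>
        rw [TensorProduct.map_tmul, LinearMap.lTensor_tmul, LinearMap.single_apply,
          LinearMap.single_apply,
          sum_form_single, LinearMap.lTensor_tmul, TensorProduct.rid_tmul, TensorProduct.rid_tmul,
          Pi.single_smul]
    rw [map_sum, map_sum]
    simp only [h, form_right]
    exact Finset.univ_sum_single 1

lemma sum_entry_single {n : Type} [Fintype n] [DecidableEq n] (a : n → k) (j l : n) (c : k) :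
    (∑ j, (a j)⁻¹ • Matrix.entryLinearMap k k j j) (Matrix.single j l c) =
      if j = l then (a j)⁻¹ * c else 0 := by
  simp only [LinearMap.sum_apply, LinearMap.smul_apply, Matrix.entryLinearMap_apply,
    Matrix.single_apply, smul_eq_mul, mul_ite, mul_zero, ite_and, Finset.sum_ite_eq,
    Finset.mem_univ, if_true]
  exact if_congr eq_comm rfl rfl

/-- The separability idempotent `∑ E_{jl} a ⊗ E_{lj}` of a matrix algebra, for an invertible
diagonal matrix `a` of trace `1`. -/
def matrix {n : Type} [Fintype n] [DecidableEq n] (a : n → k) (ha : ∀ i, a i ≠ 0)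
    (hsum : ∑ i, a i = 1) : SeparabilityIdempotent k (Matrix n n k) where
  idem := ∑ j, ∑ l, Matrix.single j l (a l) ⊗ₜ Matrix.single l j 1
  -- `φ(r) = tr(a⁻¹ r)`: the inverse cancels the factor `a` in the first leg of `e`.
  form := ∑ j, (a j)⁻¹ • Matrix.entryLinearMap k k j j
  mul_idem := by
    simp only [map_sum, LinearMap.mul'_apply, Matrix.single_mul_single_same, mul_one]
    rw [← Matrix.sum_single_one]
    refine Finset.sum_congr rfl fun j _ => ?_
    rw [← hsum]
    exact (map_sum (Matrix.singleAddMonoidHom (α := k) j j) a _).symm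
  comm r := by
    induction r using Matrix.induction_on' with
    | h_zero => simp
    | h_add p q hp hq =>
      rw [TensorProduct.add_tmul, TensorProduct.tmul_add, add_mul, mul_add, hp, hq]
    | h_std_basis p q c =>
      simp only [Finset.mul_sum, Finset.sum_mul, Algebra.TensorProduct.tmul_mul_tmul, one_mul, mul_one]
      refine (Finset.sum_eq_single q (fun j _ h => ?_) (by simp)).trans
        (Eq.trans ?_ (Finset.sum_eq_single p (fun j _ h => ?_) (by simp)).symm)
      · refine Finset.sum_eq_zero fun l _ => ?_
        rw [Matrix.single_mul_single_of_ne _ _ _ _ h.symm, TensorProduct.zero_tmul]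
      · refine Finset.sum_congr rfl fun l _ => ?_
        rw [Matrix.single_mul_single_same, Matrix.single_mul_single_same, one_mul,
          ← smul_eq_mul, ← Matrix.smul_single, TensorProduct.smul_tmul, Matrix.smul_single,
          smul_eq_mul, mul_one]
      · refine Finset.sum_eq_zero fun l _ => ?_
        rw [Matrix.single_mul_single_of_ne _ _ _ _ h, TensorProduct.tmul_zero]
  form_left := by
    simp only [map_sum, LinearMap.rTensor_tmul, TensorProduct.lid_tmul, sum_entry_single, ite_smul,
      zero_smul, Finset.sum_ite_eq, Finset.mem_univ, if_true, inv_mul_cancel₀ (ha _), one_smul]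
    exact Matrix.sum_single_one
  form_right := by
    simp only [map_sum, LinearMap.lTensor_tmul, TensorProduct.rid_tmul, sum_entry_single, ite_smul,
      zero_smul, Finset.sum_ite_eq', Finset.mem_univ, if_true, Matrix.smul_single, smul_eq_mul,
      mul_one, inv_mul_cancel₀ (ha _)]
    exact Matrix.sum_single_one

/-- Equal weights `1/n` are not available when the characteristic divides `n`. In an infinite field
one can choose `x` different from `0` and `c`, and then continue with `c - x ≠ 0`. -/
lemma exists_sum_eq [Infinite k] (n : ℕ) : ∀ c : k, c ≠ 0 →
    ∃ a : Fin (n + 1) → k, (∀ i, a i ≠ 0) ∧ ∑ i, a i = c := by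
  induction n with
  | zero => exact fun c hc => ⟨fun _ => c, fun _ => hc, by simp⟩
  | succ n ih =>
    intro c hc
    classical
    obtain ⟨x, hx⟩ := Infinite.exists_notMem_finset (insert 0 (insert c (∅ : Finset k)))
    simp only [Finset.mem_insert, Finset.notMem_empty, or_false, not_or] at hx
    obtain ⟨a, ha, hsum⟩ := ih (c - x) (sub_ne_zero.2 (Ne.symm hx.2))
    refine ⟨Fin.cons x a, fun i => ?_, by rw [Fin.sum_cons, hsum, add_sub_cancel]⟩
    induction i using Fin.cases with
    | zero => exact hx.1
    | succ i => exact ha i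

/-- By Wedderburn over an algebraically closed field, `R` is a finite product of matrix algebras
over `k` itself, so the explicit idempotents suffice. -/
theorem _root_.nonempty_separabilityIdempotent [IsAlgClosed k] (R : Type w) [Ring R] [Algebra k R]
    [FiniteDimensional k R] [IsSemisimpleRing R] : Nonempty (SeparabilityIdempotent k R) := by
  obtain ⟨n, d, hd, ⟨f⟩⟩ := IsSemisimpleRing.exists_algEquiv_pi_matrix_of_isAlgClosed k R
  have h (i : Fin n) : Nonempty (SeparabilityIdempotent k (Matrix (Fin (d i)) (Fin (d i)) k)) := by
    obtain ⟨m, hm⟩ := Nat.exists_eq_succ_of_ne_zero (hd i).out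
    rw [hm]
    obtain ⟨a, ha, hsum⟩ := exists_sum_eq m (1 : k) one_ne_zero
    exact ⟨matrix a ha hsum⟩
  exact ⟨(pi fun i => (h i).some).transport f.symm⟩

end SeparabilityIdempotent

end

/-! ### A generator of `C` and the conclusion -/

noncomputable section

open MonoidalLeftAction WeakBialgebra

namespace Reconstruction

/-- `G` is the sum of the chosen simple objects, and the identity of a sum of simples factors
summand by summand through `G`. -/
lemma exists_generator {C : Type u₁} [Category.{v₁} C] [Abelian C]
    (hC : IsFinitelySemisimple C) : ∃ G : C, ∀ X : C, ∃ (n : ℕ) (p : Fin n → (X ⟶ G))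
      (q : Fin n → (G ⟶ X)), ∑ j, p j ≫ q j = 𝟙 X := by
  have : Limits.HasFiniteBiproducts C := Abelian.hasFiniteBiproducts
  obtain ⟨n, S, -, hX⟩ := hC
  refine ⟨⨁ S, fun X => ?_⟩
  obtain ⟨m, f, ⟨e⟩⟩ := hX X
  refine ⟨m, fun j => e.hom ≫ Limits.biproduct.π _ j ≫ Limits.biproduct.ι S (f j),
    fun j => Limits.biproduct.π S (f j) ≫ Limits.biproduct.ι (fun j => S (f j)) j ≫ e.inv, ?_⟩
  have h : e.hom ≫ (∑ j, Limits.biproduct.π (fun j => S (f j)) j ≫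
      Limits.biproduct.ι (fun j => S (f j)) j) ≫ e.inv = 𝟙 X := by
    rw [Limits.biproduct.total, Category.id_comp, e.hom_inv_id]
  rw [Preadditive.sum_comp, Preadditive.comp_sum] at h
  simpa using h

/-- The coaction was defined as the section applied to `c(v ⊗ x)`, so pairing it gives back `c(v ⊗
x)`. -/
lemma FiberRep.IsReconstruction.isCanonical {k : Type u} [Field k] {R : Type w} [Ring R]
    [Algebra k R] {C : Type u₁} [Category.{v₁} C] [Preadditive C] [Linear k C] [MonoidalCategory C]
    [MonoidalLeftAction C (FGModuleCat.{w} R)] [BilinearAction k C (FGModuleCat.{w} R)]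
    [IsSemisimpleRing R] [FiniteDimensional k R] {S : SeparabilityIdempotent k R}
    [WeakBialgebra k (naturalEnd k R C)] (hρ : (naturalRep k R C).IsReconstruction S) :
    IsCanonical hρ.functor.asEquivalence := by
  refine ⟨fun T => hρ.comoduleEquiv T, fun T T' f v => hρ.comoduleEquiv_map f v,
    fun T v X x => ?_⟩
  refine (((naturalRep k R C).isCoact_coact S T).twist_eq (hρ.comoduleEquiv T v) X x).trans ?_
  have h1 := LinearMap.congr_fun (hρ.isColinear_comoduleEquiv T) v
  refine (congrArg (fun t => pairing k X _ (((naturalRep k R C).ev X x).rTensor _ t)) h1).trans ?_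
  exact congrArg (pairing k X _) (LinearMap.congr_fun (LinearMap.rTensor_comp_lTensor _ _ _)
    ((hρ.comodule T).coaction v))

end Reconstruction

end

theorem theorem5 {k : Type u} [Field k] [IsAlgClosed k]
    {C : Type u₁} [Category.{v₁} C] [Abelian C] [Linear k C]
    [MonoidalCategory C] [MonoidalPreadditive C] [MonoidalLinear k C]
    (hC : IsFinitelySemisimple C) (hfin : ∀ X Y : C, FiniteDimensional k (X ⟶ Y))
    {R : Type w} [Ring R] [Algebra k R] [FiniteDimensional k R] [IsSemisimpleRing R]
    [MonoidalLeftAction C (FGModuleCat.{w} R)] [BilinearAction k C (FGModuleCat.{w} R)] :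
    Nonempty (SeparabilityIdempotent k R) ∧
    ∀ e : SeparabilityIdempotent k R,
      (∃ _ : WeakBialgebra k (Reconstruction.naturalEnd k R C),
        Reconstruction.IsAttached (C := C) e) ∧
      ∀ [WeakBialgebra k (Reconstruction.naturalEnd k R C)],
        Reconstruction.IsAttached (C := C) e →
        ∃ E : ModuleEndofunctor k C (FGModuleCat.{w} R) ≌
            WeakBialgebra.LeftComodule k (Reconstruction.naturalEnd k R C),
          Nonempty E.functor.Monoidal ∧ Reconstruction.IsCanonical E := by
  refine ⟨nonempty_separabilityIdempotent R, fun e => ⟨?_, fun he => ?_⟩⟩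
  -- Finite semisimplicity of `C` enters through `G`: it makes `H` finite dimensional, as the
  -- construction of `Δ` requires.
  · obtain ⟨G, hG⟩ := Reconstruction.exists_generator hC
    have := Reconstruction.finiteDimensional_naturalEnd (k := k) (R := R) G hG
    exact Reconstruction.exists_weakBialgebra C e
  · have hρ := he.isReconstruction
    exact ⟨hρ.functor.asEquivalence, ⟨hρ.coreMonoidal.toMonoidal⟩, hρ.isCanonical⟩
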